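/- **Setting.** Let $\mathcal H=\bigoplus_{n\ge 0}\mathcal H_n$ be a graded connected Hopf algebra over $\mathbb C$ of finite type (each $\mathcal H_n$ is finite-dimensional, $\mathcal H_0=\mathbb C1$), with counit $\varepsilon$, and let $k\ge 0$. Let $\mathfrak g^{(k)}$ be the space of infinitesimal characters $Z:\mathcal H\to\mathbb C$, $Z(ab)=Z(a)\varepsilon(b)+\varepsilon(a)Z(b)$, that vanish in all degrees $>k$, with the bracket $Z\star W-W\star Z$ ($\star$ is convolution) in which all components of degree $>k$ are discarded. Let $G^{(k)}$ be the group of restrictions to degrees $\le k$ of characters of $\mathcal H$, under convolution; its Lie algebra is $\mathfrak g^{(k)}$. Let $\delta^{(k)}=\mathfrak g^{(k)}\oplus(\mathfrak g^{(k)})^*$ be the double with bracket $[(a,\alpha),(b,\beta)]=([a,b],\mathrm{ad}^*_a\beta-\mathrm{ad}^*_b\alpha)$ and natural pairing $\langle(a,\alpha),(b,\beta)\rangle=\beta(a)+\alpha(b)$, and let $\tilde G^{(k)}=G^{(k)}\ltimes_{\mathrm{Ad}^*}(\mathfrak g^{(k)})^*$ be its simply connected group. For a Lie algebra $\mathfrak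 l$, let $L\mathfrak l=\mathfrak l\otimes\mathbb C[\lambda,\lambda^{-1}]$ and $R=P_+-P_-$, where $P_+$ and $P_-$ are the projections of $L\mathfrak l$ onto the powers $\lambda^j$ with $j\ge0$ and with $j<0$. Let $L\tilde G^{(k)}$ and $LG^{(k)}$ be the groups of Laurent polynomial loops. Let $I:L(\delta^{(k)*})\to L\delta^{(k)}$, $\sum_i\xi_i\lambda^i\mapsto\sum_i\xi_i\lambda^{-1-i}$, where $\delta^{(k)*}=\delta^{(k)}$ by the pairing and $L(\delta^{(k)*})$ is the graded dual of $L\delta^{(k)}$. A *Casimir function* is a function $\psi:L\delta^{(k)}\to\mathbb C$ that is holomorphic on finite-dimensional subspaces, has its differentials $d\psi(L)$ in the graded dual, and is invariant under $\mathrm{Ad}$ of $L\tilde G^{(k)}$. A *Birkhoff factorization* of a loop $g$ is $g=g_-^{-1}g_+$ with $g_+$ holomorphic in $\lambda\in\mathbb C$ and $g_-$ a polynomial in $\lambda^{-1}$ with $g_-(\infty)=e$. A curve in $L\mathfrak l$ is differentiated with respect to all linear functionals, which means: locally of bounded order in $\lambda$, and coefficientwise. A curve is *the solution* of an initial value problem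 if it solves it on $\mathbb R$ and every solution on an open interval containing $0$ agrees with it there. **Theorem.** (0) For $m,n\in\mathbb Z$ the function $\psi_{m,n}(L)=\mathrm{Res}_{\lambda=0}\bigl(\lambda^m\langle\lambda^nL(\lambda),\lambda^nL(\lambda)\rangle\bigr)$ is a Casimir function on $L\delta^{(k)}$. Now let $\psi$ be any Casimir function on $L\delta^{(k)}$. (1) Let $L_0\in L\delta^{(k)}$ and $X=I(d\psi(L_0))$. For each $t\in\mathbb R$ the loop $\exp(-tX)$ has a unique Birkhoff factorization $\exp(-tX)=g_-(t)^{-1}g_+(t)$. The $g_\pm(t)$ are curves in $L\tilde G^{(k)}$, smooth in $t$, with $g_\pm(0)=e$. The solution in $L\delta^{(k)}$ of $$\frac{dL}{dt}=[L,M],\qquad M=\tfrac12R(I(d\psi(L))),\qquad L(0)=L_0,$$ is $L(t)=\mathrm{Ad}\,g_-(t)\cdot L_0=\mathrm{Ad}\,g_+(t)\cdot L_0$. With $\pi_1:L\delta^{(k)}\to L\mathfrak g^{(k)}$ the projection, $\pi_1(L(t))$ satisfies the Lax equation $\frac{d}{dt}\pi_1(L)=[\pi_1(L),\pi_1(M)]$.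 (2) Let $L_0\in L\mathfrak g^{(k)}\subset L\delta^{(k)}$ and $X=\pi_1(I(d\psi(L_0)))$. For each $t\in\mathbb R$ the loop $\exp(-tX)$ has a unique Birkhoff factorization $\exp(-tX)=g_-(t)^{-1}g_+(t)$ with values in $G^{(k)}$. The $g_\pm(t)$ are curves in $LG^{(k)}$, smooth in $t$, with $g_\pm(0)=e$. The solution in $L\mathfrak g^{(k)}$ of $$\frac{dL}{dt}=[L,M_1],\qquad M_1=\pi_1\bigl(\tfrac12R(I(d\psi(L)))\bigr),\qquad L(0)=L_0,$$ is $L(t)=\mathrm{Ad}\,g_-(t)\cdot L_0=\mathrm{Ad}\,g_+(t)\cdot L_0$. -/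

import Mathlib

open scoped TensorProduct

set_option linter.unusedSectionVars false
set_option linter.unnecessarySeqFocus false

noncomputable section

namespace HopfLax

/-! ### Graded connected Hopf algebras and truncated functionals -/

/-- A graded algebra `H = ⨁ 𝒜 n` that is a Hopf algebra is a *graded connected Hopf algebra* if the
coproduct and the counit respect the grading and `H₀ = ℂ 1`. (The antipode then respects the grading
automatically.) The algebra `H` is not assumed to be commutative. -/
class ConnectedGradedHopf {H : Type*} [Ring H] [HopfAlgebra ℂ H] (𝒜 : ℕ → Submodule ℂ H)
    [GradedAlgebra 𝒜] : Prop where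
  comul_mem : ∀ n : ℕ, ∀ h ∈ 𝒜 n, Coalgebra.comul (R := ℂ) h ∈
    ⨆ p ∈ Finset.HasAntidiagonal.antidiagonal n,
      LinearMap.range (TensorProduct.map (𝒜 p.1).subtype (𝒜 p.2).subtype)
  counit_eq_zero : ∀ n : ℕ, n ≠ 0 → ∀ h ∈ 𝒜 n, Coalgebra.counit (R := ℂ) h = 0
  connected : 𝒜 0 = Submodule.span ℂ {1}

section Truncation

variable {H : Type*} [Ring H] [HopfAlgebra ℂ H] (𝒜 : ℕ → Submodule ℂ H) [GradedAlgebra 𝒜] (k : ℕ)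

/-- The projection of `H` onto `⨁_{n ≤ k} H_n`. -/
def truncProj : H →ₗ[ℂ] H := ∑ n ∈ Finset.range (k + 1), GradedAlgebra.proj 𝒜 n

/-- The linear functionals on `H` that vanish in all degrees `> k`; equivalently the linear
functionals on `⨁_{n ≤ k} H_n`. -/
@[ext] structure TruncDual where
  toFun : Module.Dual ℂ H
  vanish : ∀ n : ℕ, k < n → ∀ h ∈ 𝒜 n, toFun h = 0

variable {𝒜 k}

lemma truncProj_of_le {n : ℕ} (hn : n ≤ k) {h : H} (hh : h ∈ 𝒜 n) : truncProj 𝒜 k h = h := by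
  classical
  simp only [truncProj, LinearMap.sum_apply, GradedAlgebra.proj_apply]
  rw [Finset.sum_eq_single n]
  · simp [DirectSum.decompose_of_mem_same 𝒜 hh]
  · intro m _ hm
    exact DirectSum.decompose_of_mem_ne 𝒜 hh (Ne.symm hm)
  · intro h'; exact absurd (Finset.mem_range.2 (by omega)) h'

lemma truncProj_of_lt {n : ℕ} (hn : k < n) {h : H} (hh : h ∈ 𝒜 n) : truncProj 𝒜 k h = 0 := by
  classical
  simp only [truncProj, LinearMap.sum_apply, GradedAlgebra.proj_apply]
  refine Finset.sum_eq_zero fun m hm => ?_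
  have := Finset.mem_range.1 hm
  exact DirectSum.decompose_of_mem_ne 𝒜 hh (by omega)

/-- Linear maps on `H` agree if they agree on homogeneous elements. -/
lemma hom_ext_graded {M : Type*} [AddCommMonoid M] [Module ℂ M] {f g : H →ₗ[ℂ] M}
    (hfg : ∀ n, ∀ h ∈ 𝒜 n, f h = g h) : f = g := by
  classical
  ext h
  induction h using DirectSum.Decomposition.inductionOn 𝒜 with
  | zero => simp
  | homogeneous x => exact hfg _ _ x.2
  | add x y hx hy => simp [hx, hy]

variable (𝒜 k) in
/-- Truncation of a functional to degrees `≤ k`. -/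
def trunc (f : Module.Dual ℂ H) : TruncDual 𝒜 k where
  toFun := f ∘ₗ truncProj 𝒜 k
  vanish n hn h hh := by simp [truncProj_of_lt hn hh]

lemma trunc_apply_of_le (f : Module.Dual ℂ H) {n : ℕ} (hn : n ≤ k) {h : H} (hh : h ∈ 𝒜 n) :
    (trunc 𝒜 k f).toFun h = f h := by simp [trunc, truncProj_of_le hn hh]

lemma TruncDual.ext_graded {f g : TruncDual 𝒜 k}
    (hfg : ∀ n ≤ k, ∀ h ∈ 𝒜 n, f.toFun h = g.toFun h) : f = g := by
  apply TruncDual.ext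
  apply hom_ext_graded (𝒜 := 𝒜)
  intro n h hh
  by_cases hn : n ≤ k
  · exact hfg n hn h hh
  · rw [f.vanish n (by omega) h hh, g.vanish n (by omega) h hh]

@[simp] lemma trunc_toFun (f : TruncDual 𝒜 k) : trunc 𝒜 k f.toFun = f :=
  TruncDual.ext_graded fun _ hn _ hh => trunc_apply_of_le _ hn hh

lemma trunc_eq_iff {f g : Module.Dual ℂ H} :
    trunc 𝒜 k f = trunc 𝒜 k g ↔ ∀ n ≤ k, ∀ h ∈ 𝒜 n, f h = g h := by
  constructor
  · intro e n hn h hh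
    rw [← trunc_apply_of_le f hn hh, e, trunc_apply_of_le g hn hh]
  · intro e
    refine TruncDual.ext_graded fun n hn h hh => ?_
    rw [trunc_apply_of_le f hn hh, trunc_apply_of_le g hn hh, e n hn h hh]

/-- The convolution product `(f ⋆ g)(h) = ⟨f ⊗ g, Δ h⟩` of two functionals. -/
def conv (f g : Module.Dual ℂ H) : Module.Dual ℂ H :=
  (WithConv.toConv f * WithConv.toConv g).ofConv

lemma conv_apply (f g : Module.Dual ℂ H) (h : H) :
    conv f g h = LinearMap.mul' ℂ ℂ (TensorProduct.map f g (Coalgebra.comul h)) := rfl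

/-- In degree `≤ k`, the convolution product depends only on the truncations. -/
lemma conv_congr [ConnectedGradedHopf 𝒜] {f f' g g' : Module.Dual ℂ H}
    (hf : ∀ n ≤ k, ∀ h ∈ 𝒜 n, f h = f' h) (hg : ∀ n ≤ k, ∀ h ∈ 𝒜 n, g h = g' h)
    {n : ℕ} (hn : n ≤ k) {h : H} (hh : h ∈ 𝒜 n) : conv f g h = conv f' g' h := by
  rw [conv_apply, conv_apply]
  congr 1
  have hmem := ConnectedGradedHopf.comul_mem n h hh
  have key : (⨆ p ∈ Finset.HasAntidiagonal.antidiagonal n,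
      LinearMap.range (TensorProduct.map (𝒜 p.1).subtype (𝒜 p.2).subtype)) ≤
      LinearMap.eqLocus (TensorProduct.map f g) (TensorProduct.map f' g') := by
    refine iSup₂_le fun p hp => ?_
    rintro _ ⟨x, rfl⟩
    have hp' := Finset.HasAntidiagonal.mem_antidiagonal.1 hp
    induction x using TensorProduct.induction_on with
    | zero => simp
    | tmul a b =>
      simp only [LinearMap.mem_eqLocus, TensorProduct.map_tmul, Submodule.subtype_apply]
      rw [hf p.1 (by omega) _ a.2, hg p.2 (by omega) _ b.2]
    | add x y hx hy => rw [map_add]; exact Submodule.add_mem _ hx hy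
  exact key hmem

namespace TruncDual

instance : Zero (TruncDual 𝒜 k) := ⟨⟨0, by simp⟩⟩
instance : Add (TruncDual 𝒜 k) :=
  ⟨fun f g => ⟨f.toFun + g.toFun, fun n hn h hh => by simp [f.vanish n hn h hh, g.vanish n hn h hh]⟩⟩
instance : Neg (TruncDual 𝒜 k) :=
  ⟨fun f => ⟨-f.toFun, fun n hn h hh => by simp [f.vanish n hn h hh]⟩⟩
instance : Sub (TruncDual 𝒜 k) :=
  ⟨fun f g => ⟨f.toFun - g.toFun, fun n hn h hh => by simp [f.vanish n hn h hh, g.vanish n hn h hh]⟩⟩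
instance {S : Type*} [Monoid S] [DistribMulAction S ℂ] [SMulCommClass ℂ S ℂ] :
    SMul S (TruncDual 𝒜 k) :=
  ⟨fun s f => ⟨s • f.toFun, fun n hn h hh => by simp [f.vanish n hn h hh]⟩⟩

lemma toFun_injective : Function.Injective (TruncDual.toFun (𝒜 := 𝒜) (k := k)) :=
  fun _ _ h => TruncDual.ext h

@[simp] lemma zero_toFun : (0 : TruncDual 𝒜 k).toFun = 0 := rfl
@[simp] lemma add_toFun (f g : TruncDual 𝒜 k) : (f + g).toFun = f.toFun + g.toFun := rfl
@[simp] lemma neg_toFun (f : TruncDual 𝒜 k) : (-f).toFun = -f.toFun := rfl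
@[simp] lemma sub_toFun (f g : TruncDual 𝒜 k) : (f - g).toFun = f.toFun - g.toFun := rfl
@[simp] lemma smul_toFun {S : Type*} [Monoid S] [DistribMulAction S ℂ] [SMulCommClass ℂ S ℂ]
    (s : S) (f : TruncDual 𝒜 k) : (s • f).toFun = s • f.toFun := rfl

instance : AddCommGroup (TruncDual 𝒜 k) :=
  toFun_injective.addCommGroup _ rfl (fun _ _ => rfl) (fun _ => rfl) (fun _ _ => rfl)
    (fun _ _ => rfl) (fun _ _ => rfl)

variable (𝒜 k) in
/-- The inclusion into the full dual. -/
def toDualHom : TruncDual 𝒜 k →+ Module.Dual ℂ H where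
  toFun := TruncDual.toFun
  map_zero' := rfl
  map_add' _ _ := rfl

instance : Module ℂ (TruncDual 𝒜 k) :=
  toFun_injective.module ℂ (toDualHom 𝒜 k) (fun _ _ => rfl)

/-- The unit of the truncated convolution algebra is the (truncated) counit. -/
instance : One (TruncDual 𝒜 k) := ⟨trunc 𝒜 k Coalgebra.counit⟩

/-- The product of the truncated convolution algebra: convolve, and forget all degrees `> k`. -/
instance : Mul (TruncDual 𝒜 k) := ⟨fun f g => trunc 𝒜 k (conv f.toFun g.toFun)⟩

lemma one_def : (1 : TruncDual 𝒜 k) = trunc 𝒜 k Coalgebra.counit := rfl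
lemma mul_def (f g : TruncDual 𝒜 k) : f * g = trunc 𝒜 k (conv f.toFun g.toFun) := rfl

lemma conv_counit (f : Module.Dual ℂ H) : conv f Coalgebra.counit = f :=
  congrArg WithConv.ofConv (mul_one (WithConv.toConv f))
lemma counit_conv (f : Module.Dual ℂ H) : conv Coalgebra.counit f = f :=
  congrArg WithConv.ofConv (one_mul (WithConv.toConv f))
lemma conv_assoc (f g h : Module.Dual ℂ H) : conv (conv f g) h = conv f (conv g h) :=
  congrArg WithConv.ofConv (mul_assoc (WithConv.toConv f) (WithConv.toConv g) (WithConv.toConv h))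
lemma conv_add (f g h : Module.Dual ℂ H) : conv f (g + h) = conv f g + conv f h :=
  congrArg WithConv.ofConv (mul_add (WithConv.toConv f) (WithConv.toConv g) (WithConv.toConv h))
lemma add_conv (f g h : Module.Dual ℂ H) : conv (f + g) h = conv f h + conv g h :=
  congrArg WithConv.ofConv (add_mul (WithConv.toConv f) (WithConv.toConv g) (WithConv.toConv h))
lemma smul_conv (c : ℂ) (f g : Module.Dual ℂ H) : conv (c • f) g = c • conv f g :=
  congrArg WithConv.ofConv (smul_mul_assoc c (WithConv.toConv f) (WithConv.toConv g))
lemma conv_smul (c : ℂ) (f g : Module.Dual ℂ H) : conv f (c • g) = c • conv f g :=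
  congrArg WithConv.ofConv (mul_smul_comm c (WithConv.toConv f) (WithConv.toConv g))

lemma trunc_add (f g : Module.Dual ℂ H) : trunc 𝒜 k (f + g) = trunc 𝒜 k f + trunc 𝒜 k g := rfl
lemma trunc_smul (c : ℂ) (f : Module.Dual ℂ H) : trunc 𝒜 k (c • f) = c • trunc 𝒜 k f := rfl
lemma trunc_sub (f g : Module.Dual ℂ H) : trunc 𝒜 k (f - g) = trunc 𝒜 k f - trunc 𝒜 k g := rfl

lemma trunc_conv [ConnectedGradedHopf 𝒜] (f g : Module.Dual ℂ H) :
    trunc 𝒜 k (conv f g) = trunc 𝒜 k f * trunc 𝒜 k g := by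
  rw [mul_def, trunc_eq_iff]
  intro n hn h hh
  exact conv_congr (fun m hm x hx => (trunc_apply_of_le _ hm hx).symm)
    (fun m hm x hx => (trunc_apply_of_le _ hm hx).symm) hn hh

instance [ConnectedGradedHopf 𝒜] : Ring (TruncDual 𝒜 k) where
  __ := (inferInstance : AddCommGroup (TruncDual 𝒜 k))
  mul_assoc f g h := by
    rw [← trunc_toFun f, ← trunc_toFun g, ← trunc_toFun h, ← trunc_conv, ← trunc_conv,
      ← trunc_conv, ← trunc_conv, conv_assoc]
  one_mul f := by
    rw [one_def]; nth_rw 1 [← trunc_toFun f]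
    rw [← trunc_conv, counit_conv, trunc_toFun]
  mul_one f := by
    rw [one_def]; nth_rw 1 [← trunc_toFun f]
    rw [← trunc_conv, conv_counit, trunc_toFun]
  left_distrib f g h := by simp only [mul_def, add_toFun, conv_add, trunc_add]
  right_distrib f g h := by simp only [mul_def, add_toFun, add_conv, trunc_add]
  zero_mul f := by
    have : conv (0 : Module.Dual ℂ H) f.toFun = 0 := by
      simpa using smul_conv (0 : ℂ) 0 f.toFun
    rw [mul_def, zero_toFun, this]; ext; simp [trunc]
  mul_zero f := by
    have : conv f.toFun (0 : Module.Dual ℂ H) = 0 := by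
      simpa using conv_smul (0 : ℂ) f.toFun 0
    rw [mul_def, zero_toFun, this]; ext; simp [trunc]
  neg_add_cancel := neg_add_cancel

instance [ConnectedGradedHopf 𝒜] : Algebra ℂ (TruncDual 𝒜 k) :=
  Algebra.ofModule
    (fun c f g => by simp only [mul_def, smul_toFun, smul_conv, trunc_smul])
    (fun c f g => by simp only [mul_def, smul_toFun, conv_smul, trunc_smul])

/-- The commutator bracket of the truncated convolution algebra. -/
instance [ConnectedGradedHopf 𝒜] : LieRing (TruncDual 𝒜 k) := LieRing.ofAssociativeRing

instance [ConnectedGradedHopf 𝒜] : LieAlgebra ℂ (TruncDual 𝒜 k) :=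
  LieAlgebra.ofAssociativeAlgebra

end TruncDual


/-! ### Characters and infinitesimal characters -/

/-- If `f(ab) = ∑ p_s(a) q_s(b)` and `g(ab) = ∑ p'_t(a) q'_t(b)`, the convolution product `f ⋆ g`
satisfies the corresponding product formula, because `Δ` is multiplicative. -/
lemma conv_mul_formula {ι κ : Type*} [Fintype ι] [Fintype κ] {f g : Module.Dual ℂ H}
    {p q : ι → Module.Dual ℂ H} {p' q' : κ → Module.Dual ℂ H}
    (hf : ∀ a b, f (a * b) = ∑ s, p s a * q s b) (hg : ∀ a b, g (a * b) = ∑ t, p' t a * q' t b)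
    (a b : H) : conv f g (a * b) = ∑ s, ∑ t, conv (p s) (p' t) a * conv (q s) (q' t) b := by
  have hab : conv f g (a * b) = ∑ i ∈ (Coalgebra.Repr.arbitrary ℂ a).index,
      ∑ j ∈ (Coalgebra.Repr.arbitrary ℂ b).index,
        f ((Coalgebra.Repr.arbitrary ℂ a).left i * (Coalgebra.Repr.arbitrary ℂ b).left j) *
        g ((Coalgebra.Repr.arbitrary ℂ a).right i * (Coalgebra.Repr.arbitrary ℂ b).right j) := by
    rw [conv_apply, Bialgebra.comul_mul, ← (Coalgebra.Repr.arbitrary ℂ a).eq,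
      ← (Coalgebra.Repr.arbitrary ℂ b).eq, Finset.sum_mul_sum]
    simp
  have ha := fun s t => (Coalgebra.Repr.arbitrary ℂ a).convMul_apply
    (WithConv.toConv (p s)) (WithConv.toConv (p' t))
  have hb := fun s t => (Coalgebra.Repr.arbitrary ℂ b).convMul_apply
    (WithConv.toConv (q s)) (WithConv.toConv (q' t))
  have e2 : ∀ s t, conv (p s) (p' t) a = (WithConv.toConv (p s) * WithConv.toConv (p' t)) a :=
    fun _ _ => rfl
  have e3 : ∀ s t, conv (q s) (q' t) b = (WithConv.toConv (q s) * WithConv.toConv (q' t)) b :=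
    fun _ _ => rfl
  simp only [e2, e3, ha, hb, hab, hf, hg, Finset.sum_mul_sum]
  have swap : ∀ F : ι → κ → _ → _ → ℂ,
      ∑ i ∈ (Coalgebra.Repr.arbitrary ℂ a).index, ∑ j ∈ (Coalgebra.Repr.arbitrary ℂ b).index,
        ∑ s, ∑ t, F s t i j =
      ∑ s, ∑ t, ∑ i ∈ (Coalgebra.Repr.arbitrary ℂ a).index,
        ∑ j ∈ (Coalgebra.Repr.arbitrary ℂ b).index, F s t i j := by
    intro F
    simp only [Finset.sum_comm (s := (Coalgebra.Repr.arbitrary ℂ b).index) (t := Finset.univ),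
      Finset.sum_comm (s := (Coalgebra.Repr.arbitrary ℂ a).index) (t := Finset.univ)]
  rw [swap]
  refine Finset.sum_congr rfl fun s _ => Finset.sum_congr rfl fun t _ =>
    Finset.sum_congr rfl fun i _ => Finset.sum_congr rfl fun j _ => ?_
  ring

/-- A functional `D` with `D(ab) = D(a) φ(b) + φ(a) D(b)` for a character `φ`; for `φ = ε` this is an
infinitesimal character. -/
def IsDerAlong (φ : H →ₐ[ℂ] ℂ) (D : Module.Dual ℂ H) : Prop :=
  ∀ a b, D (a * b) = D a * φ b + φ a * D b

/-- An infinitesimal character of `H`: `Z(ab) = Z(a) ε(b) + ε(a) Z(b)`. -/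
def IsInfChar (Z : Module.Dual ℂ H) : Prop :=
  ∀ a b, Z (a * b) = Z a * Coalgebra.counit (R := ℂ) b + Coalgebra.counit (R := ℂ) a * Z b

/-- The convolution product of two characters is a character. -/
def convChar (φ χ : H →ₐ[ℂ] ℂ) : H →ₐ[ℂ] ℂ :=
  (WithConv.toConv φ * WithConv.toConv χ).ofConv

lemma convChar_toLinearMap (φ χ : H →ₐ[ℂ] ℂ) :
    (convChar φ χ).toLinearMap = conv φ.toLinearMap χ.toLinearMap := rfl

/-- The inverse `φ ∘ S` of a character `φ`. -/
def invChar (φ : H →ₐ[ℂ] ℂ) : H →ₐ[ℂ] ℂ :=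
  AlgHom.ofLinearMap (φ.toLinearMap ∘ₗ HopfAlgebra.antipode ℂ)
    (by simp) (fun a b => by simp [HopfAlgebra.antipode_mul_antidistrib, mul_comm])

lemma conv_invChar (φ : H →ₐ[ℂ] ℂ) :
    conv φ.toLinearMap (invChar φ).toLinearMap = Coalgebra.counit := by
  ext h
  have e := (Coalgebra.Repr.arbitrary ℂ h).convMul_apply
    (WithConv.toConv φ.toLinearMap) (WithConv.toConv (invChar φ).toLinearMap)
  have e' := congrArg φ
    (HopfAlgebra.sum_mul_antipode_eq_algebraMap_counit (Coalgebra.Repr.arbitrary ℂ h))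
  simp only [map_sum, map_mul, AlgHom.commutes, Algebra.algebraMap_self, RingHom.id_apply] at e'
  exact e.trans e'

lemma invChar_conv (φ : H →ₐ[ℂ] ℂ) :
    conv (invChar φ).toLinearMap φ.toLinearMap = Coalgebra.counit := by
  ext h
  have e := (Coalgebra.Repr.arbitrary ℂ h).convMul_apply
    (WithConv.toConv (invChar φ).toLinearMap) (WithConv.toConv φ.toLinearMap)
  have e' := congrArg φ
    (HopfAlgebra.sum_antipode_mul_eq_algebraMap_counit (Coalgebra.Repr.arbitrary ℂ h))
  simp only [map_sum, map_mul, AlgHom.commutes, Algebra.algebraMap_self, RingHom.id_apply] at e'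
  exact e.trans e'


/-- The counit as a character (the unit of the character group). -/
def counitChar : H →ₐ[ℂ] ℂ := Bialgebra.counitAlgHom ℂ H

lemma IsInfChar.isDerAlong {Z : Module.Dual ℂ H} (hZ : IsInfChar Z) : IsDerAlong counitChar Z := hZ

lemma IsDerAlong.conv_char {φ : H →ₐ[ℂ] ℂ} {D : Module.Dual ℂ H} (hD : IsDerAlong φ D)
    (χ : H →ₐ[ℂ] ℂ) : IsDerAlong (convChar φ χ) (conv D χ.toLinearMap) := by
  intro a b
  rw [conv_mul_formula (p := ![D, φ.toLinearMap]) (q := ![φ.toLinearMap, D])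
    (p' := fun _ : Unit => χ.toLinearMap) (q' := fun _ => χ.toLinearMap)
    (fun x y => by simpa [Fin.sum_univ_two] using hD x y) (by simp) a b]
  simp [Fin.sum_univ_two, ← convChar_toLinearMap]

lemma IsDerAlong.char_conv {φ : H →ₐ[ℂ] ℂ} {D : Module.Dual ℂ H} (hD : IsDerAlong φ D)
    (χ : H →ₐ[ℂ] ℂ) : IsDerAlong (convChar χ φ) (conv χ.toLinearMap D) := by
  intro a b
  rw [conv_mul_formula (p' := ![D, φ.toLinearMap]) (q' := ![φ.toLinearMap, D])
    (p := fun _ : Unit => χ.toLinearMap) (q := fun _ => χ.toLinearMap)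
    (by simp) (fun x y => by simpa [Fin.sum_univ_two] using hD x y) a b]
  simp [Fin.sum_univ_two, ← convChar_toLinearMap]

/-- Conjugation by a character preserves infinitesimal characters. -/
lemma IsInfChar.conj {Z : Module.Dual ℂ H} (hZ : IsInfChar Z) (φ : H →ₐ[ℂ] ℂ) :
    IsInfChar (conv (conv φ.toLinearMap Z) (invChar φ).toLinearMap) := by
  have h := (hZ.isDerAlong.char_conv φ).conv_char (invChar φ)
  have e : convChar (convChar φ counitChar) (invChar φ) = counitChar := by
    apply AlgHom.toLinearMap_injective
    have e0 : (counitChar (H := H)).toLinearMap = Coalgebra.counit := rfl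
    rw [convChar_toLinearMap, convChar_toLinearMap, e0, TruncDual.conv_counit, conv_invChar]
  rw [e] at h
  exact h

/-- The bracket `Z ⋆ W - W ⋆ Z` of infinitesimal characters is an infinitesimal character. -/
lemma IsInfChar.bracket {Z W : Module.Dual ℂ H} (hZ : IsInfChar Z) (hW : IsInfChar W) :
    IsInfChar (conv Z W - conv W Z) := by
  intro a b
  have h1 := conv_mul_formula (p := ![Z, Coalgebra.counit]) (q := ![Coalgebra.counit, Z])
    (p' := ![W, Coalgebra.counit]) (q' := ![Coalgebra.counit, W])
    (fun x y => by simpa [Fin.sum_univ_two] using hZ x y) (fun x y => by simpa [Fin.sum_univ_two] using hW x y) a b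
  have h2 := conv_mul_formula (p := ![W, Coalgebra.counit]) (q := ![Coalgebra.counit, W])
    (p' := ![Z, Coalgebra.counit]) (q' := ![Coalgebra.counit, Z])
    (fun x y => by simpa [Fin.sum_univ_two] using hW x y) (fun x y => by simpa [Fin.sum_univ_two] using hZ x y) a b
  simp only [Fin.sum_univ_two, Matrix.cons_val_zero, Matrix.cons_val_one, TruncDual.conv_counit,
    TruncDual.counit_conv] at h1 h2
  simp only [LinearMap.sub_apply, h1, h2]
  ring

variable [ConnectedGradedHopf 𝒜]

/-- The truncation of an infinitesimal character is an infinitesimal character. -/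
lemma IsInfChar.trunc {Z : Module.Dual ℂ H} (hZ : IsInfChar Z) :
    IsInfChar (HopfLax.trunc 𝒜 k Z).toFun := by
  classical
  suffices hom : ∀ m, ∀ a ∈ 𝒜 m, ∀ n, ∀ b ∈ 𝒜 n, (HopfLax.trunc 𝒜 k Z).toFun (a * b) =
      (HopfLax.trunc 𝒜 k Z).toFun a * Coalgebra.counit (R := ℂ) b +
        Coalgebra.counit (R := ℂ) a * (HopfLax.trunc 𝒜 k Z).toFun b by
    intro a b
    induction a using DirectSum.Decomposition.inductionOn 𝒜 with
    | zero => simp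
    | add x y hx hy => simp only [add_mul, map_add, hx, hy]; ring
    | homogeneous x =>
      induction b using DirectSum.Decomposition.inductionOn 𝒜 with
      | zero => simp
      | add x y hx hy => simp only [mul_add, map_add, hx, hy]; ring
      | homogeneous y => exact hom _ _ x.2 _ _ y.2
  intro m a ha n b hb
  have hab : a * b ∈ 𝒜 (m + n) := SetLike.mul_mem_graded ha hb
  have tr : ∀ d, ∀ x ∈ 𝒜 d, (HopfLax.trunc 𝒜 k Z).toFun x = if d ≤ k then Z x else 0 := by
    intro d x hx
    split_ifs with hd
    · exact trunc_apply_of_le _ hd hx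
    · exact (HopfLax.trunc 𝒜 k Z).vanish d (by omega) x hx
  rw [tr _ _ hab, tr _ _ ha, tr _ _ hb, hZ a b]
  rcases Nat.eq_zero_or_pos m with rfl | hm
  · rcases Nat.eq_zero_or_pos n with rfl | hn
    · simp
    · rw [ConnectedGradedHopf.counit_eq_zero n (by omega) b hb]
      simp
  · rw [ConnectedGradedHopf.counit_eq_zero m (by omega) a ha]
    rcases Nat.eq_zero_or_pos n with rfl | hn
    · simp
    · rw [ConnectedGradedHopf.counit_eq_zero n (by omega) b hb]
      simp

variable (𝒜 k)

/-- The truncated Lie algebra `𝔤⁽ᵏ⁾`: the infinitesimal characters of `H` that vanish in all degrees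
`> k` (equivalently, the span of the infinitesimal characters `Z_i` dual to a minimal set of
homogeneous generators `T_i` with `deg T_i ≤ k`). The bracket is `Z ⋆ W - W ⋆ Z` with
all components in degree `> k` discarded, i.e. for homogeneous `Z`, `W` it is the bracket of
infinitesimal characters if `deg Z + deg W ≤ k`, and `0` otherwise. -/
def truncLie : LieSubalgebra ℂ (TruncDual 𝒜 k) where
  carrier := {Z | IsInfChar Z.toFun}
  zero_mem' := fun a b => by simp
  add_mem' := fun {Z W} hZ hW a b => by
    simp only [TruncDual.add_toFun, LinearMap.add_apply, hZ a b, hW a b]; ring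
  smul_mem' := fun c Z hZ a b => by
    simp only [TruncDual.smul_toFun, LinearMap.smul_apply, hZ a b, smul_eq_mul]; ring
  lie_mem' := fun {Z W} hZ hW => by
    have h := (IsInfChar.bracket hZ hW).trunc (𝒜 := 𝒜) (k := k)
    exact h

/-- The truncated group `G⁽ᵏ⁾`: restrictions of complex characters of `H` to degrees `≤ k`, with the
convolution product. -/
def truncGroup : Subgroup (TruncDual 𝒜 k)ˣ where
  carrier := {u | ∃ φ : H →ₐ[ℂ] ℂ, (u : TruncDual 𝒜 k) = trunc 𝒜 k φ.toLinearMap}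
  one_mem' := ⟨counitChar, rfl⟩
  mul_mem' := by
    rintro u v ⟨φ, hφ⟩ ⟨χ, hχ⟩
    exact ⟨convChar φ χ, by
      rw [Units.val_mul, hφ, hχ, convChar_toLinearMap, TruncDual.trunc_conv]⟩
  inv_mem' := by
    rintro u ⟨φ, hφ⟩
    refine ⟨invChar φ, ?_⟩
    rw [← Units.mul_right_inj u, Units.mul_inv, hφ, ← TruncDual.trunc_conv, conv_invChar]
    rfl


/-- Evaluation of truncated functionals in degrees `≤ k` is injective. -/
instance [∀ n, FiniteDimensional ℂ (𝒜 n)] : FiniteDimensional ℂ (TruncDual 𝒜 k) := by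
  let ev : TruncDual 𝒜 k →ₗ[ℂ] ((n : Fin (k + 1)) → Module.Dual ℂ (𝒜 n)) :=
    { toFun := fun f n => f.toFun ∘ₗ (𝒜 n).subtype
      map_add' := fun f g => rfl
      map_smul' := fun c f => rfl }
  refine FiniteDimensional.of_injective ev fun f g hfg => TruncDual.ext_graded fun n hn h hh => ?_
  exact LinearMap.congr_fun (congrFun hfg ⟨n, by omega⟩) ⟨h, hh⟩

/-- The adjoint action `Ad_g Z = g ⋆ Z ⋆ g⁻¹` of `G⁽ᵏ⁾` on `𝔤⁽ᵏ⁾`. -/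
def groupAd : truncGroup 𝒜 k →* Module.End ℂ (truncLie 𝒜 k) where
  toFun g :=
    { toFun := fun Z => ⟨(g : (TruncDual 𝒜 k)ˣ) * (Z : TruncDual 𝒜 k) *
          ((g⁻¹ : truncGroup 𝒜 k) : (TruncDual 𝒜 k)ˣ), by
        obtain ⟨u, φ, hφ⟩ := g
        have hinv : ((u⁻¹ : (TruncDual 𝒜 k)ˣ) : TruncDual 𝒜 k) =
            trunc 𝒜 k (invChar φ).toLinearMap := by
          rw [← Units.mul_right_inj u, Units.mul_inv, hφ, ← TruncDual.trunc_conv, conv_invChar]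
          rfl
        have h := ((show IsInfChar Z.1.toFun from Z.2).conj φ).trunc (𝒜 := 𝒜) (k := k)
        rw [TruncDual.trunc_conv, TruncDual.trunc_conv, ← hφ, ← hinv, trunc_toFun] at h
        exact h⟩
      map_add' := fun Z W => Subtype.ext (by simp [mul_add, add_mul])
      map_smul' := fun c Z => Subtype.ext (by simp) }
  map_one' := by ext Z : 1; exact Subtype.ext (by simp)
  map_mul' g g' := by ext Z : 1; exact Subtype.ext (by simp [mul_assoc])

/-- The coadjoint action `Ad*_g ξ = ξ ∘ Ad_{g⁻¹}`. -/
def groupCoAd (g : truncGroup 𝒜 k) (ξ : Module.Dual ℂ (truncLie 𝒜 k)) :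
    Module.Dual ℂ (truncLie 𝒜 k) := ξ ∘ₗ groupAd 𝒜 k g⁻¹

/-- The group `G̃⁽ᵏ⁾ = G⁽ᵏ⁾ ⋉ (𝔤⁽ᵏ⁾)*` for the coadjoint representation. -/
@[ext] structure DoubleGroup where
  base : truncGroup 𝒜 k
  vec : Module.Dual ℂ (truncLie 𝒜 k)

variable {𝒜 k}

namespace DoubleGroup

/-- `(g, α) (g', α') = (g g', α + Ad*_g α')`. -/
instance : Mul (DoubleGroup 𝒜 k) := ⟨fun x y => ⟨x.base * y.base, x.vec + groupCoAd 𝒜 k x.base y.vec⟩⟩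
instance : One (DoubleGroup 𝒜 k) := ⟨⟨1, 0⟩⟩
instance : Inv (DoubleGroup 𝒜 k) := ⟨fun x => ⟨x.base⁻¹, -groupCoAd 𝒜 k x.base⁻¹ x.vec⟩⟩

instance : Group (DoubleGroup 𝒜 k) :=
  Group.ofLeftAxioms
    (fun x y z => by
      refine DoubleGroup.ext (mul_assoc _ _ _) ?_
      change x.vec + _ + groupCoAd 𝒜 k (x.base * y.base) z.vec =
        x.vec + groupCoAd 𝒜 k x.base (y.vec + groupCoAd 𝒜 k y.base z.vec)
      ext Z
      simp [groupCoAd, add_assoc])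
    (fun x => by
      refine DoubleGroup.ext (one_mul _) ?_
      change 0 + groupCoAd 𝒜 k 1 x.vec = x.vec
      ext Z
      simp [groupCoAd])
    (fun x => by
      refine DoubleGroup.ext (inv_mul_cancel _) ?_
      change -groupCoAd 𝒜 k x.base⁻¹ x.vec + groupCoAd 𝒜 k x.base⁻¹ x.vec = 0
      simp)

end DoubleGroup

end Truncation

/-! ### The double of a Lie algebra -/

section Double

variable (𝔤 : Type*) [LieRing 𝔤] [LieAlgebra ℂ 𝔤]

/-- The double `δ = 𝔤 ⊕ 𝔤*` of a Lie algebra (for the zero cocycle). -/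
@[ext] structure Double where
  fst : 𝔤
  snd : Module.Dual ℂ 𝔤

variable {𝔤}

namespace Double

/-- The underlying pair. -/
def toProd : Double 𝔤 ≃ 𝔤 × Module.Dual ℂ 𝔤 where
  toFun x := (x.fst, x.snd)
  invFun x := ⟨x.1, x.2⟩
  left_inv _ := rfl
  right_inv _ := rfl

instance : AddCommGroup (Double 𝔤) := toProd.addCommGroup
instance : Module ℂ (Double 𝔤) := toProd.module ℂ

/-- The underlying pair, linearly. -/
def toProdL : Double 𝔤 ≃ₗ[ℂ] 𝔤 × Module.Dual ℂ 𝔤 :=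
  { toProd with
    map_add' := fun _ _ => rfl
    map_smul' := fun _ _ => rfl }

instance [FiniteDimensional ℂ 𝔤] : FiniteDimensional ℂ (Double 𝔤) :=
  toProdL.symm.finiteDimensional

@[simp] lemma zero_fst : (0 : Double 𝔤).fst = 0 := rfl
@[simp] lemma zero_snd : (0 : Double 𝔤).snd = 0 := rfl
@[simp] lemma add_fst (x y : Double 𝔤) : (x + y).fst = x.fst + y.fst := rfl
@[simp] lemma add_snd (x y : Double 𝔤) : (x + y).snd = x.snd + y.snd := rfl
@[simp] lemma smul_fst (c : ℂ) (x : Double 𝔤) : (c • x).fst = c • x.fst := rfl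
@[simp] lemma smul_snd (c : ℂ) (x : Double 𝔤) : (c • x).snd = c • x.snd := rfl

/-- `[(a, α), (b, β)] = ([a, b], ad*_a β - ad*_b α)` with `(ad*_a β)(c) = -β([a, c])`. -/
instance : Bracket (Double 𝔤) (Double 𝔤) :=
  ⟨fun x y => ⟨⁅x.fst, y.fst⁆, ⁅x.fst, y.snd⁆ - ⁅y.fst, x.snd⁆⟩⟩

@[simp] lemma lie_fst (x y : Double 𝔤) : ⁅x, y⁆.fst = ⁅x.fst, y.fst⁆ := rfl
@[simp] lemma lie_snd (x y : Double 𝔤) : ⁅x, y⁆.snd = ⁅x.fst, y.snd⁆ - ⁅y.fst, x.snd⁆ := rfl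

instance : LieRing (Double 𝔤) where
  add_lie x y z := by ext <;> simp <;> ring
  lie_add x y z := by ext <;> simp <;> ring
  lie_self x := by ext <;> simp
  leibniz_lie x y z := by ext <;> simp <;> ring

instance : LieAlgebra ℂ (Double 𝔤) where
  lie_smul c x y := by ext <;> simp <;> ring

/-- The inclusion `𝔤 ⊂ δ`. -/
def inl : 𝔤 →ₗ[ℂ] Double 𝔤 where
  toFun a := ⟨a, 0⟩
  map_add' a b := by ext <;> simp
  map_smul' c a := by ext <;> simp

/-- The inclusion `𝔤* ⊂ δ`. -/
def inr : Module.Dual ℂ 𝔤 →ₗ[ℂ] Double 𝔤 where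
  toFun a := ⟨0, a⟩
  map_add' a b := by ext <;> simp
  map_smul' c a := by ext <;> simp

/-- The projection `π₁ : δ → 𝔤`. -/
def proj : Double 𝔤 →ₗ[ℂ] 𝔤 where
  toFun := fst
  map_add' _ _ := rfl
  map_smul' _ _ := rfl

/-- The natural pairing `⟨(a, b*), (c, d*)⟩ = d*(a) + b*(c)`. -/
def pairing (x y : Double 𝔤) : ℂ := y.snd x.fst + x.snd y.fst

/-- The identification `δ* = δ` given by the natural pairing. -/
def sharp [FiniteDimensional ℂ 𝔤] (f : Module.Dual ℂ (Double 𝔤)) : Double 𝔤 :=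
  ⟨(Module.evalEquiv ℂ 𝔤).symm (f ∘ₗ inr), f ∘ₗ inl⟩

lemma pairing_sharp [FiniteDimensional ℂ 𝔤] (f : Module.Dual ℂ (Double 𝔤)) (y : Double 𝔤) :
    pairing (sharp f) y = f y := by
  have h1 : y.snd (sharp f).fst = f (inr y.snd) := by
    exact Module.apply_evalEquiv_symm_apply ℂ 𝔤 y.snd (f ∘ₗ inr)
  have h2 : y = inr y.snd + inl y.fst := by ext <;> simp [inl, inr]
  rw [pairing, h1]
  conv_rhs => rw [h2, map_add]
  rfl

end Double

end Double

/-! ### Loop algebras -/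

section Loop

/-- The loop algebra `L𝔩 = 𝔩 ⊗ ℂ[λ, λ⁻¹]`. -/
abbrev Loop (𝔩 : Type*) [LieRing 𝔩] [LieAlgebra ℂ 𝔩] := LieAlgebra.loopAlgebra ℂ ℤ 𝔩

variable {𝔩 : Type*} [LieRing 𝔩] [LieAlgebra ℂ 𝔩]

/-- The (finitely many) coefficients `L_j` of `L(λ) = ∑ λ^j L_j`. -/
def coeffs (L : Loop 𝔩) : ℤ →₀ 𝔩 := LieAlgebra.LoopAlgebra.toFinsupp ℂ ℤ 𝔩 L

/-- The loop with given coefficients. -/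
def ofCoeffs (c : ℤ →₀ 𝔩) : Loop 𝔩 := (LieAlgebra.LoopAlgebra.toFinsupp ℂ ℤ 𝔩).symm c

/-- The value `L(λ) ∈ 𝔩` for `λ ∈ ℂ ∖ {0}`. -/
def evalLoop (z : ℂˣ) (L : Loop 𝔩) : 𝔩 := (coeffs L).sum fun n x => ((z ^ n : ℂˣ) : ℂ) • x

/-- The projection `P₊` onto the powers `λ^j` with `j ≥ 0`. -/
def posPart (L : Loop 𝔩) : Loop 𝔩 := ofCoeffs ((coeffs L).filter (fun n => 0 ≤ n))

/-- The projection `P₋` onto the powers `λ^j` with `j < 0`. -/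
def negPart (L : Loop 𝔩) : Loop 𝔩 := ofCoeffs ((coeffs L).filter (fun n => n < 0))

/-- `R = P₊ - P₋`. -/
def rMat (L : Loop 𝔩) : Loop 𝔩 := posPart L - negPart L

/-- A linear map applied to the coefficients of a loop. -/
def mapLoop {𝔩' : Type*} [LieRing 𝔩'] [LieAlgebra ℂ 𝔩'] (f : 𝔩 →ₗ[ℂ] 𝔩') : Loop 𝔩 →ₗ[ℂ] Loop 𝔩' :=
  LinearMap.lTensor (AddMonoidAlgebra ℂ ℤ) f

/-- The action on `L𝔩` of an element of the graded dual `L(𝔩*)`, where the degree `i` part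
`ξ_i ∈ 𝔩*` acts on the coefficient of `λ^i`. -/
def gradedDualApply (ξ : ℤ →₀ Module.Dual ℂ 𝔩) (Y : Loop 𝔩) : ℂ := ξ.sum fun i f => f (coeffs Y i)

variable {𝔤 : Type*} [LieRing 𝔤] [LieAlgebra ℂ 𝔤]

/-- The pairing `⟨∑ λ^i L_i, ∑ λ^j L'_j⟩ = ∑_{i+j=-1} ⟨L_i, L'_j⟩` on `Lδ`. -/
def loopPairing (L L' : Loop (Double 𝔤)) : ℂ :=
  (coeffs L).sum fun i a => Double.pairing a (coeffs L' (-1 - i))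

/-- The isomorphism `I : L(δ*) → Lδ`, `∑ ξ_i λ^i ↦ ∑ ξ_i λ^{-1-i}` where `δ*` is identified with `δ`
by the natural pairing; it satisfies `⟨I ξ, Y⟩ = ξ(Y)`. -/
def gradIso [FiniteDimensional ℂ 𝔤] (ξ : ℤ →₀ Module.Dual ℂ (Double 𝔤)) : Loop (Double 𝔤) :=
  ofCoeffs (ξ.sum fun i f => Finsupp.single (-1 - i) (Double.sharp f))

/-- The Laurent polynomial `λ ↦ ⟨L(λ), L(λ)⟩`. -/
def loopSquare (L : Loop (Double 𝔤)) : LaurentPolynomial ℂ :=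
  (coeffs L).sum fun i a => (coeffs L).sum fun j b =>
    LaurentPolynomial.C (Double.pairing a b) * LaurentPolynomial.T (i + j)

/-- The quadratic functions `ψ_{m,n}(L) = Res_{λ=0} (λ^m ψ(λ^n L(λ)))`, `ψ(Y) = ⟨Y, Y⟩`. -/
def resCasimir (m n : ℤ) (L : Loop (Double 𝔤)) : ℂ :=
  (LaurentPolynomial.T m *
    loopSquare ((LaurentPolynomial.T n : AddMonoidAlgebra ℂ ℤ) • L)).coeff (-1)

end Loop

/-! ### Calculus on complex vector spaces, and differential equations -/

section Calculus

variable {V : Type*} [AddCommGroup V] [Module ℂ V]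

/-- The curve `c` in `V` has derivative `v` at `t`: every linear functional of `c` is differentiable
with the corresponding derivative. For finite-dimensional `V` this is ordinary differentiability.
For `V = L𝔩` a curve that is differentiable in this sense stays, locally in `t`, within
loops of bounded order, and it is differentiated coefficientwise. -/
def HasVelocity (c : ℝ → V) (v : V) (t : ℝ) : Prop :=
  ∀ l : Module.Dual ℂ V, HasDerivAt (fun s => l (c s)) (l v) t

/-- `c : ℝ → V` is the solution of `dv/dt = F(v)`, `v(0) = v₀`: it solves the initial value problem
on `ℝ`, and any solution on an open interval around `0` agrees with it there. -/
def IsTheSolution (F : V → V) (v₀ : V) (c : ℝ → V) : Prop :=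
  c 0 = v₀ ∧ (∀ t, HasVelocity c (F (c t)) t) ∧
    ∀ a b : ℝ, a < 0 → 0 < b → ∀ c' : ℝ → V, c' 0 = v₀ →
      (∀ t ∈ Set.Ioo a b, HasVelocity c' (F (c' t)) t) → ∀ t ∈ Set.Ioo a b, c' t = c t

/-- `ψ : V → ℂ` is holomorphic on every finite-dimensional subspace. -/
def IsHolomorphic (ψ : V → ℂ) : Prop :=
  ∀ (n : ℕ) (v : Fin n → V), Differentiable ℂ fun x : Fin n → ℂ => ψ (∑ i, x i • v i)

end Calculus

/-! ### Loops in groups with global coordinates -/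

section Coordinates

/-- A system of global coordinate functions on a group `Γ`, together with their differentials at the
unit element as linear functions on the Lie algebra `𝔩`. -/
structure Coords (ι Γ 𝔩 : Type*) where
  coord : ι → Γ → ℂ
  tangent : ι → 𝔩 → ℂ

variable {ι Γ 𝔩 : Type*} [Group Γ] (K : Coords ι Γ 𝔩)

/-- `g = exp X`: there is a one-parameter subgroup `γ` with `γ'(0) = X` and `γ(1) = g`. -/
def IsExp (X : 𝔩) (g : Γ) : Prop :=
  ∃ γ : ℝ → Γ, (∀ s t, γ (s + t) = γ s * γ t) ∧
    (∀ i, HasDerivAt (fun t => K.coord i (γ t)) (K.tangent i X) 0) ∧ γ 1 = g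

/-- The loop `g` is a Laurent polynomial in `λ`, i.e. it belongs to the loop group `LΓ`. -/
def IsLaurentLoop (g : ℂˣ → Γ) : Prop :=
  ∀ i, ∃ p : LaurentPolynomial ℂ, ∀ z : ℂˣ,
    K.coord i (g z) = p.eval₂ (RingHom.id ℂ) z

/-- The loop `g` extends holomorphically to `λ ∈ ℂ`. -/
def IsPlusLoop (g : ℂˣ → Γ) : Prop :=
  ∀ i, ∃ f : ℂ → ℂ, Differentiable ℂ f ∧ ∀ z : ℂˣ, K.coord i (g z) = f z

/-- The loop `g` is a polynomial in `λ⁻¹` without constant term, up to the unit element: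
`g(∞) = e`. -/
def IsMinusLoop (g : ℂˣ → Γ) : Prop :=
  ∀ i, ∃ p : Polynomial ℂ, p.coeff 0 = 0 ∧
    ∀ z : ℂˣ, K.coord i (g z) = K.coord i 1 + p.eval ((z⁻¹ : ℂˣ) : ℂ)

variable [LieRing 𝔩] [LieAlgebra ℂ 𝔩]

/-- `exp(X) = g₋⁻¹ g₊` is a Birkhoff factorization, for `X ∈ L𝔩`. -/
def IsBirkhoff (X : Loop 𝔩) (gm gp : ℂˣ → Γ) : Prop :=
  IsMinusLoop K gm ∧ IsPlusLoop K gp ∧ ∀ z : ℂˣ, IsExp K (evalLoop z X) ((gm z)⁻¹ * gp z)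

/-- The loops `exp(-tX)`, `t ∈ ℝ`, have unique Birkhoff factorizations `g₋(t)⁻¹ g₊(t)`; these are
smooth curves of Laurent polynomial loops with `g₋(0) = g₊(0) = e`; and the solution of
`dL/dt = F(L)`, `L(0) = L₀`, is `L(t) = Ad_{g₋(t)} L₀ = Ad_{g₊(t)} L₀`. -/
def SolvedByFactorization (Ad : Γ → 𝔩 → 𝔩) (X : Loop 𝔩) (F : Loop 𝔩 → Loop 𝔩) (L₀ : Loop 𝔩)
    (gm gp : ℝ → ℂˣ → Γ) (L : ℝ → Loop 𝔩) : Prop :=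
  (∀ t : ℝ, IsBirkhoff K (-(t : ℂ) • X) (gm t) (gp t)) ∧
  (∀ t : ℝ, ∀ hm hp : ℂˣ → Γ, IsBirkhoff K (-(t : ℂ) • X) hm hp → hm = gm t ∧ hp = gp t) ∧
  gm 0 = 1 ∧ gp 0 = 1 ∧
  (∀ t, IsLaurentLoop K (gm t) ∧ IsLaurentLoop K (gp t)) ∧
  (∀ z i, ContDiff ℝ (⊤ : ℕ∞) (fun t => K.coord i (gm t z)) ∧
    ContDiff ℝ (⊤ : ℕ∞) (fun t => K.coord i (gp t z))) ∧
  (∀ t z, evalLoop z (L t) = Ad (gm t z) (evalLoop z L₀)) ∧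
  (∀ t z, evalLoop z (L t) = Ad (gp t z) (evalLoop z L₀)) ∧
  IsTheSolution F L₀ L

end Coordinates

/-! ### Casimir functions on the loop algebra of the truncated double -/

section Casimir

variable {H : Type*} [Ring H] [HopfAlgebra ℂ H] (𝒜 : ℕ → Submodule ℂ H) [GradedAlgebra 𝒜]
  [ConnectedGradedHopf 𝒜] (k : ℕ)

/-- Coordinates on `G⁽ᵏ⁾`: the values `φ(h)`, `h ∈ H`. -/
def groupCoords : Coords H (truncGroup 𝒜 k) (truncLie 𝒜 k) where
  coord h g := ((g : (TruncDual 𝒜 k)ˣ) : TruncDual 𝒜 k).toFun h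
  tangent h Z := (Z : TruncDual 𝒜 k).toFun h

/-- Coordinates on `G̃⁽ᵏ⁾ = G⁽ᵏ⁾ ⋉ (𝔤⁽ᵏ⁾)*`: the values `φ(h)`, `h ∈ H`, and `α(Z)`, `Z ∈ 𝔤⁽ᵏ⁾`. -/
def doubleCoords : Coords (H ⊕ truncLie 𝒜 k) (DoubleGroup 𝒜 k) (Double (truncLie 𝒜 k)) where
  coord i g := Sum.elim (fun h => (groupCoords 𝒜 k).coord h g.base) (fun Z => g.vec Z) i
  tangent i X := Sum.elim (fun h => (groupCoords 𝒜 k).tangent h X.fst) (fun Z => X.snd Z) i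

/-- The adjoint action of `G̃⁽ᵏ⁾` on `δ⁽ᵏ⁾`, i.e. the derivative of conjugation:
`Ad_{(g, α)} (Y, β) = (Ad_g Y, Ad*_g β - ad*_{Ad_g Y} α)`. -/
def doubleAd (x : DoubleGroup 𝒜 k) (Y : Double (truncLie 𝒜 k)) : Double (truncLie 𝒜 k) :=
  ⟨groupAd 𝒜 k x.base Y.fst, groupCoAd 𝒜 k x.base Y.snd - ⁅groupAd 𝒜 k x.base Y.fst, x.vec⁆⟩

/-- `ψ : Lδ⁽ᵏ⁾ → ℂ` is a Casimir function with differential `dψ`: it is holomorphic (on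
finite-dimensional subspaces), its differentials `dψ(L)` belong to the graded dual `L(δ*)`, and it is
invariant under the adjoint action of the loop group `LG̃⁽ᵏ⁾`. -/
structure IsCasimir (ψ : Loop (Double (truncLie 𝒜 k)) → ℂ)
    (dψ : Loop (Double (truncLie 𝒜 k)) → ℤ →₀ Module.Dual ℂ (Double (truncLie 𝒜 k))) : Prop where
  holomorphic : IsHolomorphic ψ
  differential : ∀ L Y, HasDerivAt (fun s : ℂ => ψ (L + s • Y)) (gradedDualApply (dψ L) Y) 0
  invariant : ∀ g : ℂˣ → DoubleGroup 𝒜 k, IsLaurentLoop (doubleCoords 𝒜 k) g →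
    ∀ L L', (∀ z, evalLoop z L' = doubleAd 𝒜 k (g z) (evalLoop z L)) → ψ L' = ψ L

end Casimir

end HopfLax

end

open HopfLax

/-!
# Lax equations on loop algebras of truncated Lie algebras of infinitesimal characters

All loops and curves are handled through their values, as functions of a real time `t` and of
`z ∈ ℂˣ`. The functions that occur lie in `polyLoops S V`, the span of the `t ^ n z ^ m v` with
`m ∈ S`: because the truncated Lie algebra is nilpotent, exponentials, adjoint actions and Birkhoff
factors are all polynomial in `t` and Laurent polynomial in `z`. This gives smoothness, turns values
into curves in the loop algebra (`exists_loop_curve`), and reduces the splitting `P₊`, `P₋` to a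
splitting of exponents.

*Casimir functions.* The residue of the pairing, `resForm`, is a nondegenerate invariant form on the
loop algebra of the double, and `I(dψ(L))` is the gradient of `ψ` with respect to it. Differentiating
the invariance of `ψ` along one-parameter subgroups gives `[L, I(dψ(L))] = 0`
(`IsCasimir.lie_grad`), and invariance also makes the gradient equivariant
(`IsCasimir.grad_equivariant`). These are the only properties of `ψ` that the flows use, apart from
holomorphy.

*Birkhoff factorization.* An infinitesimal character is nilpotent under truncated convolution, its
exponential series is a character (`exists_character_exp`), and that character is the only value at
`1` of a one-parameter subgroup with the given velocity. A factorization in `G⁽ᵏ⁾` is constructed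
degree by degree (`exists_factorPair`): once it is correct up to degree `n`, the error in degree
`n + 1` is an infinitesimal character, whose parts with negative and with nonnegative exponents are
absorbed into the two factors. In the double group the component of `exp(-tX)` in `(𝔤⁽ᵏ⁾)*` is an
antiderivative in `t` built from the coadjoint action (`exists_isExpLoop`), and the factors are
lifted by splitting `Ad*_{g₋} β` (`exists_doubleFactorPair`). Uniqueness is Liouville's theorem
(`eq_of_factorization`).

*The flow.* Let `Ξ` be equivariant with `[L, Ξ(L)] = 0`, and let `g₋(t)⁻¹ g₊(t) = exp(-tX)` with
`X = Ξ(L₀)`. The logarithmic derivatives of `Ad g₋` and `Ad g₊` differ by `ad (Ad g₋ X)` and have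
only negative, respectively nonnegative, exponents. Hence the first is `ad` of the part of
`Ad g₋ X` with negative exponents (`IsBirkhoffCurve.exists_logarithmic_derivative`), and
`L(t) = Ad g₋(t) L₀` satisfies `L' = [L, ½ R Ξ(L)]` (`IsBirkhoffCurve.solvedByFactorization`). Both
flows are instances: `Ξ = I ∘ dψ` on the double, and `Ξ = π₁ ∘ I ∘ dψ` on the truncated Lie algebra.

*Uniqueness of solutions.* A curve that is differentiable in the weak sense stays locally in a
finite-dimensional subspace (`eventually_mem_finiteDimensional`). There the coefficients of `dψ` are
locally Lipschitz by Cauchy's estimates, hence so are those of the right hand side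
(`CoeffLipschitz.lax`), and the classical uniqueness theorem applies (`eq_of_hasVelocity`).
-/

open Filter Topology

noncomputable section

namespace HopfLax

/-! ### Weak differentiation of curves in complex vector spaces -/

section Calculus

variable {V W U : Type*} [AddCommGroup V] [Module ℂ V] [AddCommGroup W] [Module ℂ W]
  [AddCommGroup U] [Module ℂ U]

lemma eq_of_forall_dual {v w : V} (h : ∀ l : Module.Dual ℂ V, l v = l w) : v = w := by
  rw [← sub_eq_zero, ← Module.forall_dual_apply_eq_zero_iff ℂ]
  intro l
  rw [map_sub, h l, sub_self]

namespace HasVelocity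

variable {c d : ℝ → V} {v w : V} {t : ℝ}

lemma unique (h : HasVelocity c v t) (h' : HasVelocity c w t) : v = w :=
  eq_of_forall_dual fun l => (h l).unique (h' l)

lemma const (v : V) (t : ℝ) : HasVelocity (fun _ => v) 0 t := fun l => by
  simpa using hasDerivAt_const t (l v)

lemma add (h : HasVelocity c v t) (h' : HasVelocity d w t) :
    HasVelocity (fun s => c s + d s) (v + w) t := fun l => by
  simpa using (h l).fun_add (h' l)

lemma sub (h : HasVelocity c v t) (h' : HasVelocity d w t) :
    HasVelocity (fun s => c s - d s) (v - w) t := fun l => by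
  simpa using (h l).fun_sub (h' l)

lemma map (h : HasVelocity c v t) (f : V →ₗ[ℂ] W) : HasVelocity (fun s => f (c s)) (f v) t :=
  fun l => h (l ∘ₗ f)

lemma continuousAt (h : HasVelocity c v t) (l : Module.Dual ℂ V) :
    ContinuousAt (fun s => l (c s)) t := (h l).continuousAt

lemma shift {s : ℝ} (h : HasVelocity c v (s + t)) : HasVelocity (fun r => c (s + r)) v t :=
  fun l => HasDerivAt.comp_const_add s t (h l)

end HasVelocity

lemma hasVelocity_smul {f : ℝ → ℂ} {f' : ℂ} {t : ℝ} (h : HasDerivAt f f' t) (v : V) :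
    HasVelocity (fun s => f s • v) (f' • v) t := fun l => by
  simpa using h.mul_const (l v)

lemma eq_of_velocity_eq_zero {c : ℝ → V} (h : ∀ t, HasVelocity c 0 t) (s t : ℝ) : c s = c t := by
  refine eq_of_forall_dual fun l => ?_
  refine is_const_of_deriv_eq_zero (f := fun s => l (c s)) (fun r => (h r l).differentiableAt)
    (fun r => ?_) s t
  simpa using (h r l).deriv

/-- A curve all of whose linear functionals are continuous at `t` stays, near `t`, in a
finite-dimensional subspace: otherwise there are times `tₙ → t` at which its values are linearly
independent, and a linear functional with value `n` at the time `tₙ` is not continuous. -/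
lemma eventually_mem_finiteDimensional {c : ℝ → V} {t : ℝ}
    (h : ∀ l : Module.Dual ℂ V, ContinuousAt (fun s => l (c s)) t) :
    ∃ E : Submodule ℂ V, FiniteDimensional ℂ E ∧ ∀ᶠ s in 𝓝 t, c s ∈ E := by
  classical
  by_contra H
  push Not at H
  have pick : ∀ (S : Finset V) (n : ℕ), ∃ s : ℝ, |s - t| < 1 / ((n : ℝ) + 1) ∧
      c s ∉ Submodule.span ℂ (S : Set V) := by
    intro S n
    have h1 := H (Submodule.span ℂ (S : Set V)) (FiniteDimensional.span_finset ℂ S)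
    have h2 : ∀ᶠ s in 𝓝 t, |s - t| < 1 / ((n : ℝ) + 1) := by
      have := Metric.ball_mem_nhds t (show (0 : ℝ) < 1 / ((n : ℝ) + 1) by positivity)
      filter_upwards [this] with s hs
      simpa [Real.dist_eq] using hs
    obtain ⟨s, hs, hs'⟩ := (h1.and_eventually h2).exists
    exact ⟨s, hs', hs⟩
  choose F hF hFs using pick
  let S : ℕ → Finset V := fun n => Nat.rec ∅ (fun n S => insert (c (F S n)) S) n
  have hS : ∀ n, S (n + 1) = insert (c (F (S n) n)) (S n) := fun n => rfl
  set u : ℕ → ℝ := fun n => F (S n) n with hu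
  have hmono : Monotone S := monotone_nat_of_le_succ fun n => by
    rw [hS]; exact Finset.subset_insert _ _
  have hmem : ∀ i n, i < n → c (u i) ∈ S n := fun i n hin =>
    hmono (Nat.succ_le_of_lt hin) (by rw [hS]; exact Finset.mem_insert_self _ _)
  have hind : LinearIndependent ℂ fun n => c (u n) := by
    rw [linearIndependent_iff']
    intro s g hg
    by_contra! hne
    obtain ⟨i, hi, hgi⟩ := hne
    have hne' : (s.filter fun j => g j ≠ 0).Nonempty := ⟨i, by simp [hi, hgi]⟩
    obtain ⟨m, hm, hmax⟩ := Finset.exists_max_image _ id hne'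
    rw [Finset.mem_filter] at hm
    have hsum : g m • c (u m) = -∑ j ∈ s.erase m, g j • c (u j) := by
      rw [eq_neg_iff_add_eq_zero, Finset.add_sum_erase s (fun j => g j • c (u j)) hm.1, hg]
    refine hFs (S m) m ?_
    have : c (u m) = (g m)⁻¹ • -∑ j ∈ s.erase m, g j • c (u j) := by
      rw [← hsum, smul_smul, inv_mul_cancel₀ hm.2, one_smul]
    change c (u m) ∈ _
    rw [this]
    refine Submodule.smul_mem _ _ (Submodule.neg_mem _ (Submodule.sum_mem _ fun j hj => ?_))
    by_cases hgj : g j = 0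
    · simp [hgj]
    · refine Submodule.smul_mem _ _ (Submodule.subset_span (hmem j m ?_))
      have h1 := hmax j (by simp [Finset.mem_of_mem_erase hj, hgj])
      exact lt_of_le_of_ne h1 (Finset.ne_of_mem_erase hj)
  obtain ⟨l, hl⟩ := LinearMap.exists_extend
    ((Finsupp.linearCombination ℂ fun n : ℕ => (n : ℂ)) ∘ₗ hind.repr)
  have hval : ∀ n, l (c (u n)) = n := by
    intro n
    have h1 := LinearMap.congr_fun hl ⟨c (u n), Submodule.subset_span ⟨n, rfl⟩⟩
    have h2 : hind.repr ⟨c (u n), Submodule.subset_span ⟨n, rfl⟩⟩ = Finsupp.single n 1 :=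
      hind.repr_eq_single n _ rfl
    simpa [h2] using h1
  have hut : Tendsto u atTop (𝓝 t) := by
    rw [tendsto_iff_dist_tendsto_zero]
    refine squeeze_zero (fun _ => dist_nonneg) (fun n => ?_) tendsto_one_div_add_atTop_nhds_zero_nat
    rw [Real.dist_eq]
    exact (hF (S n) n).le
  have h1 := ((h l).tendsto.comp hut).norm
  refine not_tendsto_nhds_of_tendsto_atTop ?_ _ h1
  have : (norm ∘ (fun s => l (c s)) ∘ u) = fun n : ℕ => (n : ℝ) := by
    ext n; simp [hval]
  change Tendsto (norm ∘ (fun s => l (c s)) ∘ u) _ _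
  rw [this]
  exact tendsto_natCast_atTop_atTop

/-- Near a time of differentiability, a curve is described by finitely many coordinates. -/
lemma HasVelocity.exists_coordinates {c : ℝ → V} {v : V} {t : ℝ} (h : HasVelocity c v t) :
    ∃ (n : ℕ) (e : Fin n → V) (l : Fin n → Module.Dual ℂ V),
      (∀ᶠ s in 𝓝 t, c s = ∑ i, l i (c s) • e i) ∧ v = ∑ i, l i v • e i := by
  obtain ⟨E, hE, hcE⟩ := eventually_mem_finiteDimensional h.continuousAt
  have hv : v ∈ E := by
    by_contra hv
    obtain ⟨f, hfv, hf⟩ := Submodule.exists_le_ker_of_notMem hv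
    refine hfv ((h f).unique ((hasDerivAt_const t (0 : ℂ)).congr_of_eventuallyEq ?_))
    filter_upwards [hcE] with s hs
    exact hf hs
  let b := Module.finBasis ℂ E
  choose l hl using fun i => LinearMap.exists_extend (b.coord i)
  have key : ∀ x ∈ E, x = ∑ i, l i x • (b i : V) := by
    intro x hx
    have h1 := congrArg Subtype.val (b.sum_repr ⟨x, hx⟩)
    simp only [Submodule.coe_sum, Submodule.coe_smul] at h1
    rw [← h1]
    congr 1
    ext i
    rw [h1]
    have := LinearMap.congr_fun (hl i) ⟨x, hx⟩
    simp only [LinearMap.comp_apply, Submodule.subtype_apply, Module.Basis.coord_apply] at this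
    rw [this]
  exact ⟨_, fun i => b i, l, hcE.mono fun s hs => key _ hs, key v hv⟩

/-- The product rule for bilinear maps. -/
lemma HasVelocity.bilin {c : ℝ → V} {v : V} {d : ℝ → W} {w : W} {t : ℝ} (hc : HasVelocity c v t)
    (hd : HasVelocity d w t) (B : V →ₗ[ℂ] W →ₗ[ℂ] U) :
    HasVelocity (fun s => B (c s) (d s)) (B v (d t) + B (c t) w) t := by
  obtain ⟨n, e, l, hl, hv⟩ := hc.exists_coordinates
  obtain ⟨m, f, r, hr, hw⟩ := hd.exists_coordinates
  intro φ
  have h1 : (fun s => φ (B (c s) (d s))) =ᶠ[𝓝 t]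
      fun s => ∑ i, ∑ j, l i (c s) * r j (d s) * φ (B (e i) (f j)) := by
    filter_upwards [hl, hr] with s hs hs'
    nth_rw 1 [hs, hs']
    simp only [map_sum, map_smul, LinearMap.sum_apply, LinearMap.smul_apply, smul_eq_mul,
      Finset.mul_sum]
    rw [Finset.sum_comm]
    exact Finset.sum_congr rfl fun i _ => Finset.sum_congr rfl fun j _ => by ring
  have h2 : φ (B v (d t) + B (c t) w) =
      ∑ i, ∑ j, (l i v * r j (d t) + l i (c t) * r j w) * φ (B (e i) (f j)) := by
    nth_rw 1 [hv, hr.self_of_nhds, hl.self_of_nhds, hw]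
    simp only [map_add, map_sum, map_smul, LinearMap.sum_apply, LinearMap.smul_apply, smul_eq_mul,
      add_mul, Finset.sum_add_distrib, Finset.mul_sum, mul_assoc]
    congr 1
    · rw [Finset.sum_comm]
      refine Finset.sum_congr rfl fun i _ => Finset.sum_congr rfl fun j _ => by ring
    · rw [Finset.sum_comm]
      refine Finset.sum_congr rfl fun i _ => Finset.sum_congr rfl fun j _ => by ring
  rw [h2]
  refine HasDerivAt.congr_of_eventuallyEq ?_ h1
  exact HasDerivAt.fun_sum fun i _ => HasDerivAt.fun_sum fun j _ =>
    ((hc (l i)).mul (hd (r j))).mul_const _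

/-- The chain rule for a function that is holomorphic on finite-dimensional subspaces. -/
lemma IsHolomorphic.comp_hasDerivAt {ψ : V → ℂ} (hψ : IsHolomorphic ψ) {c : ℝ → V} {v : V} {t : ℝ}
    (hc : HasVelocity c v t) {D : ℂ} (hD : HasDerivAt (fun s : ℂ => ψ (c t + s • v)) D 0) :
    HasDerivAt (fun s => ψ (c s)) D t := by
  obtain ⟨n, e, l, hl, hv⟩ := hc.exists_coordinates
  have hd := hψ n e (fun i => l i (c t))
  set Φ : (Fin n → ℂ) → ℂ := fun x => ψ (∑ i, x i • e i) with hΦ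
  have hx : HasDerivAt (fun s i => l i (c s)) (fun i => l i v) t :=
    hasDerivAt_pi.2 fun i => hc (l i)
  have h1 : HasDerivAt (fun s => Φ fun i => l i (c s))
      (fderiv ℂ Φ (fun i => l i (c t)) fun i => l i v) t := by
    have h0 : HasFDerivAt Φ ((fderiv ℂ Φ (fun i => l i (c t))).restrictScalars ℝ)
        ((fun s i => l i (c s)) t) := hd.hasFDerivAt.restrictScalars ℝ
    exact h0.comp_hasDerivAt t hx
  have h2 : (fun s => ψ (c s)) =ᶠ[𝓝 t] fun s => Φ fun i => l i (c s) := by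
    filter_upwards [hl] with s hs
    simp only [hΦ]
    rw [← hs]
  have h3 : HasDerivAt (fun s : ℂ => (fun i => l i (c t)) + s • fun i => l i v)
      (fun i => l i v) 0 := by
    simpa using ((hasDerivAt_id (0 : ℂ)).smul_const (fun i => l i v)).const_add
      (fun i => l i (c t))
  have h4 : HasDerivAt (fun s : ℂ => ψ (c t + s • v))
      (fderiv ℂ Φ (fun i => l i (c t)) fun i => l i v) 0 := by
    have h5 : HasFDerivAt Φ (fderiv ℂ Φ (fun i => l i (c t)))
        ((fun i => l i (c t)) + (0 : ℂ) • fun i => l i v) := by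
      simpa using hd.hasFDerivAt
    have h6 := h5.comp_hasDerivAt (0 : ℂ) h3
    refine h6.congr_of_eventuallyEq (Filter.Eventually.of_forall fun s => ?_)
    simp only [hΦ, Function.comp_apply]
    congr 1
    rw [hl.self_of_nhds]
    nth_rw 1 [hv]
    simp [add_smul, Finset.sum_add_distrib, Finset.smul_sum, smul_smul, ← hl.self_of_nhds]
  rw [hD.unique h4]
  exact h1.congr_of_eventuallyEq h2

end Calculus

/-! ### Vector-valued functions that are polynomial in `t` and Laurent polynomial in `λ` -/

section PolyLoops

variable {S S' S'' : Set ℤ} {V W U : Type*} [AddCommGroup V] [Module ℂ V] [AddCommGroup W]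
  [Module ℂ W] [AddCommGroup U] [Module ℂ U]

/-- The function `(t, z) ↦ t ^ n z ^ m v`. -/
def monomialLoop (n : ℕ) (m : ℤ) (v : V) : ℝ → ℂˣ → V :=
  fun t z => ((t : ℂ) ^ n * ((z ^ m : ℂˣ) : ℂ)) • v

lemma monomialLoop_apply (n : ℕ) (m : ℤ) (v : V) (t : ℝ) (z : ℂˣ) :
    monomialLoop n m v t z = ((t : ℂ) ^ n * ((z ^ m : ℂˣ) : ℂ)) • v := rfl

variable (S V) in
/-- The curves `t ↦ f t` of `V`-valued loops that are polynomial in the time `t` and Laurent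
polynomial in the loop parameter `z`, with exponents of `z` in `S`. Both variables are arguments of
an ordinary function, so that products and other bilinear operations are taken pointwise. -/
def polyLoops : Submodule ℂ (ℝ → ℂˣ → V) :=
  Submodule.span ℂ {f | ∃ (n : ℕ) (m : ℤ) (v : V), m ∈ S ∧ f = monomialLoop n m v}

lemma monomialLoop_mem (n : ℕ) {m : ℤ} (hm : m ∈ S) (v : V) : monomialLoop n m v ∈ polyLoops S V :=
  Submodule.subset_span ⟨n, m, v, hm, rfl⟩

lemma polyLoops_induction {P : (f : ℝ → ℂˣ → V) → f ∈ polyLoops S V → Prop}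
    (hmono : ∀ (n m) (hm : m ∈ S) (v : V), P (monomialLoop n m v) (monomialLoop_mem n hm v))
    (hzero : P 0 (Submodule.zero_mem _))
    (hadd : ∀ f g hf hg, P f hf → P g hg → P (f + g) (Submodule.add_mem _ hf hg))
    {f : ℝ → ℂˣ → V} (hf : f ∈ polyLoops S V) : P f hf := by
  have hsmul : ∀ (c : ℂ) n m (v : V), c • monomialLoop n m v = monomialLoop n m (c • v) := by
    intro c n m v
    ext t z
    simp only [monomialLoop, Pi.smul_apply]
    rw [smul_comm]
  have h : ∀ c : ℂ, P (c • f) (Submodule.smul_mem _ c hf) := by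
    induction hf using Submodule.span_induction with
    | mem f hf =>
      obtain ⟨n, m, v, hm, rfl⟩ := hf
      intro c
      simp only [hsmul]
      exact hmono _ _ hm _
    | zero => intro c; simpa using hzero
    | add f g _ _ hf hg => intro c; simpa only [smul_add] using hadd _ _ _ _ (hf c) (hg c)
    | smul c f _ hf => intro d; simpa only [smul_smul] using hf (d * c)
  simpa only [one_smul] using h 1

lemma polyLoops_mono (h : S ⊆ S') {f : ℝ → ℂˣ → V} (hf : f ∈ polyLoops S V) :
    f ∈ polyLoops S' V := by
  rw [polyLoops] at hf ⊢
  refine Submodule.span_mono ?_ hf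
  rintro _ ⟨n, m, v, hm, rfl⟩
  exact ⟨n, m, v, h hm, rfl⟩

lemma const_mem_polyLoops (h : (0 : ℤ) ∈ S) (v : V) : (fun _ _ => v) ∈ polyLoops S V := by
  have : (fun (_ : ℝ) (_ : ℂˣ) => v) = monomialLoop 0 0 v := by ext t z; simp [monomialLoop]
  rw [this]
  exact monomialLoop_mem 0 h v

lemma polyLoops_map (φ : V →ₗ[ℂ] W) {f : ℝ → ℂˣ → V} (hf : f ∈ polyLoops S V) :
    (fun t z => φ (f t z)) ∈ polyLoops S W := by
  induction hf using polyLoops_induction with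
  | hmono n m hm v =>
    have : (fun t z => φ (monomialLoop n m v t z)) = monomialLoop n m (φ v) := by
      ext t z; simp [monomialLoop]
    rw [this]
    exact monomialLoop_mem n hm _
  | hzero => simp only [Pi.zero_apply, map_zero]; exact Submodule.zero_mem _
  | hadd f g _ _ hf hg =>
    simp only [Pi.add_apply, map_add]; exact Submodule.add_mem _ hf hg

lemma polyLoops_bilin (B : V →ₗ[ℂ] W →ₗ[ℂ] U) (h : ∀ m ∈ S, ∀ m' ∈ S', m + m' ∈ S'')
    {f : ℝ → ℂˣ → V} (hf : f ∈ polyLoops S V) {g : ℝ → ℂˣ → W} (hg : g ∈ polyLoops S' W) :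
    (fun t z => B (f t z) (g t z)) ∈ polyLoops S'' U := by
  induction hf using polyLoops_induction with
  | hmono n m hm v =>
    induction hg using polyLoops_induction with
    | hmono n' m' hm' w =>
      have : (fun t z => B (monomialLoop n m v t z) (monomialLoop n' m' w t z)) =
          monomialLoop (n + n') (m + m') (B v w) := by
        ext t z
        simp only [monomialLoop, map_smul, LinearMap.smul_apply, smul_smul, pow_add, zpow_add,
          Units.val_mul]
        congr 1
        ring
      rw [this]
      exact monomialLoop_mem _ (h m hm m' hm') _
    | hzero => simp only [Pi.zero_apply, map_zero]; exact Submodule.zero_mem _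
    | hadd f g _ _ hf hg =>
      simp only [Pi.add_apply, map_add]; exact Submodule.add_mem _ hf hg
  | hzero => simp only [Pi.zero_apply, map_zero, LinearMap.zero_apply]; exact Submodule.zero_mem _
  | hadd f g _ _ hf hg =>
    simp only [Pi.add_apply, map_add, LinearMap.add_apply]; exact Submodule.add_mem _ hf hg

lemma time_smul_mem_polyLoops {f : ℝ → ℂˣ → V} (hf : f ∈ polyLoops S V) :
    (fun (t : ℝ) z => (t : ℂ) • f t z) ∈ polyLoops S V := by
  have h := polyLoops_bilin (S'' := S) (LinearMap.lsmul ℂ V)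
    (by simp) (monomialLoop_mem (S := {0}) 1 rfl (1 : ℂ)) hf
  simpa [monomialLoop] using h

/-- The splitting of a loop into its parts with negative and with nonnegative exponents. -/
lemma polyLoops_split {f : ℝ → ℂˣ → V} (hf : f ∈ polyLoops Set.univ V) :
    ∃ fm ∈ polyLoops (Set.Iio 0) V, ∃ fp ∈ polyLoops (Set.Ici 0) V, f = fm + fp := by
  induction hf using polyLoops_induction with
  | hmono n m hm v =>
    rcases lt_or_ge m 0 with h | h
    · exact ⟨_, monomialLoop_mem n (S := Set.Iio 0) h v, 0, Submodule.zero_mem _, by simp⟩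
    · exact ⟨0, Submodule.zero_mem _, _, monomialLoop_mem n (S := Set.Ici 0) h v, by simp⟩
  | hzero => exact ⟨0, Submodule.zero_mem _, 0, Submodule.zero_mem _, by simp⟩
  | hadd f g _ _ hf hg =>
    obtain ⟨a, ha, b, hb, rfl⟩ := hf
    obtain ⟨c, hc, d, hd, rfl⟩ := hg
    exact ⟨a + c, Submodule.add_mem _ ha hc, b + d, Submodule.add_mem _ hb hd, by abel⟩

lemma hasVelocity_monomial (n : ℕ) (x : ℂ) (v : V) (t : ℝ) :
    HasVelocity (fun s : ℝ => ((s : ℂ) ^ n * x) • v) (((n : ℂ) * (t : ℂ) ^ (n - 1) * x) • v) t := by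
  refine hasVelocity_smul ?_ v
  have h := (hasDerivAt_pow n (t : ℂ)).comp_ofReal
  simpa using h.mul_const x

lemma exists_velocity_mem_polyLoops {f : ℝ → ℂˣ → V} (hf : f ∈ polyLoops S V) :
    ∃ f' ∈ polyLoops S V, ∀ t z, HasVelocity (fun s => f s z) (f' t z) t := by
  induction hf using polyLoops_induction with
  | hmono n m hm v =>
    refine ⟨monomialLoop (n - 1) m ((n : ℂ) • v), monomialLoop_mem _ hm _, fun t z => ?_⟩
    have h := hasVelocity_monomial n ((z ^ m : ℂˣ) : ℂ) v t
    refine Eq.subst (motive := fun w => HasVelocity _ w t) ?_ h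
    rw [monomialLoop_apply, smul_smul]
    congr 1
    ring
  | hzero => exact ⟨0, Submodule.zero_mem _, fun t z => HasVelocity.const 0 t⟩
  | hadd f g _ _ hf hg =>
    obtain ⟨f', hf', hf⟩ := hf
    obtain ⟨g', hg', hg⟩ := hg
    exact ⟨f' + g', Submodule.add_mem _ hf' hg', fun t z => (hf t z).add (hg t z)⟩

lemma exists_antiderivative_mem_polyLoops {f : ℝ → ℂˣ → V} (hf : f ∈ polyLoops S V) :
    ∃ F ∈ polyLoops S V, (∀ z, F 0 z = 0) ∧ ∀ t z, HasVelocity (fun s => F s z) (f t z) t := by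
  induction hf using polyLoops_induction with
  | hmono n m hm v =>
    refine ⟨monomialLoop (n + 1) m (((n : ℂ) + 1)⁻¹ • v), monomialLoop_mem _ hm _,
      fun z => by simp [monomialLoop], fun t z => ?_⟩
    have h := hasVelocity_monomial (n + 1) ((z ^ m : ℂˣ) : ℂ) (((n : ℂ) + 1)⁻¹ • v) t
    refine Eq.subst (motive := fun w => HasVelocity _ w t) ?_ h
    have hn : (n : ℂ) + 1 ≠ 0 := by exact_mod_cast Nat.succ_ne_zero n
    rw [monomialLoop_apply, smul_smul, Nat.add_sub_cancel, Nat.cast_add, Nat.cast_one]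
    congr 1
    field_simp
  | hzero => exact ⟨0, Submodule.zero_mem _, fun z => rfl, fun t z => HasVelocity.const 0 t⟩
  | hadd f g _ _ hf hg =>
    obtain ⟨f', hf', hf0, hf⟩ := hf
    obtain ⟨g', hg', hg0, hg⟩ := hg
    exact ⟨f' + g', Submodule.add_mem _ hf' hg', fun z => by simp [hf0, hg0],
      fun t z => (hf t z).add (hg t z)⟩

lemma polyLoops_contDiff {f : ℝ → ℂˣ → ℂ} (hf : f ∈ polyLoops S ℂ) (z : ℂˣ) :
    ContDiff ℝ (⊤ : ℕ∞) fun t => f t z := by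
  induction hf using polyLoops_induction with
  | hmono n m hm v =>
    simp only [monomialLoop]
    have : ContDiff ℝ (⊤ : ℕ∞) (fun t : ℝ => (t : ℂ)) := Complex.ofRealCLM.contDiff
    exact ((this.pow n).mul contDiff_const).smul contDiff_const
  | hzero => exact contDiff_const
  | hadd f g _ _ hf hg => exact hf.add hg

lemma polyLoops_laurent {f : ℝ → ℂˣ → ℂ} (hf : f ∈ polyLoops S ℂ) (t : ℝ) :
    ∃ p : LaurentPolynomial ℂ, ∀ z : ℂˣ, f t z = p.eval₂ (RingHom.id ℂ) z := by
  induction hf using polyLoops_induction with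
  | hmono n m hm v =>
    refine ⟨LaurentPolynomial.C ((t : ℂ) ^ n * v) * LaurentPolynomial.T m, fun z => ?_⟩
    simp [monomialLoop]
    ring
  | hzero => exact ⟨0, fun z => by simp⟩
  | hadd f g _ _ hf hg =>
    obtain ⟨p, hp⟩ := hf
    obtain ⟨q, hq⟩ := hg
    exact ⟨p + q, fun z => by simp [hp, hq]⟩

lemma polyLoops_entire {f : ℝ → ℂˣ → ℂ} (hf : f ∈ polyLoops (Set.Ici 0) ℂ) (t : ℝ) :
    ∃ F : ℂ → ℂ, Differentiable ℂ F ∧ ∀ z : ℂˣ, f t z = F z := by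
  induction hf using polyLoops_induction with
  | hmono n m hm v =>
    obtain ⟨j, rfl⟩ := Int.eq_ofNat_of_zero_le hm
    exact ⟨fun z => ((t : ℂ) ^ n * z ^ j) * v, by fun_prop, fun z => by simp [monomialLoop]⟩
  | hzero => exact ⟨0, differentiable_const 0, fun z => rfl⟩
  | hadd f g _ _ hf hg =>
    obtain ⟨p, hp, hp'⟩ := hf
    obtain ⟨q, hq, hq'⟩ := hg
    exact ⟨p + q, hp.add hq, fun z => by simp [hp', hq']⟩

lemma polyLoops_inverse {f : ℝ → ℂˣ → ℂ} (hf : f ∈ polyLoops (Set.Iio 0) ℂ) (t : ℝ) :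
    ∃ p : Polynomial ℂ, p.coeff 0 = 0 ∧ ∀ z : ℂˣ, f t z = p.eval ((z⁻¹ : ℂˣ) : ℂ) := by
  induction hf using polyLoops_induction with
  | hmono n m hm v =>
    obtain ⟨j, hj⟩ := Int.eq_ofNat_of_zero_le (show (0 : ℤ) ≤ -m from by have := hm.out; omega)
    have hj0 : j ≠ 0 := by
      rintro rfl
      have := hm.out
      omega
    refine ⟨Polynomial.C ((t : ℂ) ^ n * v) * Polynomial.X ^ j, ?_, fun z => ?_⟩
    · simp [Polynomial.coeff_X_pow, hj0.symm]
    · have : (z ^ m : ℂˣ) = (z⁻¹) ^ j := by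
        rw [← zpow_natCast, ← hj, inv_zpow', neg_neg]
      simp only [monomialLoop, this]
      simp
      ring
  | hzero => exact ⟨0, by simp, fun z => by simp⟩
  | hadd f g _ _ hf hg =>
    obtain ⟨p, hp, hp'⟩ := hf
    obtain ⟨q, hq, hq'⟩ := hg
    exact ⟨p + q, by simp [hp, hq], fun z => by simp [hp', hq']⟩

/-- Liouville: an entire function that is on `ℂ ∖ {0}` a polynomial in `λ⁻¹` without constant term
vanishes. -/
lemma eq_zero_of_entire_of_inverse {F : ℂ → ℂ} (hF : Differentiable ℂ F) {p : Polynomial ℂ}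
    (hp : p.coeff 0 = 0) (h : ∀ z : ℂˣ, F z = p.eval ((z⁻¹ : ℂˣ) : ℂ)) (z : ℂ) : F z = 0 := by
  refine hF.apply_eq_of_tendsto_cocompact z ?_
  have h1 : Tendsto (fun w : ℂ => p.eval w⁻¹) (cocompact ℂ) (𝓝 0) := by
    have := (p.continuous.tendsto 0).comp (tendsto_inv₀_cobounded (α := ℂ))
    rw [Metric.cobounded_eq_cocompact] at this
    rw [← Polynomial.coeff_zero_eq_eval_zero, hp] at this
    exact this
  refine h1.congr' ?_
  have : ∀ᶠ w : ℂ in cocompact ℂ, w ≠ 0 := by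
    rw [← Metric.cobounded_eq_cocompact]
    exact Bornology.eventually_ne_cobounded 0
  filter_upwards [this] with w hw
  rw [show w = ((Units.mk0 w hw : ℂˣ) : ℂ) from rfl, h, Units.val_inv_eq_inv_val]

lemma eq_of_mem_polyLoops {f : ℝ → ℂˣ → V} (hf : f ∈ polyLoops (Set.Iio 0) V)
    (hf' : f ∈ polyLoops (Set.Ici 0) V) (t : ℝ) (z : ℂˣ) : f t z = 0 := by
  refine eq_of_forall_dual fun l => ?_
  obtain ⟨p, hp, hp'⟩ := polyLoops_inverse (polyLoops_map l hf) t
  obtain ⟨F, hF, hF'⟩ := polyLoops_entire (polyLoops_map l hf') t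
  rw [map_zero, hF']
  exact eq_zero_of_entire_of_inverse hF hp (fun w => by rw [← hF', hp']) z

end PolyLoops

/-! ### Loops and their values -/

section Loop

variable {𝔩 : Type*} [LieRing 𝔩] [LieAlgebra ℂ 𝔩]

/-- The loop `λ ^ m v`. -/
def monoLoop (m : ℤ) (v : 𝔩) : Loop 𝔩 := AddMonoidAlgebra.single m (1 : ℂ) ⊗ₜ[ℂ] v

lemma coeffs_monoLoop (m : ℤ) (v : 𝔩) : coeffs (monoLoop m v) = Finsupp.single m v := by
  exact LieAlgebra.LoopAlgebra.toFinsupp_single_tmul ℂ ℤ 𝔩 m v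

lemma ofCoeffs_single (m : ℤ) (v : 𝔩) : ofCoeffs (Finsupp.single m v) = monoLoop m v := by
  simp [ofCoeffs, monoLoop]

@[simp] lemma coeffs_ofCoeffs (c : ℤ →₀ 𝔩) : coeffs (ofCoeffs c) = c := by simp [coeffs, ofCoeffs]
@[simp] lemma ofCoeffs_coeffs (L : Loop 𝔩) : ofCoeffs (coeffs L) = L := by simp [coeffs, ofCoeffs]

@[simp] lemma coeffs_add (L L' : Loop 𝔩) : coeffs (L + L') = coeffs L + coeffs L' := map_add _ _ _
@[simp] lemma coeffs_sub (L L' : Loop 𝔩) : coeffs (L - L') = coeffs L - coeffs L' := map_sub _ _ _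
@[simp] lemma coeffs_smul (c : ℂ) (L : Loop 𝔩) : coeffs (c • L) = c • coeffs L := map_smul _ _ _
@[simp] lemma coeffs_zero : coeffs (0 : Loop 𝔩) = 0 := map_zero _

lemma coeffs_injective : Function.Injective (coeffs (𝔩 := 𝔩)) :=
  (LieAlgebra.LoopAlgebra.toFinsupp ℂ ℤ 𝔩).injective

lemma loop_eq_sum (L : Loop 𝔩) : L = ∑ m ∈ (coeffs L).support, monoLoop m (coeffs L m) := by
  conv_lhs => rw [← ofCoeffs_coeffs L, ← Finsupp.sum_single (coeffs L)]
  simp only [Finsupp.sum, ofCoeffs, map_sum]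
  exact Finset.sum_congr rfl fun m _ => ofCoeffs_single m _

lemma loop_induction {P : Loop 𝔩 → Prop} (hmono : ∀ m v, P (monoLoop m v)) (hzero : P 0)
    (hadd : ∀ L L', P L → P L' → P (L + L')) (L : Loop 𝔩) : P L := by
  rw [loop_eq_sum L]
  exact Finset.sum_induction _ P hadd hzero fun m _ => hmono _ _

variable (𝔩) in
/-- The coefficient of `λ ^ m`, linearly. -/
def coeffLin (m : ℤ) : Loop 𝔩 →ₗ[ℂ] 𝔩 :=
  Finsupp.lapply m ∘ₗ (LieAlgebra.LoopAlgebra.toFinsupp ℂ ℤ 𝔩).toLinearMap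

variable (𝔩) in
/-- Evaluation of loops, linearly. -/
def evalLin (z : ℂˣ) : Loop 𝔩 →ₗ[ℂ] 𝔩 :=
  (Finsupp.lsum ℂ fun n => ((z ^ n : ℂˣ) : ℂ) • LinearMap.id) ∘ₗ
    (LieAlgebra.LoopAlgebra.toFinsupp ℂ ℤ 𝔩).toLinearMap

lemma evalLin_apply (z : ℂˣ) (L : Loop 𝔩) : evalLin 𝔩 z L = evalLoop z L := rfl

@[simp] lemma evalLoop_add (z : ℂˣ) (L L' : Loop 𝔩) :
    evalLoop z (L + L') = evalLoop z L + evalLoop z L' := map_add (evalLin 𝔩 z) L L'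
@[simp] lemma evalLoop_sub (z : ℂˣ) (L L' : Loop 𝔩) :
    evalLoop z (L - L') = evalLoop z L - evalLoop z L' := map_sub (evalLin 𝔩 z) L L'
@[simp] lemma evalLoop_neg (z : ℂˣ) (L : Loop 𝔩) :
    evalLoop z (-L) = -evalLoop z L := map_neg (evalLin 𝔩 z) L
@[simp] lemma evalLoop_smul (z : ℂˣ) (c : ℂ) (L : Loop 𝔩) :
    evalLoop z (c • L) = c • evalLoop z L := map_smul (evalLin 𝔩 z) c L
@[simp] lemma evalLoop_zero (z : ℂˣ) : evalLoop z (0 : Loop 𝔩) = 0 := map_zero (evalLin 𝔩 z)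

@[simp] lemma evalLoop_monoLoop (z : ℂˣ) (m : ℤ) (v : 𝔩) :
    evalLoop z (monoLoop m v) = ((z ^ m : ℂˣ) : ℂ) • v := by
  rw [evalLoop, coeffs_monoLoop, Finsupp.sum_single_index (by simp)]

lemma lie_monoLoop (m n : ℤ) (v w : 𝔩) :
    ⁅monoLoop m v, monoLoop n w⁆ = monoLoop (m + n) ⁅v, w⁆ := by
  rw [monoLoop, monoLoop, LieAlgebra.ExtendScalars.bracket_tmul, AddMonoidAlgebra.single_mul_single,
    one_mul]
  rfl

/-! The bracket of `L𝔩` is found by instance search as a bracket on tensor products, to which the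
lemmas on Lie rings do not apply syntactically. -/

lemma loop_lie_add (L L' L'' : Loop 𝔩) : ⁅L, L' + L''⁆ = ⁅L, L'⁆ + ⁅L, L''⁆ :=
  (LieAlgebra.ExtendScalars.instLieRing ℂ (AddMonoidAlgebra ℂ ℤ) 𝔩).lie_add L L' L''

lemma loop_add_lie (L L' L'' : Loop 𝔩) : ⁅L + L', L''⁆ = ⁅L, L''⁆ + ⁅L', L''⁆ :=
  (LieAlgebra.ExtendScalars.instLieRing ℂ (AddMonoidAlgebra ℂ ℤ) 𝔩).add_lie L L' L''

lemma loop_lie_zero (L : Loop 𝔩) : ⁅L, (0 : Loop 𝔩)⁆ = 0 := by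
  have h := loop_lie_add L 0 0
  rwa [add_zero, left_eq_add] at h

lemma loop_zero_lie (L : Loop 𝔩) : ⁅(0 : Loop 𝔩), L⁆ = 0 := by
  have h := loop_add_lie 0 0 L
  rwa [add_zero, left_eq_add] at h

lemma evalLoop_lie (z : ℂˣ) (L L' : Loop 𝔩) :
    evalLoop z ⁅L, L'⁆ = ⁅evalLoop z L, evalLoop z L'⁆ := by
  induction L using loop_induction with
  | hmono m v =>
    induction L' using loop_induction with
    | hmono n w =>
      simp only [lie_monoLoop, evalLoop_monoLoop, smul_lie, lie_smul, smul_smul, zpow_add,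
        Units.val_mul]
      rw [mul_comm]
    | hzero => simp [loop_lie_zero]
    | hadd L L' h h' => simp only [loop_lie_add, lie_add, evalLoop_add, h, h']
  | hzero => simp [loop_zero_lie]
  | hadd L L' h h' => simp only [loop_add_lie, add_lie, evalLoop_add, h, h']

/-- The functions `z ↦ L(z)` are loops in the sense of `polyLoops`. -/
lemma evalLoop_mem_polyLoops (L : Loop 𝔩) {S : Set ℤ} (h : ∀ m, coeffs L m ≠ 0 → m ∈ S) :
    (fun _ z => evalLoop z L) ∈ polyLoops S 𝔩 := by
  have : (fun (_ : ℝ) z => evalLoop z L) =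
      ∑ m ∈ (coeffs L).support, monomialLoop 0 m (coeffs L m) := by
    ext t z
    simp [evalLoop, Finsupp.sum, monomialLoop]
  rw [this]
  exact Submodule.sum_mem _ fun m hm => monomialLoop_mem 0 (h m (by simpa using hm)) _

/-- A loop is determined by its values. -/
lemma evalLoop_injective {L L' : Loop 𝔩} (h : ∀ z, evalLoop z L = evalLoop z L') : L = L' := by
  rw [← sub_eq_zero]
  set D := L - L' with hD
  have h0 : ∀ z, evalLoop z D = 0 := fun z => by simp [hD, h]
  refine coeffs_injective (Finsupp.ext fun m => eq_of_forall_dual fun l => ?_)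
  -- the Laurent polynomial `l ∘ D` vanishes on `ℂ ∖ {0}`, so all its coefficients are zero
  obtain ⟨N, hN⟩ : ∃ N : ℕ, ∀ j ∈ (coeffs D).support, 0 ≤ j + N := by
    refine ⟨((coeffs D).support.sup fun j => j.natAbs), fun j hj => ?_⟩
    have := Finset.le_sup (f := fun j : ℤ => j.natAbs) hj
    omega
  set p : Polynomial ℂ := ∑ j ∈ (coeffs D).support,
    Polynomial.monomial (j + N).toNat (l (coeffs D j)) with hp
  have hp0 : p = 0 := by
    refine Polynomial.eq_zero_of_infinite_isRoot p
      ((Set.finite_singleton (0 : ℂ)).infinite_compl.mono fun z hz => ?_)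
    have hz' : z ≠ 0 := hz
    have h1 := congrArg l (h0 (Units.mk0 z hz'))
    simp only [evalLoop, Finsupp.sum, map_sum, map_smul, map_zero] at h1
    simp only [Set.mem_ofPred_eq, Polynomial.IsRoot.def, hp, Polynomial.eval_finsetSum,
      Polynomial.eval_monomial]
    have h2 : ∀ j ∈ (coeffs D).support, l (coeffs D j) * z ^ (j + N).toNat =
        z ^ N * (((Units.mk0 z hz' ^ j : ℂˣ) : ℂ) • l (coeffs D j)) := by
      intro j hj
      have : z ^ (j + N).toNat = z ^ N * z ^ j := by
        rw [← zpow_natCast, Int.toNat_of_nonneg (hN j hj), zpow_add₀ hz', zpow_natCast, mul_comm]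
      rw [this]
      simp
      ring
    rw [Finset.sum_congr rfl h2, ← Finset.mul_sum, h1, mul_zero]
  by_cases hm : m ∈ (coeffs D).support
  · have h3 := congrArg (fun q => Polynomial.coeff q (m + N).toNat) hp0
    simp only [hp, Polynomial.finsetSum_coeff, Polynomial.coeff_monomial,
      Polynomial.coeff_zero] at h3
    rw [Finset.sum_eq_single m] at h3
    · simpa using h3
    · intro j hj hjm
      have h4 := hN j hj
      have h5 := hN m hm
      exact if_neg (by omega)
    · exact fun h => absurd hm h
  · simp only [Finsupp.mem_support_iff, not_not] at hm
    simp [hm]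

/-- A polynomial curve of loops is a curve in `L𝔩` that is differentiable in the weak sense. -/
lemma exists_loop_curve {f : ℝ → ℂˣ → 𝔩} (hf : f ∈ polyLoops Set.univ 𝔩) :
    ∃ c : ℝ → Loop 𝔩, (∀ t z, evalLoop z (c t) = f t z) ∧ ∀ t, ∃ v, HasVelocity c v t := by
  induction hf using polyLoops_induction with
  | hmono n m hm v =>
    refine ⟨fun t => ((t : ℂ) ^ n * 1) • monoLoop m v, fun t z => ?_, fun t =>
      ⟨_, hasVelocity_monomial n 1 (monoLoop m v) t⟩⟩
    simp [monomialLoop, smul_smul]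
  | hzero => exact ⟨0, fun t z => by simp, fun t => ⟨0, HasVelocity.const 0 t⟩⟩
  | hadd f g _ _ hf hg =>
    obtain ⟨c, hc, hc'⟩ := hf
    obtain ⟨d, hd, hd'⟩ := hg
    refine ⟨fun t => c t + d t, fun t z => by simp [hc, hd], fun t => ?_⟩
    obtain ⟨v, hv⟩ := hc' t
    obtain ⟨w, hw⟩ := hd' t
    exact ⟨v + w, hv.add hw⟩

lemma posPart_add_negPart (L : Loop 𝔩) : posPart L + negPart L = L := by
  apply coeffs_injective
  ext m
  simp only [posPart, negPart, coeffs_add, coeffs_ofCoeffs, Finsupp.add_apply,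
    Finsupp.filter_apply]
  by_cases h : 0 ≤ m
  · simp [h, not_lt.2 h]
  · simp [h, not_le.1 h]

lemma half_rMat (L : Loop 𝔩) : (1 / 2 : ℂ) • rMat L = (1 / 2 : ℂ) • L - negPart L := by
  have h : posPart L = L - negPart L := eq_sub_of_add_eq (posPart_add_negPart L)
  rw [rMat, h]
  module

lemma evalLoop_negPart_mem (L : Loop 𝔩) :
    (fun _ z => evalLoop z (negPart L)) ∈ polyLoops (Set.Iio 0) 𝔩 :=
  evalLoop_mem_polyLoops _ fun m hm => by
    simp only [negPart, coeffs_ofCoeffs, Finsupp.filter_apply, ne_eq, ite_eq_right_iff,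
      Classical.not_imp] at hm
    exact hm.1

lemma evalLoop_posPart_mem (L : Loop 𝔩) :
    (fun _ z => evalLoop z (posPart L)) ∈ polyLoops (Set.Ici 0) 𝔩 :=
  evalLoop_mem_polyLoops _ fun m hm => by
    simp only [posPart, coeffs_ofCoeffs, Finsupp.filter_apply, ne_eq, ite_eq_right_iff,
      Classical.not_imp] at hm
    exact hm.1

lemma mapLoop_monoLoop {𝔩' : Type*} [LieRing 𝔩'] [LieAlgebra ℂ 𝔩'] (f : 𝔩 →ₗ[ℂ] 𝔩') (m : ℤ)
    (v : 𝔩) :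
    mapLoop f (monoLoop m v) = monoLoop m (f v) := rfl

lemma evalLoop_mapLoop {𝔩' : Type*} [LieRing 𝔩'] [LieAlgebra ℂ 𝔩'] (f : 𝔩 →ₗ[ℂ] 𝔩') (z : ℂˣ)
    (L : Loop 𝔩) : evalLoop z (mapLoop f L) = f (evalLoop z L) := by
  induction L using loop_induction with
  | hmono m v => simp [mapLoop_monoLoop]
  | hzero => simp
  | hadd L L' h h' => simp [h, h']

lemma coeffs_mapLoop {𝔩' : Type*} [LieRing 𝔩'] [LieAlgebra ℂ 𝔩'] (f : 𝔩 →ₗ[ℂ] 𝔩') (m : ℤ)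
    (L : Loop 𝔩) : coeffs (mapLoop f L) m = f (coeffs L m) := by
  induction L using loop_induction with
  | hmono n v =>
    rw [mapLoop_monoLoop, coeffs_monoLoop, coeffs_monoLoop, Finsupp.single_apply,
      Finsupp.single_apply]
    split_ifs <;> simp
  | hzero => simp
  | hadd L L' h h' => simp [h, h']

end Loop

/-! ### Holomorphic functions of several variables are locally Lipschitz -/

section Lipschitz

variable {E : Type*} [NormedAddCommGroup E] [NormedSpace ℂ E]

lemma locallyLipschitz_of_differentiable {f : E → ℂ} (hf : Differentiable ℂ f) :
    LocallyLipschitz f := by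
  intro x₀
  obtain ⟨r, hr, hb⟩ := Metric.eventually_nhds_iff_ball.1
    (hf.continuous.continuousAt.eventually (Metric.ball_mem_nhds (f x₀) one_pos))
  refine ⟨⟨2 / (r / 2), by positivity⟩, Metric.ball x₀ (r / 4),
    Metric.ball_mem_nhds _ (by positivity), LipschitzOnWith.of_dist_le_mul fun x hx y hy => ?_⟩
  have hsub : Metric.ball y (r / 2) ⊆ Metric.ball x₀ r := by
    refine Metric.ball_subset_ball' ?_
    have := Metric.mem_ball.1 hy
    linarith
  refine Complex.dist_le_div_mul_dist_of_mapsTo_ball (R₁ := r / 2) (R₂ := 2)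
    hf.differentiableOn (fun z hz => ?_) ?_
  · have h1 := Metric.mem_ball.1 (hb z (hsub hz))
    have h2 := Metric.mem_ball.1 (hb y (Metric.ball_subset_ball (by linarith) hy))
    rw [Metric.mem_closedBall]
    linarith [dist_triangle_right (f z) (f y) (f x₀)]
  · rw [Metric.mem_ball] at *
    linarith [dist_triangle_right x y x₀]

/-- By the Cauchy estimate, a partial derivative of a holomorphic function is locally Lipschitz. -/
lemma locallyLipschitz_deriv {Φ : E × ℂ → ℂ} (hΦ : Differentiable ℂ Φ) :
    LocallyLipschitz fun x => deriv (fun s => Φ (x, s)) 0 := by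
  intro x₀
  obtain ⟨K, U, hU, hK⟩ := locallyLipschitz_of_differentiable hΦ (x₀, 0)
  obtain ⟨r, hr, hrU⟩ := Metric.mem_nhds_iff.1 hU
  refine ⟨⟨K / (r / 2), by positivity⟩, Metric.ball x₀ r, Metric.ball_mem_nhds _ hr,
    LipschitzOnWith.of_dist_le_mul fun x hx y hy => ?_⟩
  have hd : ∀ x, Differentiable ℂ fun s => Φ (x, s) := fun x =>
    hΦ.comp ((differentiable_const x).prodMk differentiable_id)
  rw [dist_eq_norm, ← deriv_fun_sub (hd x 0) (hd y 0)]
  have h := Complex.norm_deriv_le_of_forall_mem_sphere_norm_le (c := 0) (R := r / 2)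
    (C := K * dist x y) (f := fun s => Φ (x, s) - Φ (y, s)) (by positivity)
    ((hd x).sub (hd y)).diffContOnCl (fun s hs => ?_)
  · refine h.trans (le_of_eq ?_)
    change (K : ℝ) * dist x y / (r / 2) = K / (r / 2) * dist x y
    ring
  · have hs' : dist s 0 < r := by
      rw [Metric.mem_sphere.1 hs]
      linarith
    rw [← dist_eq_norm]
    refine (hK.dist_le_mul (x, s) (hrU ?_) (y, s) (hrU ?_)).trans (le_of_eq ?_)
    · rw [Metric.mem_ball, Prod.dist_eq]
      exact max_lt hx hs'
    · rw [Metric.mem_ball, Prod.dist_eq]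
      exact max_lt hy hs'
    · rw [Prod.dist_eq, dist_self, max_eq_left dist_nonneg]

end Lipschitz

section Lipschitz

variable {E : Type*} [NormedAddCommGroup E]

lemma LocallyLipschitz.mul_complex {f g : E → ℂ} (hf : LocallyLipschitz f)
    (hg : LocallyLipschitz g) : LocallyLipschitz fun x => f x * g x :=
  (locallyLipschitz_of_differentiable (f := fun p : ℂ × ℂ => p.1 * p.2) (by fun_prop)).comp
    (hf.prodMk hg)

lemma LocallyLipschitz.finset_sum {ι : Type*} (s : Finset ι) {f : ι → E → ℂ}
    (hf : ∀ i ∈ s, LocallyLipschitz (f i)) : LocallyLipschitz fun x => ∑ i ∈ s, f i x := by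
  classical
  induction s using Finset.induction_on with
  | empty => simpa using LocallyLipschitz.const (0 : ℂ)
  | insert i s hi ih =>
    simp only [Finset.sum_insert hi]
    exact (locallyLipschitz_of_differentiable (f := fun p : ℂ × ℂ => p.1 + p.2) (by fun_prop)).comp
      ((hf i (Finset.mem_insert_self i s)).prodMk
        (ih fun j hj => hf j (Finset.mem_insert_of_mem hj)))

lemma LocallyLipschitz.pi_complex {n : ℕ} {f : E → Fin n → ℂ}
    (hf : ∀ i, LocallyLipschitz fun x => f x i) : LocallyLipschitz f := by
  intro x
  choose K U hU hK using fun i => hf i x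
  refine ⟨Finset.univ.sup K, ⋂ i, U i, (Filter.iInter_mem).2 hU, ?_⟩
  refine LipschitzOnWith.of_dist_le_mul fun y hy z hz => ?_
  rw [Set.mem_iInter] at hy hz
  refine (dist_pi_le_iff (by positivity)).2 fun i => ?_
  refine ((hK i).dist_le_mul y (hy i) z (hz i)).trans ?_
  gcongr
  exact Finset.le_sup (Finset.mem_univ i)

end Lipschitz

/-! ### Uniqueness of solutions in the loop algebra -/

section Uniqueness

variable {𝔩 : Type*} [LieRing 𝔩] [LieAlgebra ℂ 𝔩]

/-- A map into the loop algebra is *coefficientwise locally Lipschitz* if, on every space spanned by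
finitely many monomials `λ ^ m v`, all linear functionals of all coefficients of its values are
locally Lipschitz. The order in `λ` of its values need not be bounded on such a space. -/
def CoeffLipschitz (F : Loop 𝔩 → Loop 𝔩) : Prop :=
  ∀ (n : ℕ) (p : Fin n → ℤ) (v : Fin n → 𝔩) (m : ℤ) (l : Module.Dual ℂ 𝔩),
    LocallyLipschitz fun x : Fin n → ℂ => l (coeffs (F (∑ i, x i • monoLoop (p i) (v i))) m)

/-- The loops in a finite-dimensional subspace are combinations of finitely many monomials
`λ ^ m v`, with coefficients that are linear functionals of coefficients of the loop. -/
lemma exists_monomial_coordinates [FiniteDimensional ℂ 𝔩] (E : Submodule ℂ (Loop 𝔩))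
    [FiniteDimensional ℂ E] :
    ∃ (n : ℕ) (p : Fin n → ℤ) (v : Fin n → 𝔩) (l : Fin n → Module.Dual ℂ 𝔩),
      ∀ L ∈ E, L = ∑ i, l i (coeffs L (p i)) • monoLoop (p i) (v i) := by
  classical
  obtain ⟨T, hT⟩ := (Submodule.fg_iff_finiteDimensional E).2 inferInstance
  let s : Finset ℤ := T.biUnion fun L => (coeffs L).support
  have hs : ∀ L ∈ E, (coeffs L).support ⊆ s := by
    intro L hL
    rw [← hT] at hL
    induction hL using Submodule.span_induction with
    | mem L hL => exact Finset.subset_biUnion_of_mem (fun L => (coeffs L).support) hL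
    | zero => simp
    | add L L' _ _ h h' =>
      rw [coeffs_add]
      exact Finsupp.support_add.trans (Finset.union_subset h h')
    | smul c L _ h =>
      rw [coeffs_smul]
      exact Finsupp.support_smul.trans h
  let b := Module.finBasis ℂ 𝔩
  let eqv := Fintype.equivFin (s × Fin (Module.finrank ℂ 𝔩))
  refine ⟨_, fun i => (eqv.symm i).1, fun i => b (eqv.symm i).2, fun i => b.coord (eqv.symm i).2,
    fun L hL => ?_⟩
  rw [eqv.symm.sum_comp (fun j : s × Fin (Module.finrank ℂ 𝔩) =>
    b.coord j.2 (coeffs L j.1) • monoLoop (j.1 : ℤ) (b j.2)), Fintype.sum_prod_type]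
  have h1 : ∀ m : ℤ, ∑ j, b.coord j (coeffs L m) • monoLoop m (b j) = monoLoop m (coeffs L m) := by
    intro m
    change _ = TensorProduct.mk ℂ _ _ (AddMonoidAlgebra.single m 1) (coeffs L m)
    conv_rhs => rw [← b.sum_repr (coeffs L m)]
    rw [map_sum]
    refine Finset.sum_congr rfl fun j _ => ?_
    rw [map_smul]
    rfl
  simp only [h1]
  rw [Finset.sum_coe_sort s fun m => monoLoop m (coeffs L m)]
  conv_lhs => rw [loop_eq_sum L]
  refine Finset.sum_subset (hs L hL) fun m _ hm => ?_
  rw [Finsupp.notMem_support_iff.1 hm]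
  simp [monoLoop]

lemma eventuallyEq_of_hasVelocity [FiniteDimensional ℂ 𝔩] {F : Loop 𝔩 → Loop 𝔩}
    (hF : CoeffLipschitz F) {c c' : ℝ → Loop 𝔩} {t₀ : ℝ}
    (hc : ∀ᶠ t in 𝓝 t₀, HasVelocity c (F (c t)) t)
    (hc' : ∀ᶠ t in 𝓝 t₀, HasVelocity c' (F (c' t)) t) (h : c t₀ = c' t₀) : c =ᶠ[𝓝 t₀] c' := by
  obtain ⟨E₁, hE₁, hcE₁⟩ := eventually_mem_finiteDimensional hc.self_of_nhds.continuousAt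
  obtain ⟨E₂, hE₂, hcE₂⟩ := eventually_mem_finiteDimensional hc'.self_of_nhds.continuousAt
  obtain ⟨n, p, v, l, hl⟩ := exists_monomial_coordinates (E₁ ⊔ E₂)
  let q : Fin n → Module.Dual ℂ (Loop 𝔩) := fun i => l i ∘ₗ coeffLin 𝔩 (p i)
  have hq : ∀ L ∈ E₁ ⊔ E₂, L = ∑ i, q i L • monoLoop (p i) (v i) := hl
  set f : (Fin n → ℂ) → Fin n → ℂ := fun x i => q i (F (∑ j, x j • monoLoop (p j) (v j))) with hf
  have hfL : LocallyLipschitz f := LocallyLipschitz.pi_complex fun i => hF n p v (p i) (l i)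
  obtain ⟨K, U, hU, hK⟩ := hfL fun i => q i (c t₀)
  have key : ∀ d : ℝ → Loop 𝔩, (∀ᶠ t in 𝓝 t₀, HasVelocity d (F (d t)) t) →
      (∀ᶠ t in 𝓝 t₀, d t ∈ E₁ ⊔ E₂) → d t₀ = c t₀ →
      ∀ᶠ t in 𝓝 t₀, HasDerivAt (fun s i => q i (d s)) (f fun i => q i (d t)) t ∧
        (fun i => q i (d t)) ∈ U := by
    intro d hd hdE hd0
    have hcont : ContinuousAt (fun s i => q i (d s)) t₀ :=
      continuousAt_pi.2 fun i => hd.self_of_nhds.continuousAt (q i)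
    have h3 : ∀ᶠ t in 𝓝 t₀, (fun i => q i (d t)) ∈ U :=
      hcont.eventually_mem (by simpa [hd0] using hU)
    filter_upwards [hd, hdE, h3] with t ht htE htU
    refine ⟨hasDerivAt_pi.2 fun i => ?_, htU⟩
    simp only [hf]
    rw [← hq _ htE]
    exact ht (q i)
  have h1 := key c hc (hcE₁.mono fun t ht => Submodule.mem_sup_left ht) rfl
  have h2 := key c' hc' (hcE₂.mono fun t ht => Submodule.mem_sup_right ht) h.symm
  have h3 := ODE_solution_unique_of_eventually (v := fun _ => f) (s := fun _ => U)
    (Filter.Eventually.of_forall fun _ => hK) h1 h2 (by simp only [h])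
  filter_upwards [h3, hcE₁, hcE₂] with t ht ht1 ht2
  rw [hq _ (Submodule.mem_sup_left ht1), hq _ (Submodule.mem_sup_right ht2)]
  exact Finset.sum_congr rfl fun i _ => by rw [congrFun ht i]

/-- Two solutions on an interval containing `0` that agree at `0` agree throughout, if the right-hand
side is coefficientwise locally Lipschitz. -/
lemma eq_of_hasVelocity [FiniteDimensional ℂ 𝔩] {F : Loop 𝔩 → Loop 𝔩} (hF : CoeffLipschitz F)
    {c c' : ℝ → Loop 𝔩} {a b : ℝ} (ha : a < 0) (hb : 0 < b)
    (hc : ∀ t ∈ Set.Ioo a b, HasVelocity c (F (c t)) t)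
    (hc' : ∀ t ∈ Set.Ioo a b, HasVelocity c' (F (c' t)) t) (h : c 0 = c' 0) :
    ∀ t ∈ Set.Ioo a b, c t = c' t := by
  have hpre : IsPreconnected (Set.Ioo a b) := isPreconnected_Ioo
  -- the set of times at which the solutions agree is open by local uniqueness, and the set of
  -- times at which they differ is open because linear functionals of solutions are continuous
  by_contra! hne
  obtain ⟨t₁, ht₁, hne⟩ := hne
  have hev : ∀ t ∈ Set.Ioo a b, ∀ {P : ℝ → Prop}, (∀ s ∈ Set.Ioo a b, P s) → ∀ᶠ s in 𝓝 t, P s :=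
    fun t ht P hP => Filter.eventually_of_mem (Ioo_mem_nhds ht.1 ht.2) hP
  have hopen1 : IsOpen {t | t ∈ Set.Ioo a b ∧ c t = c' t} := by
    rw [isOpen_iff_mem_nhds]
    rintro t ⟨ht, hct⟩
    filter_upwards [eventuallyEq_of_hasVelocity hF (hev t ht hc) (hev t ht hc') hct,
      Ioo_mem_nhds ht.1 ht.2] with s hs hs'
    exact ⟨hs', hs⟩
  have hopen2 : IsOpen {t | t ∈ Set.Ioo a b ∧ c t ≠ c' t} := by
    rw [isOpen_iff_mem_nhds]
    rintro t ⟨ht, hct⟩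
    obtain ⟨l, hl⟩ : ∃ l : Module.Dual ℂ (Loop 𝔩), l (c t) ≠ l (c' t) := by
      by_contra! hl
      exact hct (eq_of_forall_dual hl)
    have h1 : ∀ᶠ s in 𝓝 t, l (c s) ≠ l (c' s) :=
      ((hc t ht).continuousAt l).ne_iff_eventually_ne ((hc' t ht).continuousAt l) |>.1 hl
    filter_upwards [h1, Ioo_mem_nhds ht.1 ht.2] with s hs hs'
    exact ⟨hs', fun e => hs (by rw [e])⟩
  obtain ⟨t, -, ht1, ht2⟩ := hpre _ _ hopen1 hopen2
    (fun t ht => (em (c t = c' t)).imp (fun h => ⟨ht, h⟩) fun h => ⟨ht, h⟩)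
    ⟨0, ⟨ha, hb⟩, ⟨ha, hb⟩, h⟩ ⟨t₁, ht₁, ht₁, hne⟩
  exact ht2.2 ht1.2

lemma loop_smul_lie (a : ℂ) (L L' : Loop 𝔩) : ⁅a • L, L'⁆ = a • ⁅L, L'⁆ :=
  evalLoop_injective fun z => by simp only [evalLoop_lie, evalLoop_smul, smul_lie]

/-- The bracket with `M` on the right, linearly. -/
def lieRight (M : Loop 𝔩) : Loop 𝔩 →ₗ[ℂ] Loop 𝔩 where
  toFun L := ⁅L, M⁆
  map_add' L L' := loop_add_lie L L' M
  map_smul' a L := loop_smul_lie a L M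

lemma coeffs_monoLoop_lie (j m : ℤ) (v : 𝔩) (M : Loop 𝔩) :
    coeffs ⁅monoLoop j v, M⁆ m = ⁅v, coeffs M (m - j)⁆ := by
  induction M using loop_induction with
  | hmono n w =>
    rw [lie_monoLoop, coeffs_monoLoop, coeffs_monoLoop, Finsupp.single_apply, Finsupp.single_apply]
    have : j + n = m ↔ n = m - j := by omega
    simp only [this]
    split_ifs <;> simp
  | hzero => simp [loop_lie_zero]
  | hadd L L' h h' => simp [loop_lie_add, h, h']

lemma coeffs_half_rMat (M : Loop 𝔩) (m : ℤ) :
    coeffs ((1 / 2 : ℂ) • rMat M) m = (if 0 ≤ m then (1 / 2 : ℂ) else -(1 / 2)) • coeffs M m := by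
  simp only [rMat, posPart, negPart, coeffs_smul, coeffs_sub, coeffs_ofCoeffs, Finsupp.smul_apply,
    Finsupp.sub_apply, Finsupp.filter_apply]
  by_cases h : 0 ≤ m
  · simp [h, not_lt.2 h]
  · simp [h, not_le.1 h]

/-- The right-hand side of the Lax equation is coefficientwise locally Lipschitz, because a
coefficient of a bracket involves finitely many coefficients of its second entry. -/
lemma CoeffLipschitz.lax {Ξ : Loop 𝔩 → Loop 𝔩} (hΞ : CoeffLipschitz Ξ) :
    CoeffLipschitz fun L => ⁅L, (1 / 2 : ℂ) • rMat (Ξ L)⁆ := by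
  intro n p v m l
  set L : (Fin n → ℂ) → Loop 𝔩 := fun x => ∑ i, x i • monoLoop (p i) (v i) with hL
  change LocallyLipschitz fun x : Fin n → ℂ => l (coeffs ⁅L x, (1 / 2 : ℂ) • rMat (Ξ (L x))⁆ m)
  have h1 : ∀ x : Fin n → ℂ, l (coeffs ⁅L x, (1 / 2 : ℂ) • rMat (Ξ (L x))⁆ m) =
      ∑ i, x i * ((if 0 ≤ m - p i then (1 / 2 : ℂ) else -(1 / 2)) *
        (l ∘ₗ LieAlgebra.ad ℂ 𝔩 (v i)) (coeffs (Ξ (L x)) (m - p i))) := by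
    intro x
    change (l ∘ₗ coeffLin 𝔩 m ∘ₗ lieRight ((1 / 2 : ℂ) • rMat (Ξ (L x)))) (L x) = _
    nth_rw 2 [hL]
    simp only [map_sum, map_smul, smul_eq_mul]
    refine Finset.sum_congr rfl fun i _ => ?_
    congr 1
    change l (coeffs ⁅monoLoop (p i) (v i), (1 / 2 : ℂ) • rMat (Ξ (L x))⁆ m) = _
    rw [coeffs_monoLoop_lie, coeffs_half_rMat, lie_smul, map_smul, smul_eq_mul]
    rfl
  simp only [h1]
  refine LocallyLipschitz.finset_sum _ fun i _ => LocallyLipschitz.mul_complex ?_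
    (LocallyLipschitz.mul_complex (LocallyLipschitz.const _) (hΞ n p v _ _))
  exact locallyLipschitz_of_differentiable (by fun_prop)

end Uniqueness

/-! ### The Lax flow solved by a Birkhoff factorization -/

lemma polyLoops_freeze {S : Set ℤ} {V : Type*} [AddCommGroup V] [Module ℂ V] {f : ℝ → ℂˣ → V}
    (hf : f ∈ polyLoops S V) (t₀ : ℝ) : (fun _ z => f t₀ z) ∈ polyLoops S V := by
  induction hf using polyLoops_induction with
  | hmono n m hm v =>
    have : (fun (_ : ℝ) z => monomialLoop n m v t₀ z) = monomialLoop 0 m ((t₀ : ℂ) ^ n • v) := by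
      ext t z
      simp only [monomialLoop, smul_smul]
      congr 1
      ring
    rw [this]
    exact monomialLoop_mem 0 hm _
  | hzero => exact Submodule.zero_mem _
  | hadd f g _ _ hf hg => exact Submodule.add_mem _ hf hg

lemma Iio_add_Iic : ∀ m ∈ Set.Iio (0 : ℤ), ∀ m' ∈ Set.Iic (0 : ℤ), m + m' ∈ Set.Iio (0 : ℤ) := by
  simp only [Set.mem_Iio, Set.mem_Iic]
  omega

lemma Iic_add_Iic : ∀ m ∈ Set.Iic (0 : ℤ), ∀ m' ∈ Set.Iic (0 : ℤ), m + m' ∈ Set.Iic (0 : ℤ) := by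
  simp only [Set.mem_Iic]
  omega

lemma Ici_add_Ici : ∀ m ∈ Set.Ici (0 : ℤ), ∀ m' ∈ Set.Ici (0 : ℤ), m + m' ∈ Set.Ici (0 : ℤ) := by
  simp only [Set.mem_Ici]
  omega

section Flow

variable {ι Γ 𝔩 : Type*} [Group Γ] [LieRing 𝔩] [LieAlgebra ℂ 𝔩] (K : Coords ι Γ 𝔩)
  (Ad : Γ →* Module.End ℂ 𝔩)

variable (𝔩) in
/-- The adjoint representation, as a linear map into the algebra of endomorphisms. -/
def adEnd : 𝔩 →ₗ[ℂ] Module.End ℂ 𝔩 :=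
  LinearMap.mk₂ ℂ (fun x y => ⁅x, y⁆) add_lie smul_lie lie_add lie_smul

@[simp] lemma adEnd_apply (x y : 𝔩) : adEnd 𝔩 x y = ⁅x, y⁆ := rfl

/-- The adjoint action of the loop `g` and of its inverse preserves Laurent polynomial loops. -/
def ActsOnLoops (g : ℂˣ → Γ) : Prop :=
  (∀ Y : Loop 𝔩, ∃ Y' : Loop 𝔩, ∀ z, evalLoop z Y' = Ad (g z) (evalLoop z Y)) ∧
    ∀ Y : Loop 𝔩, ∃ Y' : Loop 𝔩, ∀ z, evalLoop z Y' = Ad (g z)⁻¹ (evalLoop z Y)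

/-- The curves `g₋(t)`, `g₊(t)` are the unique Birkhoff factorizations of `exp(-tX)`, and their
adjoint actions are polynomial in `t` and Laurent polynomial in `λ`, with the exponents of `λ` that
belong to a Birkhoff factorization. -/
structure IsBirkhoffCurve (X : Loop 𝔩) (gm gp : ℝ → ℂˣ → Γ) : Prop where
  birkhoff : ∀ t : ℝ, IsBirkhoff K (-(t : ℂ) • X) (gm t) (gp t)
  unique : ∀ t : ℝ, ∀ hm hp : ℂˣ → Γ, IsBirkhoff K (-(t : ℂ) • X) hm hp → hm = gm t ∧ hp = gp t
  gm_zero : gm 0 = 1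
  gp_zero : gp 0 = 1
  laurent : ∀ t, IsLaurentLoop K (gm t) ∧ IsLaurentLoop K (gp t)
  smooth : ∀ z i, ContDiff ℝ (⊤ : ℕ∞) (fun t => K.coord i (gm t z)) ∧
    ContDiff ℝ (⊤ : ℕ∞) (fun t => K.coord i (gp t z))
  ad_gm : (fun t z => Ad (gm t z) - 1) ∈ polyLoops (Set.Iio 0) (Module.End ℂ 𝔩)
  ad_gm_inv : (fun t z => Ad (gm t z)⁻¹) ∈ polyLoops (Set.Iic 0) (Module.End ℂ 𝔩)
  ad_gp : (fun t z => Ad (gp t z)) ∈ polyLoops (Set.Ici 0) (Module.End ℂ 𝔩)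
  ad_gp_inv : (fun t z => Ad (gp t z)⁻¹) ∈ polyLoops (Set.Ici 0) (Module.End ℂ 𝔩)
  velocity : ∀ t z, HasVelocity (fun s => Ad ((gm s z)⁻¹ * gp s z))
    (-(Ad ((gm t z)⁻¹ * gp t z) * adEnd 𝔩 (evalLoop z X))) t

variable {K Ad}

lemma ad_conj (hAd : ∀ g x y, Ad g ⁅x, y⁆ = ⁅Ad g x, Ad g y⁆) (g : Γ) (x : 𝔩) :
    Ad g * adEnd 𝔩 x * Ad g⁻¹ = adEnd 𝔩 (Ad g x) := by
  ext y
  simp only [Module.End.mul_apply, adEnd_apply, hAd]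
  rw [← Module.End.mul_apply, ← map_mul, mul_inv_cancel, map_one, Module.End.one_apply]

lemma actsOnLoops_of_mem {g : ℂˣ → Γ}
    (h : (fun _ z => Ad (g z)) ∈ polyLoops Set.univ (Module.End ℂ 𝔩))
    (h' : (fun _ z => Ad (g z)⁻¹) ∈ polyLoops Set.univ (Module.End ℂ 𝔩)) : ActsOnLoops Ad g := by
  have key : ∀ A : ℂˣ → Module.End ℂ 𝔩, (fun _ z => A z) ∈ polyLoops Set.univ (Module.End ℂ 𝔩) →
      ∀ Y : Loop 𝔩, ∃ Y' : Loop 𝔩, ∀ z, evalLoop z Y' = A z (evalLoop z Y) := by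
    intro A hA Y
    obtain ⟨c, hc, -⟩ := exists_loop_curve (polyLoops_bilin (S'' := Set.univ)
      (LinearMap.id : Module.End ℂ 𝔩 →ₗ[ℂ] 𝔩 →ₗ[ℂ] 𝔩) (by simp) hA
      (evalLoop_mem_polyLoops Y (S := Set.univ) (by simp)))
    exact ⟨c 0, fun z => hc 0 z⟩
  exact ⟨key _ h, key _ h'⟩

namespace IsBirkhoffCurve

variable {X : Loop 𝔩} {gm gp : ℝ → ℂˣ → Γ} (h : IsBirkhoffCurve K Ad X gm gp)
include h

lemma ad_gm_mem : (fun t z => Ad (gm t z)) ∈ polyLoops (Set.Iic 0) (Module.End ℂ 𝔩) := by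
  have h1 := Submodule.add_mem _ (polyLoops_mono Set.Iio_subset_Iic_self h.ad_gm)
    (const_mem_polyLoops (S := Set.Iic 0) (by simp) (1 : Module.End ℂ 𝔩))
  convert h1 using 1
  ext1 t; ext1 z
  simp

lemma actsOnLoops (t : ℝ) : ActsOnLoops Ad (gm t) :=
  actsOnLoops_of_mem (polyLoops_freeze (polyLoops_mono (Set.subset_univ _) h.ad_gm_mem) t)
    (polyLoops_freeze (polyLoops_mono (Set.subset_univ _) h.ad_gm_inv) t)

/-- `Ad (exp(-tX))` fixes everything that commutes with `X`. -/
lemma ad_apply_eq (t : ℝ) (z : ℂˣ) {y : 𝔩} (hy : ⁅evalLoop z X, y⁆ = 0) :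
    Ad (gp t z) y = Ad (gm t z) y := by
  have h1 : ∀ t, HasVelocity (fun s => Ad ((gm s z)⁻¹ * gp s z) y) 0 t := fun t => by
    have := (h.velocity t z).map (LinearMap.applyₗ y)
    simpa [hy] using this
  have h2 : Ad ((gm t z)⁻¹ * gp t z) y = y := by
    have := eq_of_velocity_eq_zero h1 t 0
    rw [this, h.gm_zero, h.gp_zero]
    simp
  have h3 := congrArg (Ad (gm t z)) h2
  rwa [← Module.End.mul_apply, ← map_mul, mul_inv_cancel_left] at h3

/-- The logarithmic derivative of `Ad g₋(t)` is `ad` of the negative part of `Ad g₋(t) X`: the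
logarithmic derivatives of `Ad g₋` and `Ad g₊` have negative and nonnegative exponents, and their
difference is `ad (Ad g₋(t) X)`. -/
lemma exists_logarithmic_derivative (hAd : ∀ g x y, Ad g ⁅x, y⁆ = ⁅Ad g x, Ad g y⁆) :
    ∃ ym ∈ polyLoops (Set.Iio 0) 𝔩, ∃ yp ∈ polyLoops (Set.Ici 0) 𝔩,
      (∀ t z, Ad (gm t z) (evalLoop z X) = ym t z + yp t z) ∧
      ∀ t z, HasVelocity (fun s => Ad (gm s z))
        (adEnd 𝔩 (ym t z) * Ad (gm t z)) t := by
  obtain ⟨dm, hdm, hdm'⟩ := exists_velocity_mem_polyLoops h.ad_gm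
  obtain ⟨dp, hdp, hdp'⟩ := exists_velocity_mem_polyLoops h.ad_gp
  have hdm1 : ∀ t z, HasVelocity (fun s => Ad (gm s z)) (dm t z) t := fun t z => by
    simpa using (hdm' t z).add (HasVelocity.const (1 : Module.End ℂ 𝔩) t)
  have hY : (fun t z => Ad (gm t z) (evalLoop z X)) ∈ polyLoops Set.univ 𝔩 :=
    polyLoops_bilin (S'' := Set.univ) (LinearMap.id : Module.End ℂ 𝔩 →ₗ[ℂ] 𝔩 →ₗ[ℂ] 𝔩) (by simp)
      h.ad_gm_mem (evalLoop_mem_polyLoops X (S := Set.univ) (by simp))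
  obtain ⟨ym, hym, yp, hyp, hsum⟩ := polyLoops_split hY
  have hsum' : ∀ t z, Ad (gm t z) (evalLoop z X) = ym t z + yp t z := fun t z =>
    congrFun (congrFun hsum t) z
  refine ⟨ym, hym, yp, hyp, hsum', fun t z => ?_⟩
  -- differentiate `Ad g₊ = Ad g₋ ∘ Ad (g₋⁻¹ g₊)`
  have hrel : ∀ t z, dp t z * Ad (gp t z)⁻¹ =
      dm t z * Ad (gm t z)⁻¹ - adEnd 𝔩 (ym t z + yp t z) := by
    intro t z
    have h1 := (hdm1 t z).bilin (h.velocity t z) (LinearMap.mul ℂ (Module.End ℂ 𝔩))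
    simp only [LinearMap.mul_apply', ← map_mul, mul_inv_cancel_left] at h1
    rw [(hdp' t z).unique h1, ← hsum', ← h.ad_apply_eq t z (lie_self _), ← ad_conj hAd]
    rw [mul_neg, add_mul, neg_mul, ← sub_eq_add_neg, mul_assoc, ← map_mul, mul_assoc (gm t z)⁻¹,
      mul_inv_cancel, mul_one, ← mul_assoc (Ad (gm t z)), ← map_mul, mul_inv_cancel_left]
  have hN : (fun t z => dm t z * Ad (gm t z)⁻¹ - adEnd 𝔩 (ym t z)) ∈
      polyLoops (Set.Iio 0) (Module.End ℂ 𝔩) :=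
    Submodule.sub_mem _
      (polyLoops_bilin (S'' := Set.Iio 0) (LinearMap.mul ℂ (Module.End ℂ 𝔩))
        Iio_add_Iic hdm h.ad_gm_inv)
      (polyLoops_map (adEnd 𝔩) hym)
  have hQ : (fun t z => dm t z * Ad (gm t z)⁻¹ - adEnd 𝔩 (ym t z)) ∈
      polyLoops (Set.Ici 0) (Module.End ℂ 𝔩) := by
    have h1 := Submodule.add_mem _
      (polyLoops_bilin (S'' := Set.Ici 0) (LinearMap.mul ℂ (Module.End ℂ 𝔩))
        Ici_add_Ici hdp h.ad_gp_inv)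
      (polyLoops_map (adEnd 𝔩) hyp)
    convert h1 using 1
    ext1 t; ext1 z
    change _ = dp t z * Ad (gp t z)⁻¹ + adEnd 𝔩 (yp t z)
    rw [hrel, map_add]
    abel
  have h0 := eq_of_mem_polyLoops hN hQ t z
  rw [← sub_eq_zero.1 h0, mul_assoc, ← map_mul, inv_mul_cancel, map_one, mul_one]
  exact hdm1 t z

/-- The Lax flow of an `Ad`-equivariant map `Ξ` with `[L, Ξ L] = 0` is solved by the Birkhoff
factorization of `exp(-t Ξ(L₀))`. -/
theorem solvedByFactorization [FiniteDimensional ℂ 𝔩]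
    (hAd : ∀ g x y, Ad g ⁅x, y⁆ = ⁅Ad g x, Ad g y⁆) {Ξ : Loop 𝔩 → Loop 𝔩}
    (hΞ : ∀ g, IsLaurentLoop K g → ActsOnLoops Ad g → ∀ L L' : Loop 𝔩,
      (∀ z, evalLoop z L' = Ad (g z) (evalLoop z L)) →
      ∀ z, evalLoop z (Ξ L') = Ad (g z) (evalLoop z (Ξ L)))
    (hcomm : ∀ L, ⁅L, Ξ L⁆ = 0) (hLip : CoeffLipschitz Ξ) {L₀ : Loop 𝔩} (hX : X = Ξ L₀) :
    ∃ L, SolvedByFactorization K (fun g => Ad g) X (fun L => ⁅L, (1 / 2 : ℂ) • rMat (Ξ L)⁆)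
      L₀ gm gp L := by
  obtain ⟨ym, hym, yp, hyp, hsum, hder⟩ := h.exists_logarithmic_derivative hAd
  have hmem : ∀ Y : Loop 𝔩, (fun t z => Ad (gm t z) (evalLoop z Y)) ∈ polyLoops Set.univ 𝔩 :=
    fun Y => polyLoops_bilin (S'' := Set.univ)
      (LinearMap.id : Module.End ℂ 𝔩 →ₗ[ℂ] 𝔩 →ₗ[ℂ] 𝔩) (by simp)
      h.ad_gm_mem (evalLoop_mem_polyLoops Y (S := Set.univ) (by simp))
  obtain ⟨c, hc, hcv⟩ := exists_loop_curve (hmem L₀)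
  have hΞc : ∀ t z, evalLoop z (Ξ (c t)) = ym t z + yp t z := fun t z => by
    rw [hΞ (gm t) (h.laurent t).1 (h.actsOnLoops t) L₀ (c t) (hc t) z, ← hX, hsum]
  have hneg : ∀ t z, evalLoop z (negPart (Ξ (c t))) = ym t z := by
    intro t z
    have h1 : (fun (_ : ℝ) z => evalLoop z (negPart (Ξ (c t))) - ym t z) =
        fun _ z => yp t z - evalLoop z (posPart (Ξ (c t))) := by
      ext1 _; ext1 z
      rw [sub_eq_sub_iff_add_eq_add, add_comm, ← evalLoop_add, posPart_add_negPart, hΞc, add_comm]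
    have h2 : (fun (_ : ℝ) z => evalLoop z (negPart (Ξ (c t))) - ym t z) ∈
        polyLoops (Set.Iio 0) 𝔩 :=
      Submodule.sub_mem _ (evalLoop_negPart_mem _) (polyLoops_freeze hym t)
    have h3 : (fun (_ : ℝ) z => evalLoop z (negPart (Ξ (c t))) - ym t z) ∈
        polyLoops (Set.Ici 0) 𝔩 := by
      rw [h1]
      exact Submodule.sub_mem _ (polyLoops_freeze hyp t) (evalLoop_posPart_mem _)
    exact sub_eq_zero.1 (eq_of_mem_polyLoops h2 h3 t z)
  have hcomm' : ∀ L z, ⁅evalLoop z L, evalLoop z (Ξ L)⁆ = 0 := fun L z => by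
    rw [← evalLoop_lie, hcomm, evalLoop_zero]
  have hsol : ∀ t, HasVelocity c ⁅c t, (1 / 2 : ℂ) • rMat (Ξ (c t))⁆ t := by
    intro t
    obtain ⟨v, hv⟩ := hcv t
    have : ⁅c t, (1 / 2 : ℂ) • rMat (Ξ (c t))⁆ = v := by
      refine evalLoop_injective fun z => ?_
      have h1 := hv.map (evalLin 𝔩 z)
      have h2 := (hder t z).map (LinearMap.applyₗ (evalLoop z L₀))
      simp only [evalLin_apply, hc] at h1
      have h3 := hcomm' (c t) z
      rw [hc] at h3
      rw [h1.unique h2, half_rMat]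
      simp only [evalLoop_lie, evalLoop_sub, evalLoop_smul, lie_sub, lie_smul, hneg, hc,
        LinearMap.applyₗ_apply_apply, Module.End.mul_apply, adEnd_apply]
      rw [h3, smul_zero, zero_sub, lie_skew]
    rw [this]
    exact hv
  have hc0 : c 0 = L₀ := evalLoop_injective fun z => by
    rw [hc, h.gm_zero, Pi.one_apply, map_one, Module.End.one_apply]
  refine ⟨c, h.birkhoff, h.unique, h.gm_zero, h.gp_zero, h.laurent, h.smooth, hc, fun t z => ?_,
    hc0, hsol, ?_⟩
  · rw [hc]
    refine (h.ad_apply_eq t z ?_).symm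
    rw [← lie_skew, hX, hcomm', neg_zero]
  · intro a b ha hb c' hc'0 hc' t ht
    exact eq_of_hasVelocity hLip.lax ha hb hc' (fun t _ => hsol t) (hc'0.trans hc0.symm) t ht

end IsBirkhoffCurve

end Flow

/-! ### The degree filtration and the exponential map of the truncated group -/

section Truncation

variable {H : Type*} [Ring H] [HopfAlgebra ℂ H] {𝒜 : ℕ → Submodule ℂ H} [GradedAlgebra 𝒜] {k : ℕ}
  [ConnectedGradedHopf 𝒜]

lemma conv_eq_zero {f g : Module.Dual ℂ H} {i j : ℕ} (hf : ∀ n < i, ∀ h ∈ 𝒜 n, f h = 0)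
    (hg : ∀ n < j, ∀ h ∈ 𝒜 n, g h = 0) {n : ℕ} (hn : n < i + j) {h : H} (hh : h ∈ 𝒜 n) :
    conv f g h = 0 := by
  rw [conv_apply]
  have hmem := ConnectedGradedHopf.comul_mem n h hh
  have key : (⨆ p ∈ Finset.HasAntidiagonal.antidiagonal n,
      LinearMap.range (TensorProduct.map (𝒜 p.1).subtype (𝒜 p.2).subtype)) ≤
      LinearMap.ker (TensorProduct.map f g) := by
    refine iSup₂_le fun p hp => ?_
    rintro _ ⟨x, rfl⟩
    have hp' := Finset.HasAntidiagonal.mem_antidiagonal.1 hp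
    induction x using TensorProduct.induction_on with
    | zero => simp
    | tmul a b =>
      simp only [LinearMap.mem_ker, TensorProduct.map_tmul, Submodule.subtype_apply]
      rcases lt_or_ge p.1 i with h1 | h1
      · rw [hf _ h1 _ a.2, TensorProduct.zero_tmul]
      · rw [hg p.2 (by omega) _ b.2, TensorProduct.tmul_zero]
    | add x y hx hy => rw [map_add]; exact Submodule.add_mem _ hx hy
  rw [LinearMap.mem_ker.1 (key hmem), map_zero]

lemma mem_degree_zero {h : H} (hh : h ∈ 𝒜 0) : ∃ c : ℂ, h = c • 1 := by
  rw [ConnectedGradedHopf.connected (𝒜 := 𝒜)] at hh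
  obtain ⟨c, hc⟩ := Submodule.mem_span_singleton.1 hh
  exact ⟨c, hc.symm⟩

variable (𝒜 k) in
/-- The truncated functionals that vanish in all degrees `< m`. -/
def lowerVanish (m : ℕ) : Submodule ℂ (TruncDual 𝒜 k) where
  carrier := {f | ∀ n < m, ∀ h ∈ 𝒜 n, f.toFun h = 0}
  zero_mem' := fun n _ h _ => by simp
  add_mem' := fun {f g} hf hg n hn h hh => by simp [hf n hn h hh, hg n hn h hh]
  smul_mem' := fun c f hf n hn h hh => by simp [hf n hn h hh]

lemma lowerVanish_antitone {m m' : ℕ} (h : m ≤ m') : lowerVanish 𝒜 k m' ≤ lowerVanish 𝒜 k m :=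
  fun _ hf n hn => hf n (hn.trans_le h)

lemma mul_mem_lowerVanish {f g : TruncDual 𝒜 k} {i j : ℕ} (hf : f ∈ lowerVanish 𝒜 k i)
    (hg : g ∈ lowerVanish 𝒜 k j) : f * g ∈ lowerVanish 𝒜 k (i + j) := by
  intro n hn h hh
  by_cases hnk : n ≤ k
  · rw [TruncDual.mul_def, trunc_apply_of_le _ hnk hh]
    exact conv_eq_zero hf hg hn hh
  · exact (f * g).vanish n (by omega) h hh

lemma mem_lowerVanish_zero (f : TruncDual 𝒜 k) : f ∈ lowerVanish 𝒜 k 0 := fun n hn => by omega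

lemma eq_zero_of_mem_lowerVanish {f : TruncDual 𝒜 k} (hf : f ∈ lowerVanish 𝒜 k (k + 1)) : f = 0 :=
  TruncDual.ext_graded fun n hn h hh => by rw [hf n (by omega) h hh]; rfl

lemma pow_mem_lowerVanish {f : TruncDual 𝒜 k} {m : ℕ} (hf : f ∈ lowerVanish 𝒜 k m) (i : ℕ) :
    f ^ i ∈ lowerVanish 𝒜 k (i * m) := by
  induction i with
  | zero => rw [zero_mul]; exact mem_lowerVanish_zero _
  | succ i ih => rw [pow_succ, add_mul, one_mul]; exact mul_mem_lowerVanish ih hf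

lemma IsInfChar.apply_one {Z : Module.Dual ℂ H} (hZ : IsInfChar Z) : Z 1 = 0 := by
  have h := hZ 1 1
  simp only [mul_one, Bialgebra.counit_one, one_mul] at h
  exact left_eq_add.1 h

lemma truncLie_le_lowerVanish {Z : TruncDual 𝒜 k} (hZ : Z ∈ truncLie 𝒜 k) :
    Z ∈ lowerVanish 𝒜 k 1 := by
  intro n hn h hh
  obtain rfl : n = 0 := by omega
  obtain ⟨c, rfl⟩ := mem_degree_zero hh
  rw [map_smul, IsInfChar.apply_one hZ, smul_zero]

lemma truncGroup_sub_one_mem (g : truncGroup 𝒜 k) :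
    ((g : (TruncDual 𝒜 k)ˣ) : TruncDual 𝒜 k) - 1 ∈ lowerVanish 𝒜 k 1 := by
  intro n hn h hh
  obtain rfl : n = 0 := by omega
  obtain ⟨c, rfl⟩ := mem_degree_zero hh
  obtain ⟨u, φ, hφ⟩ := g
  simp only [hφ, TruncDual.one_def, TruncDual.sub_toFun, LinearMap.sub_apply]
  rw [trunc_apply_of_le _ (Nat.zero_le k) hh, trunc_apply_of_le _ (Nat.zero_le k) hh]
  simp

/-- The exponential series, cut off after the term of order `k`. -/
def truncExp (Z : TruncDual 𝒜 k) : TruncDual 𝒜 k :=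
  ∑ i ∈ Finset.range (k + 1), ((i.factorial : ℂ)⁻¹) • Z ^ i

lemma pow_eq_zero_of_lt {Z : TruncDual 𝒜 k} (hZ : Z ∈ lowerVanish 𝒜 k 1) {i : ℕ} (hi : k < i) :
    Z ^ i = 0 :=
  eq_zero_of_mem_lowerVanish (lowerVanish_antitone (by omega) (pow_mem_lowerVanish hZ i))

lemma truncExp_add {Z W : TruncDual 𝒜 k} (hZ : Z ∈ lowerVanish 𝒜 k 1)
    (hW : W ∈ lowerVanish 𝒜 k 1) (h : Commute Z W) :
    truncExp (Z + W) = truncExp Z * truncExp W := by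
  let _ : Module ℚ (TruncDual 𝒜 k) := Module.compHom _ (algebraMap ℚ ℂ)
  have key : ∀ Y ∈ lowerVanish 𝒜 k 1, IsNilpotent.exp Y = truncExp Y := by
    intro Y hY
    rw [IsNilpotent.exp_eq_sum (pow_eq_zero_of_lt hY (Nat.lt_succ_self k)), truncExp]
    refine Finset.sum_congr rfl fun i _ => ?_
    change (algebraMap ℚ ℂ _) • Y ^ i = _
    simp
  rw [← key _ hZ, ← key _ hW, ← key _ (Submodule.add_mem _ hZ hW)]
  exact IsNilpotent.exp_add_of_commute h ⟨k + 1, pow_eq_zero_of_lt hZ (Nat.lt_succ_self k)⟩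
    ⟨k + 1, pow_eq_zero_of_lt hW (Nat.lt_succ_self k)⟩

lemma truncExp_zero : truncExp (0 : TruncDual 𝒜 k) = 1 := by
  rw [truncExp, Finset.sum_eq_single 0]
  · simp
  · intro i _ hi; simp [hi]
  · simp

lemma truncExp_sub_one (Z : TruncDual 𝒜 k) :
    truncExp Z - 1 = ∑ i ∈ Finset.range k, (((i + 1).factorial : ℂ)⁻¹) • Z ^ (i + 1) := by
  rw [truncExp, Finset.sum_range_succ']
  simp

lemma truncExp_sub_one_sub_mem {Z : TruncDual 𝒜 k} {m : ℕ} (hm : 1 ≤ m)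
    (hZ : Z ∈ lowerVanish 𝒜 k m) : truncExp Z - 1 - Z ∈ lowerVanish 𝒜 k (m + 1) := by
  rcases Nat.eq_zero_or_pos k with rfl | hk
  · -- for `k = 0` everything in positive degree is discarded
    have : Z = 0 := eq_zero_of_mem_lowerVanish (lowerVanish_antitone (by omega) hZ)
    rw [this, truncExp_zero]
    simp
  obtain ⟨j, rfl⟩ := Nat.exists_eq_add_of_le' hk
  rw [truncExp_sub_one, Finset.sum_range_succ']
  simp only [zero_add, Nat.factorial_one, Nat.cast_one, inv_one, one_smul, pow_one,
    add_sub_cancel_right]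
  refine Submodule.sum_mem _ fun i _ => Submodule.smul_mem _ _
    (lowerVanish_antitone ?_ (pow_mem_lowerVanish hZ (i + 1 + 1)))
  nlinarith [Nat.zero_le (i * m)]

/-- The divided convolution powers `Z ^ n / n!`. -/
def divPow (Z : Module.Dual ℂ H) : ℕ → Module.Dual ℂ H
  | 0 => Coalgebra.counit
  | n + 1 => ((n + 1 : ℂ)⁻¹) • conv Z (divPow Z n)

lemma conv_divPow (Z : Module.Dual ℂ H) (n : ℕ) :
    conv Z (divPow Z n) = ((n : ℂ) + 1) • divPow Z (n + 1) := by
  have hn : (n : ℂ) + 1 ≠ 0 := by exact_mod_cast Nat.succ_ne_zero n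
  rw [divPow, smul_smul, mul_inv_cancel₀ hn, one_smul]

/-- The product formula for divided powers of an infinitesimal character, by induction from the
derivation property. -/
lemma divPow_mul {Z : Module.Dual ℂ H} (hZ : IsInfChar Z) (n : ℕ) (a b : H) :
    divPow Z n (a * b) =
      ∑ p ∈ Finset.HasAntidiagonal.antidiagonal n, divPow Z p.1 a * divPow Z p.2 b := by
  induction n generalizing a b with
  | zero => simp [divPow]
  | succ n ih =>
    have hn : (n : ℂ) + 1 ≠ 0 := by exact_mod_cast Nat.succ_ne_zero n
    refine mul_left_cancel₀ hn ?_
    have h1 := conv_mul_formula (p := ![Z, Coalgebra.counit]) (q := ![Coalgebra.counit, Z])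
      (p' := fun p : Finset.HasAntidiagonal.antidiagonal n => divPow Z p.1.1)
      (q' := fun p : Finset.HasAntidiagonal.antidiagonal n => divPow Z p.1.2)
      (fun x y => by simpa [Fin.sum_univ_two] using hZ x y)
      (fun x y => by
        rw [ih, ← Finset.sum_coe_sort]) a b
    rw [conv_divPow] at h1
    simp only [Fin.sum_univ_two, Matrix.cons_val_zero, Matrix.cons_val_one, conv_divPow,
      TruncDual.counit_conv, LinearMap.smul_apply, smul_eq_mul] at h1
    rw [h1, Finset.sum_coe_sort (Finset.HasAntidiagonal.antidiagonal n) (fun p => ((p.1 : ℂ) + 1) *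
      divPow Z (p.1 + 1) a * divPow Z p.2 b),
      Finset.sum_coe_sort (Finset.HasAntidiagonal.antidiagonal n)
      (fun p => divPow Z p.1 a * (((p.2 : ℂ) + 1) * divPow Z (p.2 + 1) b))]
    have h2 := Finset.Nat.sum_antidiagonal_succ (n := n)
      (f := fun p => (p.1 : ℂ) * divPow Z p.1 a * divPow Z p.2 b)
    have h3 := Finset.Nat.sum_antidiagonal_succ' (n := n)
      (f := fun p => divPow Z p.1 a * ((p.2 : ℂ) * divPow Z p.2 b))
    simp only [Nat.cast_zero, zero_mul, mul_zero, zero_add, Nat.cast_add,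
      Nat.cast_one] at h2 h3
    rw [← h2, ← h3, ← Finset.sum_add_distrib, Finset.mul_sum]
    refine Finset.sum_congr rfl fun p hp => ?_
    have hp' : (p.1 : ℂ) + p.2 = n + 1 := by
      exact_mod_cast Finset.HasAntidiagonal.mem_antidiagonal.1 hp
    rw [← hp']
    ring

lemma divPow_eq_zero {Z : Module.Dual ℂ H} (hZ : IsInfChar Z) (n : ℕ) {m : ℕ} (hm : m < n) {h : H}
    (hh : h ∈ 𝒜 m) : divPow Z n h = 0 := by
  induction n generalizing m h with
  | zero => omega
  | succ n ih =>
    rw [divPow, LinearMap.smul_apply]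
    rw [conv_eq_zero (𝒜 := 𝒜) (i := 1) (j := n) ?_ (fun m hm h hh => ih hm hh) (by omega) hh,
      smul_zero]
    intro m hm h hh
    obtain rfl : m = 0 := by omega
    obtain ⟨c, rfl⟩ := mem_degree_zero hh
    rw [map_smul, hZ.apply_one, smul_zero]

lemma trunc_divPow (Z : Module.Dual ℂ H) (n : ℕ) :
    trunc 𝒜 k (divPow Z n) = ((n.factorial : ℂ)⁻¹) • trunc 𝒜 k Z ^ n := by
  induction n with
  | zero => simp [divPow, TruncDual.one_def]
  | succ n ih =>
    rw [divPow, TruncDual.trunc_smul, TruncDual.trunc_conv, ih, pow_succ', mul_smul_comm,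
      smul_smul, Nat.factorial_succ]
    push_cast
    rw [mul_inv]

lemma exists_generating_polynomial (𝒜 : ℕ → Submodule ℂ H) [GradedAlgebra 𝒜]
    [ConnectedGradedHopf 𝒜] {Z : Module.Dual ℂ H} (hZ : IsInfChar Z) (h : H) :
    ∃ p : Polynomial ℂ, ∀ n, p.coeff n = divPow Z n h := by
  classical
  induction h using DirectSum.Decomposition.inductionOn 𝒜 with
  | zero => exact ⟨0, by simp⟩
  | @homogeneous i x =>
    refine ⟨∑ j ∈ Finset.range (i + 1), Polynomial.monomial j (divPow Z j x), fun n => ?_⟩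
    simp only [Polynomial.finsetSum_coeff, Polynomial.coeff_monomial, Finset.sum_ite_eq',
      Finset.mem_range]
    split_ifs with hn
    · rfl
    · exact (divPow_eq_zero hZ n (by omega) x.2).symm
  | add x y hx hy =>
    obtain ⟨p, hp⟩ := hx
    obtain ⟨q, hq⟩ := hy
    exact ⟨p + q, by simp [hp, hq]⟩

/-- The convolution exponential of an infinitesimal character is a character: the generating
polynomials `∑ (Z ^ n / n!)(h) s ^ n` are multiplicative in `h`, and are evaluated at `s = 1`. -/
lemma exists_character_exp {Z : TruncDual 𝒜 k} (hZ : Z ∈ truncLie 𝒜 k) :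
    ∃ φ : H →ₐ[ℂ] ℂ, truncExp Z = trunc 𝒜 k φ.toLinearMap := by
  have hZ' : IsInfChar Z.toFun := hZ
  choose P hP using exists_generating_polynomial 𝒜 hZ'
  let Plin : H →ₗ[ℂ] Polynomial ℂ :=
    { toFun := P
      map_add' := fun x y => by ext n; simp [hP]
      map_smul' := fun c x => by ext n; simp [hP] }
  have hone : Plin 1 = 1 := by
    ext n
    change (P 1).coeff n = _
    rw [hP, Polynomial.coeff_one]
    rcases Nat.eq_zero_or_pos n with rfl | hn
    · simp [divPow]
    · rw [if_neg (by omega)]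
      exact divPow_eq_zero (𝒜 := 𝒜) hZ' n hn (SetLike.one_mem_graded 𝒜)
  have hmul : ∀ x y, Plin (x * y) = Plin x * Plin y := by
    intro x y
    ext n
    change (P (x * y)).coeff n = (P x * P y).coeff n
    rw [hP, Polynomial.coeff_mul, divPow_mul hZ']
    simp only [hP]
  refine ⟨(Polynomial.aeval (1 : ℂ)).comp (AlgHom.ofLinearMap Plin hone hmul), ?_⟩
  refine TruncDual.ext_graded fun n hn h hh => ?_
  rw [trunc_apply_of_le _ hn hh]
  change _ = Polynomial.aeval (1 : ℂ) (P h)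
  have hdeg : (P h).natDegree < k + 1 := by
    refine Nat.lt_succ_of_le (Polynomial.natDegree_le_iff_coeff_eq_zero.2 fun N hN => ?_)
    rw [hP]
    exact divPow_eq_zero hZ' N (by omega) hh
  rw [Polynomial.coe_aeval_eq_eval, Polynomial.eval_eq_sum_range' hdeg, truncExp]
  have hsum : ∀ s : Finset ℕ, (∑ i ∈ s, ((i.factorial : ℂ)⁻¹) • Z ^ i).toFun h =
      ∑ i ∈ s, (((i.factorial : ℂ)⁻¹) • Z ^ i).toFun h := by
    intro s
    rw [← LinearMap.sum_apply]
    exact congrArg (fun f : Module.Dual ℂ H => f h) (map_sum (TruncDual.toDualHom 𝒜 k) _ s)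
  rw [hsum]
  refine Finset.sum_congr rfl fun i _ => ?_
  rw [hP, one_pow, mul_one, ← trunc_apply_of_le (k := k) (divPow Z.toFun i) hn hh, trunc_divPow,
    trunc_toFun]

lemma truncExp_mul_neg {Z : TruncDual 𝒜 k} (hZ : Z ∈ lowerVanish 𝒜 k 1) :
    truncExp Z * truncExp (-Z) = 1 := by
  rw [← truncExp_add hZ (Submodule.neg_mem _ hZ) (Commute.neg_right (Commute.refl Z)),
    add_neg_cancel, truncExp_zero]

/-- The exponential map `𝔤⁽ᵏ⁾ → G⁽ᵏ⁾`. -/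
def groupExp (Z : truncLie 𝒜 k) : truncGroup 𝒜 k :=
  ⟨{ val := truncExp Z
     inv := truncExp (-Z)
     val_inv := truncExp_mul_neg (truncLie_le_lowerVanish Z.2)
     inv_val := by
      have h := truncExp_mul_neg (Submodule.neg_mem _ (truncLie_le_lowerVanish Z.2))
      rwa [neg_neg] at h }, exists_character_exp Z.2⟩

variable (𝒜 k) in
/-- The inclusion of the truncated group into the truncated convolution algebra. -/
def groupVal : truncGroup 𝒜 k →* TruncDual 𝒜 k := (Units.coeHom _).comp (truncGroup 𝒜 k).subtype

lemma groupVal_injective : Function.Injective (groupVal 𝒜 k) :=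
  fun _ _ h => Subtype.ext (Units.ext h)

@[simp] lemma groupVal_groupExp (Z : truncLie 𝒜 k) :
    groupVal 𝒜 k (groupExp Z) = truncExp (Z : TruncDual 𝒜 k) := rfl

lemma groupExp_add {Z W : truncLie 𝒜 k} (h : Commute (Z : TruncDual 𝒜 k) W) :
    groupExp (Z + W) = groupExp Z * groupExp W :=
  groupVal_injective (by
    rw [map_mul]
    exact truncExp_add (truncLie_le_lowerVanish Z.2) (truncLie_le_lowerVanish W.2) h)

lemma groupExp_zero : groupExp (0 : truncLie 𝒜 k) = 1 := groupVal_injective truncExp_zero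

lemma groupExp_neg (Z : truncLie 𝒜 k) : groupExp (-Z) = (groupExp Z)⁻¹ := by
  rw [eq_inv_iff_mul_eq_one, ← groupExp_add (by simp), neg_add_cancel,
    groupExp_zero]

lemma groupExp_smul_add (s t : ℂ) (Z : truncLie 𝒜 k) :
    groupExp ((s + t) • Z) = groupExp (s • Z) * groupExp (t • Z) := by
  rw [add_smul, groupExp_add]
  exact ((Commute.refl _).smul_left s).smul_right t

end Truncation

/-! ### Birkhoff factorization in the truncated group -/

lemma mem_polyLoops_of_subtype {S : Set ℤ} {V : Type*} [AddCommGroup V] [Module ℂ V]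
    {E : Submodule ℂ V} {f : ℝ → ℂˣ → E} (hf : (fun t z => (f t z : V)) ∈ polyLoops S V) :
    f ∈ polyLoops S E := by
  obtain ⟨r, hr⟩ := LinearMap.exists_leftInverse_of_injective E.subtype (Submodule.ker_subtype E)
  convert polyLoops_map r hf using 1
  ext1 t; ext1 z
  exact (LinearMap.congr_fun hr (f t z)).symm

/-- A loop in a finite-dimensional space whose functionals are polynomials in `λ⁻¹` without constant
term is such a polynomial itself. -/
lemma mem_polyLoops_of_inverse {V : Type*} [AddCommGroup V] [Module ℂ V] [FiniteDimensional ℂ V]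
    {f : ℂˣ → V} (hf : ∀ l : Module.Dual ℂ V, ∃ p : Polynomial ℂ, p.coeff 0 = 0 ∧
      ∀ z : ℂˣ, l (f z) = p.eval ((z⁻¹ : ℂˣ) : ℂ)) :
    (fun _ z => f z) ∈ polyLoops (Set.Iio 0) V := by
  let b := Module.finBasis ℂ V
  choose p hp hp' using fun i => hf (b.coord i)
  have h1 : (fun (_ : ℝ) z => f z) = ∑ i, ∑ j ∈ Finset.range (p i).natDegree,
      monomialLoop 0 (-((j : ℤ) + 1)) ((p i).coeff (j + 1) • b i) := by
    ext1 t; ext1 z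
    simp only [Finset.sum_apply, monomialLoop, pow_zero, one_mul]
    conv_lhs => rw [← b.sum_repr (f z)]
    refine Finset.sum_congr rfl fun i _ => ?_
    have h2 := hp' i z
    rw [Module.Basis.coord_apply] at h2
    rw [h2, Polynomial.eval_eq_sum_range, Finset.sum_range_succ', hp, zero_mul, add_zero,
      Finset.sum_smul]
    refine Finset.sum_congr rfl fun j _ => ?_
    rw [smul_smul, mul_comm]
    congr 2
  rw [h1]
  refine Submodule.sum_mem _ fun i _ => Submodule.sum_mem _ fun j _ => monomialLoop_mem 0 ?_ _
  simp only [Set.mem_Iio]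
  omega

section Factorization

variable {H : Type*} [Ring H] [HopfAlgebra ℂ H] {𝒜 : ℕ → Submodule ℂ H} [GradedAlgebra 𝒜] {k : ℕ}
  [ConnectedGradedHopf 𝒜]

local notation "A" => TruncDual 𝒜 k

lemma polyLoops_mul {S S' S'' : Set ℤ} {R : Type*} [Ring R] [Algebra ℂ R]
    (h : ∀ m ∈ S, ∀ m' ∈ S', m + m' ∈ S'') {f g : ℝ → ℂˣ → R} (hf : f ∈ polyLoops S R)
    (hg : g ∈ polyLoops S' R) : (fun t z => f t z * g t z) ∈ polyLoops S'' R :=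
  polyLoops_bilin (LinearMap.mul ℂ R) h hf hg

lemma truncExp_sub_one_mem_polyLoops {S : Set ℤ} (hS : ∀ m ∈ S, ∀ m' ∈ S, m + m' ∈ S)
    {f : ℝ → ℂˣ → A} (hf : f ∈ polyLoops S A) :
    (fun t z => truncExp (f t z) - 1) ∈ polyLoops S A := by
  have hpow : ∀ i : ℕ, (fun t z => f t z ^ (i + 1)) ∈ polyLoops S A := by
    intro i
    induction i with
    | zero => simpa using hf
    | succ i ih =>
      simp only [pow_succ _ (i + 1)]
      exact polyLoops_mul hS ih hf
  have h1 : (fun t z => truncExp (f t z) - 1) =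
      ∑ i ∈ Finset.range k, (((i + 1).factorial : ℂ)⁻¹) • fun t z => f t z ^ (i + 1) := by
    ext1 t; ext1 z
    rw [truncExp_sub_one]
    simp [Finset.sum_apply]
  rw [h1]
  exact Submodule.sum_mem _ fun i _ => Submodule.smul_mem _ _ (hpow i)

variable (𝒜 k) in
/-- The component of degree `m` of a truncated functional. -/
def degreePart (m : ℕ) : A →ₗ[ℂ] A where
  toFun f := ⟨f.toFun ∘ₗ GradedAlgebra.proj 𝒜 m, fun n hn h hh => by
    rw [LinearMap.comp_apply, GradedAlgebra.proj_apply]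
    by_cases hnm : n = m
    · subst hnm
      rw [DirectSum.decompose_of_mem_same 𝒜 hh, f.vanish n hn h hh]
    · rw [DirectSum.decompose_of_mem_ne 𝒜 hh hnm, map_zero]⟩
  map_add' f g := rfl
  map_smul' c f := rfl

lemma degreePart_apply_same {m : ℕ} (f : A) {h : H} (hh : h ∈ 𝒜 m) :
    (degreePart 𝒜 k m f).toFun h = f.toFun h := by
  change f.toFun (GradedAlgebra.proj 𝒜 m h) = _
  rw [GradedAlgebra.proj_apply, DirectSum.decompose_of_mem_same 𝒜 hh]

lemma degreePart_apply_ne {m n : ℕ} (hmn : n ≠ m) (f : A) {h : H} (hh : h ∈ 𝒜 n) :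
    (degreePart 𝒜 k m f).toFun h = 0 := by
  change f.toFun (GradedAlgebra.proj 𝒜 m h) = _
  rw [GradedAlgebra.proj_apply, DirectSum.decompose_of_mem_ne 𝒜 hh hmn, map_zero]

lemma degreePart_mem (m : ℕ) (f : A) : degreePart 𝒜 k m f ∈ lowerVanish 𝒜 k m :=
  fun _ hn _ hh => degreePart_apply_ne hn.ne f hh

lemma sub_one_sub_degreePart_mem {m : ℕ} (hm : 1 ≤ m) {f : A} (hf : f - 1 ∈ lowerVanish 𝒜 k m) :
    f - 1 - degreePart 𝒜 k m f ∈ lowerVanish 𝒜 k (m + 1) := by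
  intro n hn h hh
  rcases Nat.lt_or_ge n m with h1 | h1
  · rw [TruncDual.sub_toFun, LinearMap.sub_apply, hf n h1 h hh,
      degreePart_apply_ne h1.ne f hh, sub_zero]
  · obtain rfl : n = m := by omega
    rw [TruncDual.sub_toFun, LinearMap.sub_apply, degreePart_apply_same f hh,
      TruncDual.sub_toFun, LinearMap.sub_apply]
    have : (1 : A).toFun h = 0 := by
      by_cases hk : n ≤ k
      · rw [TruncDual.one_def, trunc_apply_of_le _ hk hh]
        exact ConnectedGradedHopf.counit_eq_zero n (by omega) h hh
      · exact (1 : A).vanish n (by omega) h hh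
    rw [this]
    ring

/-- The leading component of an element of `G⁽ᵏ⁾` that agrees with the unit in degrees `< m` is an
infinitesimal character. -/
lemma degreePart_mem_truncLie {m : ℕ} (hm : 1 ≤ m) (g : truncGroup 𝒜 k)
    (hg : groupVal 𝒜 k g - 1 ∈ lowerVanish 𝒜 k m) :
    degreePart 𝒜 k m (groupVal 𝒜 k g) ∈ truncLie 𝒜 k := by
  obtain ⟨u, φ, hφ⟩ := g
  set f : A := groupVal 𝒜 k ⟨u, φ, hφ⟩ with hfdef
  have hf : f = trunc 𝒜 k φ.toLinearMap := hφ
  have hf0 : ∀ n, 1 ≤ n → n < m → ∀ h ∈ 𝒜 n, n ≤ k → φ h = 0 := by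
    intro n hn hnm h hh hk
    have h1 := hg n hnm h hh
    rw [TruncDual.sub_toFun, LinearMap.sub_apply, TruncDual.one_def, trunc_apply_of_le _ hk hh,
      ConnectedGradedHopf.counit_eq_zero n (by omega) h hh, sub_zero, hf,
      trunc_apply_of_le _ hk hh] at h1
    exact h1
  have h1 : (degreePart 𝒜 k m f).toFun 1 = 0 :=
    degreePart_apply_ne (by omega) f (SetLike.one_mem_graded 𝒜)
  suffices hom : ∀ p, ∀ a ∈ 𝒜 p, ∀ q, ∀ b ∈ 𝒜 q, (degreePart 𝒜 k m f).toFun (a * b) =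
      (degreePart 𝒜 k m f).toFun a * Coalgebra.counit (R := ℂ) b +
        Coalgebra.counit (R := ℂ) a * (degreePart 𝒜 k m f).toFun b by
    intro a b
    induction a using DirectSum.Decomposition.inductionOn 𝒜 with
    | zero => simp
    | add x y hx hy => simp only [add_mul, map_add, hx, hy]; ring
    | homogeneous x =>
      induction b using DirectSum.Decomposition.inductionOn 𝒜 with
      | zero => simp
      | add x y hx hy => simp only [mul_add, map_add, hx, hy]; ring
      | homogeneous y => exact hom _ _ x.2 _ _ y.2
  intro p a ha q b hb
  rcases Nat.eq_zero_or_pos p with rfl | hp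
  · obtain ⟨c, rfl⟩ := mem_degree_zero ha
    simp [h1]
  rcases Nat.eq_zero_or_pos q with rfl | hq
  · obtain ⟨c, rfl⟩ := mem_degree_zero hb
    simp [h1, mul_comm]
  rw [ConnectedGradedHopf.counit_eq_zero p (by omega) a ha,
    ConnectedGradedHopf.counit_eq_zero q (by omega) b hb, mul_zero, zero_mul, add_zero]
  have hab : a * b ∈ 𝒜 (p + q) := SetLike.mul_mem_graded ha hb
  by_cases hpq : p + q = m
  · subst hpq
    rw [degreePart_apply_same f hab]
    by_cases hk : p + q ≤ k
    · rw [hf, trunc_apply_of_le _ hk hab, AlgHom.toLinearMap_apply, map_mul,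
        hf0 p hp (by omega) a ha (by omega), zero_mul]
    · exact f.vanish _ (by omega) _ hab
  · exact degreePart_apply_ne hpq f hab

lemma mul_mul_sub_one_mem {m : ℕ} (hm : 1 ≤ m) {a r b x w y : A} (hx : x ∈ lowerVanish 𝒜 k m)
    (hw : w ∈ lowerVanish 𝒜 k m) (hy : y ∈ lowerVanish 𝒜 k m)
    (ha : a - 1 - x ∈ lowerVanish 𝒜 k (m + 1)) (hr : r - 1 - w ∈ lowerVanish 𝒜 k (m + 1))
    (hb : b - 1 - y ∈ lowerVanish 𝒜 k (m + 1)) (h : x + w + y = 0) :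
    a * r * b - 1 ∈ lowerVanish 𝒜 k (m + 1) := by
  have hle : lowerVanish 𝒜 k (m + 1) ≤ lowerVanish 𝒜 k m := lowerVanish_antitone (Nat.le_succ m)
  have key : ∀ {a : A} {x : A}, x ∈ lowerVanish 𝒜 k m → a - 1 - x ∈ lowerVanish 𝒜 k (m + 1) →
      a - 1 ∈ lowerVanish 𝒜 k m := by
    intro a x hx ha
    have := Submodule.add_mem _ (hle ha) hx
    rwa [sub_add_cancel] at this
  have hmul : ∀ {f g : A}, f ∈ lowerVanish 𝒜 k m → g ∈ lowerVanish 𝒜 k m →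
      f * g ∈ lowerVanish 𝒜 k (m + 1) := fun hf hg =>
    lowerVanish_antitone (by omega) (mul_mem_lowerVanish hf hg)
  have ha' := key hx ha
  have hr' := key hw hr
  have hb' := key hy hb
  have e : a * r * b - 1 = ((a - 1 - x) + (r - 1 - w) + (b - 1 - y)) + ((a - 1) * (r - 1)
      + (a - 1) * (b - 1) + (r - 1) * (b - 1) + (a - 1) * (r - 1) * (b - 1)) := by
    have : (a - 1 - x) + (r - 1 - w) + (b - 1 - y) = (a - 1) + (r - 1) + (b - 1) := by
      rw [← sub_eq_zero]
      have h2 : (a - 1 - x) + (r - 1 - w) + (b - 1 - y) - ((a - 1) + (r - 1) + (b - 1)) =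
        -(x + w + y) := by abel
      rw [h2, h, neg_zero]
    rw [this]
    noncomm_ring
  rw [e]
  refine Submodule.add_mem _ (Submodule.add_mem _ (Submodule.add_mem _ ha hr) hb)
    (Submodule.add_mem _ (Submodule.add_mem _ (Submodule.add_mem _ (hmul ha' hr') (hmul ha' hb'))
      (hmul hr' hb')) (hmul (hle (hmul ha' hr')) hb'))

/-- The two loops are polynomial in `t`, and in `λ` they have the exponents of the factors of a
Birkhoff factorization, with `g₋(∞) = e`. -/
structure IsFactorPair (gm gp : ℝ → ℂˣ → truncGroup 𝒜 k) : Prop where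
  gm_sub_one : (fun t z => groupVal 𝒜 k (gm t z) - 1) ∈ polyLoops (Set.Iio 0) A
  gm_inv_sub_one : (fun t z => groupVal 𝒜 k (gm t z)⁻¹ - 1) ∈ polyLoops (Set.Iio 0) A
  gp_mem : (fun t z => groupVal 𝒜 k (gp t z)) ∈ polyLoops (Set.Ici 0) A
  gp_inv_mem : (fun t z => groupVal 𝒜 k (gp t z)⁻¹) ∈ polyLoops (Set.Ici 0) A

lemma isFactorPair_one : IsFactorPair (𝒜 := 𝒜) (k := k) (fun _ _ => 1) (fun _ _ => 1) where
  gm_sub_one := by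
    simp only [map_one, sub_self]
    exact Submodule.zero_mem _
  gm_inv_sub_one := by
    simp only [inv_one, map_one, sub_self]
    exact Submodule.zero_mem _
  gp_mem := by
    simp only [map_one]
    exact const_mem_polyLoops Set.self_mem_Ici 1
  gp_inv_mem := by
    simp only [inv_one, map_one]
    exact const_mem_polyLoops Set.self_mem_Ici 1

lemma mem_polyLoops_of_sub_one {R : Type*} [Ring R] [Algebra ℂ R] {S : Set ℤ} (h0 : (0 : ℤ) ∈ S)
    {f : ℝ → ℂˣ → R} (hf : (fun t z => f t z - 1) ∈ polyLoops S R) : f ∈ polyLoops S R := by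
  have h1 := Submodule.add_mem _ hf (const_mem_polyLoops h0 (1 : R))
  convert h1 using 1
  ext1 t; ext1 z
  simp

lemma Iio_add_Iio : ∀ m ∈ Set.Iio (0 : ℤ), ∀ m' ∈ Set.Iio (0 : ℤ), m + m' ∈ Set.Iio (0 : ℤ) := by
  simp only [Set.mem_Iio]
  omega

lemma add_mem_univ (S S' : Set ℤ) : ∀ m ∈ S, ∀ m' ∈ S', m + m' ∈ (Set.univ : Set ℤ) :=
  fun _ _ _ _ => Set.mem_univ _

lemma polyLoops_mul_sub_one {R : Type*} [Ring R] [Algebra ℂ R] {f g : ℝ → ℂˣ → R}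
    (hf : (fun t z => f t z - 1) ∈ polyLoops (Set.Iio 0) R)
    (hg : (fun t z => g t z - 1) ∈ polyLoops (Set.Iio 0) R) :
    (fun t z => f t z * g t z - 1) ∈ polyLoops (Set.Iio 0) R := by
  have h := Submodule.add_mem _ (Submodule.add_mem _ (polyLoops_mul Iio_add_Iio hf hg) hf) hg
  convert h using 1
  ext1 t; ext1 z
  simp only [Pi.add_apply]
  noncomm_ring

lemma IsFactorPair.mul_mul_inv_mem {E gm gp : ℝ → ℂˣ → truncGroup 𝒜 k} (hg : IsFactorPair gm gp)
    (hE : (fun t z => groupVal 𝒜 k (E t z)) ∈ polyLoops Set.univ A) :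
    (fun t z => groupVal 𝒜 k (gm t z * E t z * (gp t z)⁻¹)) ∈ polyLoops Set.univ A := by
  have h1 : (fun t z => groupVal 𝒜 k (gm t z)) ∈ polyLoops Set.univ A :=
    mem_polyLoops_of_sub_one (Set.mem_univ 0) (polyLoops_mono (Set.subset_univ _) hg.gm_sub_one)
  have h2 := polyLoops_mul (add_mem_univ _ _) (polyLoops_mul (add_mem_univ _ _) h1 hE)
    hg.gp_inv_mem
  simpa only [map_mul] using h2

lemma groupVal_sub_one_mem (g : truncGroup 𝒜 k) : groupVal 𝒜 k g - 1 ∈ lowerVanish 𝒜 k 1 :=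
  truncGroup_sub_one_mem g

/-- Existence of the Birkhoff factorization. If `g₋ E g₊⁻¹` agrees with the unit in degrees `< m`,
its component of degree `m` is a loop in the Lie algebra, whose negative and nonnegative parts are
absorbed into `g₋` and `g₊`. -/
lemma exists_factorPair {E : ℝ → ℂˣ → truncGroup 𝒜 k}
    (hE : (fun t z => groupVal 𝒜 k (E t z)) ∈ polyLoops Set.univ A) (n : ℕ) :
    ∃ gm gp : ℝ → ℂˣ → truncGroup 𝒜 k, IsFactorPair gm gp ∧
      ∀ t z, groupVal 𝒜 k (gm t z * E t z * (gp t z)⁻¹) - 1 ∈ lowerVanish 𝒜 k (n + 1) := by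
  induction n with
  | zero =>
    exact ⟨fun _ _ => 1, fun _ _ => 1, isFactorPair_one, fun t z => by
      rw [zero_add]
      exact groupVal_sub_one_mem _⟩
  | succ n ih =>
    obtain ⟨gm, gp, hg, hr⟩ := ih
    set m := n + 1 with hm
    have hm1 : 1 ≤ m := by omega
    let W : Submodule ℂ A := (truncLie 𝒜 k).toSubmodule ⊓ lowerVanish 𝒜 k m
    let w : ℝ → ℂˣ → W := fun t z =>
      ⟨degreePart 𝒜 k m (groupVal 𝒜 k (gm t z * E t z * (gp t z)⁻¹)),
        degreePart_mem_truncLie hm1 _ (hr t z), degreePart_mem m _⟩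
    have hw : w ∈ polyLoops Set.univ W :=
      mem_polyLoops_of_subtype (polyLoops_map (degreePart 𝒜 k m) (hg.mul_mul_inv_mem hE))
    obtain ⟨wm, hwm, wp, hwp, hsum⟩ := polyLoops_split hw
    let em : ℝ → ℂˣ → truncLie 𝒜 k := fun t z => ⟨wm t z, (wm t z).2.1⟩
    let ep : ℝ → ℂˣ → truncLie 𝒜 k := fun t z => ⟨wp t z, (wp t z).2.1⟩
    have hem : (fun t z => (em t z : A)) ∈ polyLoops (Set.Iio 0) A := polyLoops_map W.subtype hwm
    have hep : (fun t z => (ep t z : A)) ∈ polyLoops (Set.Ici 0) A := polyLoops_map W.subtype hwp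
    have hem' : (fun t z => ((-em t z : truncLie 𝒜 k) : A)) ∈ polyLoops (Set.Iio 0) A :=
      Submodule.neg_mem _ hem
    have hep' : (fun t z => ((-ep t z : truncLie 𝒜 k) : A)) ∈ polyLoops (Set.Ici 0) A :=
      Submodule.neg_mem _ hep
    have hexp : ∀ {f : ℝ → ℂˣ → truncLie 𝒜 k},
        (fun t z => (f t z : A)) ∈ polyLoops (Set.Ici 0) A →
        (fun t z => truncExp (f t z : A)) ∈ polyLoops (Set.Ici 0) A := fun hf =>
      mem_polyLoops_of_sub_one Set.self_mem_Ici (truncExp_sub_one_mem_polyLoops Ici_add_Ici hf)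
    refine ⟨fun t z => groupExp (-em t z) * gm t z, fun t z => groupExp (ep t z) * gp t z,
      ⟨?_, ?_, ?_, ?_⟩, fun t z => ?_⟩
    · simp only [map_mul, groupVal_groupExp]
      exact polyLoops_mul_sub_one (truncExp_sub_one_mem_polyLoops Iio_add_Iio hem') hg.gm_sub_one
    · simp only [mul_inv_rev, map_mul, groupExp_neg, inv_inv, groupVal_groupExp]
      exact polyLoops_mul_sub_one hg.gm_inv_sub_one (truncExp_sub_one_mem_polyLoops Iio_add_Iio hem)
    · simp only [map_mul, groupVal_groupExp]
      exact polyLoops_mul Ici_add_Ici (hexp hep) hg.gp_mem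
    · simp only [mul_inv_rev, map_mul, ← groupExp_neg, groupVal_groupExp]
      exact polyLoops_mul Ici_add_Ici hg.gp_inv_mem (hexp hep')
    · have e : groupExp (-em t z) * gm t z * E t z * (groupExp (ep t z) * gp t z)⁻¹ =
          groupExp (-em t z) * (gm t z * E t z * (gp t z)⁻¹) * groupExp (-ep t z) := by
        rw [mul_inv_rev, groupExp_neg (ep t z)]
        group
      rw [e, map_mul, map_mul, groupVal_groupExp, groupVal_groupExp]
      have h1 : (-(em t z : truncLie 𝒜 k) : A) ∈ lowerVanish 𝒜 k m :=
        Submodule.neg_mem _ (wm t z).2.2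
      have h2 : (-(ep t z : truncLie 𝒜 k) : A) ∈ lowerVanish 𝒜 k m :=
        Submodule.neg_mem _ (wp t z).2.2
      refine mul_mul_sub_one_mem hm1 h1 (degreePart_mem m _) h2
        (truncExp_sub_one_sub_mem hm1 h1) (sub_one_sub_degreePart_mem hm1 (hr t z))
        (truncExp_sub_one_sub_mem hm1 h2) ?_
      have h3 : degreePart 𝒜 k m (groupVal 𝒜 k (gm t z * E t z * (gp t z)⁻¹)) =
          (em t z : A) + (ep t z : A) :=
        congrArg (fun f : ℝ → ℂˣ → W => (f t z : A)) hsum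
      rw [h3]
      abel

/-- In degrees `≤ k` there is nothing left to correct after `k` steps of `exists_factorPair`. -/
lemma exists_birkhoff {E : ℝ → ℂˣ → truncGroup 𝒜 k}
    (hE : (fun t z => groupVal 𝒜 k (E t z)) ∈ polyLoops Set.univ A) :
    ∃ gm gp : ℝ → ℂˣ → truncGroup 𝒜 k, IsFactorPair gm gp ∧
      ∀ t z, (gm t z)⁻¹ * gp t z = E t z := by
  obtain ⟨gm, gp, hg, hr⟩ := exists_factorPair hE k
  refine ⟨gm, gp, hg, fun t z => ?_⟩
  have h1 : gm t z * E t z * (gp t z)⁻¹ = 1 :=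
    groupVal_injective (by
      rw [map_one]
      exact sub_eq_zero.1 (eq_zero_of_mem_lowerVanish (hr t z)))
  rw [inv_mul_eq_iff_eq_mul]
  exact (mul_inv_eq_one.1 h1).symm

end Factorization

/-! ### One-parameter subgroups -/

section OneParameter

variable {V R : Type*} [AddCommGroup V] [Module ℂ V] [Ring R] [Algebra ℂ R]

lemma HasVelocity.of_shift {c : ℝ → V} {v : V} {s t : ℝ}
    (h : HasVelocity (fun r => c (s + r)) v t) : HasVelocity c v (s + t) := by
  have h1 := HasVelocity.shift (c := fun r => c (s + r)) (s := -s) (t := s + t) (v := v)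
    (by rwa [neg_add_cancel_left])
  simpa only [add_neg_cancel_left] using h1

lemma HasVelocity.comp_neg {c : ℝ → V} {v : V} {t : ℝ} (h : HasVelocity c v (-t)) :
    HasVelocity (fun s => c (-s)) (-v) t := by
  intro l
  exact (HasDerivAt.scomp t (h l) (hasDerivAt_neg t)).congr_deriv (by simp)

lemma HasVelocity.mul {c d : ℝ → R} {v w : R} {t : ℝ} (hc : HasVelocity c v t)
    (hd : HasVelocity d w t) : HasVelocity (fun s => c s * d s) (v * d t + c t * w) t :=
  hc.bilin hd (LinearMap.mul ℂ R)

variable {γ γ' : ℝ → R} {X : R} (hγ : ∀ s t, γ (s + t) = γ s * γ t) (h0 : HasVelocity γ X 0)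
  (hγ' : ∀ s t, γ' (s + t) = γ' s * γ' t) (h0' : HasVelocity γ' X 0)
include hγ h0

lemma hasVelocity_oneParameter_left (t : ℝ) : HasVelocity γ (γ t * X) t := by
  have h1 : HasVelocity (fun r => γ (t + r)) (γ t * X) 0 := by
    simp only [hγ]
    exact h0.map (LinearMap.mulLeft ℂ (γ t))
  simpa using h1.of_shift

lemma hasVelocity_oneParameter_right (t : ℝ) : HasVelocity γ (X * γ t) t := by
  have h1 : HasVelocity (fun r => γ (t + r)) (X * γ t) 0 := by
    have h2 : ∀ r, γ (t + r) = γ r * γ t := fun r => by rw [add_comm, hγ]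
    simp only [h2]
    exact h0.map (LinearMap.mulRight ℂ (γ t))
  simpa using h1.of_shift

include hγ' h0' in
/-- A one-parameter subgroup is determined by its velocity at `0`. -/
lemma oneParameter_unique (h1 : γ 0 = 1) (h1' : γ' 0 = 1) (t : ℝ) : γ t = γ' t := by
  have key : ∀ s, HasVelocity (fun s => γ s * γ' (-s)) 0 s := by
    intro s
    have h2 := (hasVelocity_oneParameter_left hγ h0 s).mul
      (hasVelocity_oneParameter_right hγ' h0' (-s)).comp_neg
    convert h2 using 1
    noncomm_ring
  have h3 : γ t * γ' (-t) = 1 := by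
    have := eq_of_velocity_eq_zero key t 0
    simpa [h1, h1'] using this
  have h4 : γ' (-t) * γ' t = 1 := by rw [← hγ', neg_add_cancel, h1']
  calc γ t = γ t * (γ' (-t) * γ' t) := by rw [h4, mul_one]
    _ = γ' t := by rw [← mul_assoc, h3, one_mul]

end OneParameter

/-! ### Exponentials in the truncated group -/

section Exponential

variable {H : Type*} [Ring H] [HopfAlgebra ℂ H] {𝒜 : ℕ → Submodule ℂ H} [GradedAlgebra 𝒜] {k : ℕ}

variable (𝒜 k) in
/-- Evaluation of truncated functionals at an element of `H`. -/
def evalAt : H →ₗ[ℂ] Module.Dual ℂ (TruncDual 𝒜 k) where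
  toFun h :=
    { toFun := fun f => f.toFun h
      map_add' := fun _ _ => rfl
      map_smul' := fun _ _ => rfl }
  map_add' a b := by ext f; exact map_add f.toFun a b
  map_smul' c a := by ext f; exact map_smul f.toFun c a

variable [ConnectedGradedHopf 𝒜]

/-- By finite-dimensionality every functional on the truncated dual is an evaluation. -/
lemma evalAt_surjective [∀ n, FiniteDimensional ℂ (𝒜 n)] : Function.Surjective (evalAt 𝒜 k) := by
  rw [← LinearMap.flip_injective_iff₂]
  intro f g hfg
  exact TruncDual.ext (LinearMap.ext fun h => LinearMap.congr_fun hfg h)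

lemma hasVelocity_of_evalAt [∀ n, FiniteDimensional ℂ (𝒜 n)] {c : ℝ → TruncDual 𝒜 k}
    {v : TruncDual 𝒜 k} {t : ℝ} (h : ∀ x, HasDerivAt (fun s => (c s).toFun x) (v.toFun x) t) :
    HasVelocity c v t := by
  intro l
  obtain ⟨x, rfl⟩ := evalAt_surjective l
  exact h x

lemma hasVelocity_truncExp_zero (Z : truncLie 𝒜 k) :
    HasVelocity (fun s : ℝ => truncExp ((s : ℂ) • (Z : TruncDual 𝒜 k))) Z 0 := by
  have hZ := truncLie_le_lowerVanish Z.2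
  have h1 : ∀ s : ℝ, truncExp ((s : ℂ) • (Z : TruncDual 𝒜 k)) =
      ∑ i ∈ Finset.range (k + 2),
        ((s : ℂ) ^ i * (i.factorial : ℂ)⁻¹) • (Z : TruncDual 𝒜 k) ^ i := by
    intro s
    rw [Finset.sum_range_succ, pow_eq_zero_of_lt hZ (Nat.lt_succ_self k), smul_zero, add_zero,
      truncExp]
    refine Finset.sum_congr rfl fun i _ => ?_
    rw [smul_pow, smul_smul, mul_comm]
  simp only [h1]
  intro l
  simp only [map_sum]
  have h2 := HasDerivAt.fun_sum (u := Finset.range (k + 2)) fun i _ =>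
    hasVelocity_monomial i (i.factorial : ℂ)⁻¹ ((Z : TruncDual 𝒜 k) ^ i) 0 l
  refine h2.congr_deriv ?_
  rw [Finset.sum_eq_single 1]
  · simp
  · intro i _ hi
    rcases Nat.eq_zero_or_pos i with rfl | h0
    · simp
    · have : i - 1 ≠ 0 := by omega
      simp [this]
  · intro h; exact absurd (Finset.mem_range.2 (by omega)) h

lemma groupVal_groupExp_add (Z : truncLie 𝒜 k) (s t : ℝ) :
    groupVal 𝒜 k (groupExp (((s + t : ℝ) : ℂ) • Z)) =
      groupVal 𝒜 k (groupExp ((s : ℂ) • Z)) * groupVal 𝒜 k (groupExp ((t : ℂ) • Z)) := by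
  rw [Complex.ofReal_add, groupExp_smul_add, map_mul]

lemma hasVelocity_groupExp (Z : truncLie 𝒜 k) (t : ℝ) :
    HasVelocity (fun s : ℝ => groupVal 𝒜 k (groupExp ((s : ℂ) • Z)))
      (groupVal 𝒜 k (groupExp ((t : ℂ) • Z)) * (Z : TruncDual 𝒜 k)) t :=
  hasVelocity_oneParameter_left (γ := fun s : ℝ => groupVal 𝒜 k (groupExp ((s : ℂ) • Z)))
    (groupVal_groupExp_add Z) (hasVelocity_truncExp_zero Z) t

lemma hasVelocity_groupExp_right (Z : truncLie 𝒜 k) (t : ℝ) :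
    HasVelocity (fun s : ℝ => groupVal 𝒜 k (groupExp ((s : ℂ) • Z)))
      ((Z : TruncDual 𝒜 k) * groupVal 𝒜 k (groupExp ((t : ℂ) • Z))) t :=
  hasVelocity_oneParameter_right (γ := fun s : ℝ => groupVal 𝒜 k (groupExp ((s : ℂ) • Z)))
    (groupVal_groupExp_add Z) (hasVelocity_truncExp_zero Z) t

/-- The one-parameter subgroups of `G⁽ᵏ⁾` are the curves `s ↦ exp(sZ)`. -/
lemma eq_groupExp_of_oneParameter [∀ n, FiniteDimensional ℂ (𝒜 n)] {γ : ℝ → truncGroup 𝒜 k}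
    {Z : truncLie 𝒜 k} (hγ : ∀ s t, γ (s + t) = γ s * γ t)
    (h0 : ∀ x, HasDerivAt (fun t => (groupCoords 𝒜 k).coord x (γ t))
      ((groupCoords 𝒜 k).tangent x Z) 0) (s : ℝ) : γ s = groupExp ((s : ℂ) • Z) := by
  have h1 : γ 0 = 1 := by
    have h2 := hγ 0 0
    rwa [add_zero, left_eq_mul] at h2
  refine groupVal_injective (oneParameter_unique (γ := fun s => groupVal 𝒜 k (γ s))
    (γ' := fun s : ℝ => groupVal 𝒜 k (groupExp ((s : ℂ) • Z))) (X := (Z : TruncDual 𝒜 k))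
    (fun s t => by simp only [hγ, map_mul]) (hasVelocity_of_evalAt h0) (groupVal_groupExp_add Z)
    (hasVelocity_truncExp_zero Z) ?_ ?_ s)
  · simp only [h1, map_one]
  · simp only [Complex.ofReal_zero, zero_smul, groupExp_zero, map_one]

lemma isExp_groupExp (Z : truncLie 𝒜 k) : IsExp (groupCoords 𝒜 k) Z (groupExp Z) := by
  refine ⟨fun s => groupExp ((s : ℂ) • Z), fun s t => ?_, fun x => ?_, ?_⟩
  · simp only [Complex.ofReal_add, groupExp_smul_add]
  · exact hasVelocity_truncExp_zero Z (evalAt 𝒜 k x)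
  · simp only [Complex.ofReal_one, one_smul]

lemma isExp_iff [∀ n, FiniteDimensional ℂ (𝒜 n)] {Z : truncLie 𝒜 k} {g : truncGroup 𝒜 k} :
    IsExp (groupCoords 𝒜 k) Z g ↔ g = groupExp Z := by
  refine ⟨?_, fun h => h ▸ isExp_groupExp Z⟩
  rintro ⟨γ, hγ, h0, rfl⟩
  rw [eq_groupExp_of_oneParameter hγ h0, Complex.ofReal_one, one_smul]

lemma truncExp_mem_polyLoops {f : ℝ → ℂˣ → TruncDual 𝒜 k}
    (hf : f ∈ polyLoops Set.univ (TruncDual 𝒜 k)) :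
    (fun t z => truncExp (f t z)) ∈ polyLoops Set.univ (TruncDual 𝒜 k) :=
  mem_polyLoops_of_sub_one (Set.mem_univ 0)
    (truncExp_sub_one_mem_polyLoops (add_mem_univ Set.univ Set.univ) hf)

lemma groupExp_loop_mem (X : Loop (truncLie 𝒜 k)) :
    (fun (t : ℝ) z => groupVal 𝒜 k (groupExp (-(t : ℂ) • evalLoop z X))) ∈
      polyLoops Set.univ (TruncDual 𝒜 k) := by
  have h1 : (fun (t : ℝ) z => -((t : ℂ) • evalLoop z X)) ∈ polyLoops Set.univ (truncLie 𝒜 k) :=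
    Submodule.neg_mem _ (time_smul_mem_polyLoops
      (evalLoop_mem_polyLoops X (S := Set.univ) fun m _ => Set.mem_univ m))
  have h2 : (fun (t : ℝ) z => ((-((t : ℂ) • evalLoop z X) : truncLie 𝒜 k) : TruncDual 𝒜 k)) ∈
      polyLoops Set.univ (TruncDual 𝒜 k) := polyLoops_map (truncLie 𝒜 k).toSubmodule.subtype h1
  simp only [neg_smul, groupVal_groupExp]
  exact truncExp_mem_polyLoops h2

end Exponential

/-! ### Uniqueness of Birkhoff factorizations -/

section Uniqueness

/-- The function on `ℂˣ` extends to an entire function. -/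
def IsEntire (f : ℂˣ → ℂ) : Prop := ∃ F : ℂ → ℂ, Differentiable ℂ F ∧ ∀ z : ℂˣ, f z = F z

lemma isEntire_bilin {V W U : Type*} [AddCommGroup V] [Module ℂ V] [AddCommGroup W] [Module ℂ W]
    [AddCommGroup U] [Module ℂ U] (B : V →ₗ[ℂ] W →ₗ[ℂ] U) {f : ℂˣ → V} {g : ℝ → ℂˣ → W}
    (hf : ∀ l : Module.Dual ℂ V, IsEntire fun z => l (f z)) (hg : g ∈ polyLoops (Set.Ici 0) W)
    (t : ℝ) (l : Module.Dual ℂ U) : IsEntire fun z => l (B (f z) (g t z)) := by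
  induction hg using polyLoops_induction with
  | hmono n m hm v =>
    obtain ⟨F, hF, hF'⟩ := hf (l ∘ₗ B.flip v)
    lift m to ℕ using hm
    refine ⟨fun z => ((t : ℂ) ^ n * z ^ m) * F z, by fun_prop, fun z => ?_⟩
    have h1 := hF' z
    simp only [LinearMap.comp_apply, LinearMap.flip_apply] at h1
    simp [monomialLoop, h1]
  | hzero => exact ⟨0, differentiable_const 0, fun z => by simp⟩
  | hadd f' g' _ _ hf' hg' =>
    obtain ⟨F, hF, hF'⟩ := hf'
    obtain ⟨G, hG, hG'⟩ := hg'
    refine ⟨F + G, hF.add hG, fun z => ?_⟩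
    simp only [Pi.add_apply, map_add, hF', hG']

/-- Liouville's theorem for vector-valued loops. -/
lemma eq_zero_of_isEntire {V : Type*} [AddCommGroup V] [Module ℂ V] {f : ℂˣ → V}
    (hf : (fun _ z => f z) ∈ polyLoops (Set.Iio 0) V)
    (hf' : ∀ l : Module.Dual ℂ V, IsEntire fun z => l (f z)) (z : ℂˣ) : f z = 0 := by
  refine eq_of_forall_dual fun l => ?_
  obtain ⟨F, hF, hF'⟩ := hf' l
  obtain ⟨p, hp, hp'⟩ := polyLoops_inverse (polyLoops_map l hf) 0
  rw [map_zero]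
  exact (hF' z).trans (eq_zero_of_entire_of_inverse hF hp (fun z => (hF' z).symm.trans (hp' z)) z)

variable {H : Type*} [Ring H] [HopfAlgebra ℂ H] {𝒜 : ℕ → Submodule ℂ H} [GradedAlgebra 𝒜] {k : ℕ}
  [ConnectedGradedHopf 𝒜] [∀ n, FiniteDimensional ℂ (𝒜 n)]

lemma IsMinusLoop.sub_one_mem {g : ℂˣ → truncGroup 𝒜 k} (hg : IsMinusLoop (groupCoords 𝒜 k) g) :
    (fun _ z => groupVal 𝒜 k (g z) - 1) ∈ polyLoops (Set.Iio 0) (TruncDual 𝒜 k) := by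
  refine mem_polyLoops_of_inverse fun l => ?_
  obtain ⟨x, rfl⟩ := evalAt_surjective l
  obtain ⟨p, hp, hp'⟩ := hg x
  refine ⟨p, hp, fun z => ?_⟩
  rw [map_sub, sub_eq_iff_eq_add']
  exact hp' z

/-- Two factorizations of the same loop agree: by Liouville's theorem the quotient of the two minus
factors, which equals the quotient of the two plus factors, is constant. -/
lemma eq_of_factorization {hm hp gm gp : ℂˣ → truncGroup 𝒜 k}
    (hhm : IsMinusLoop (groupCoords 𝒜 k) hm) (hhp : IsPlusLoop (groupCoords 𝒜 k) hp)
    (hgm : (fun _ z => groupVal 𝒜 k (gm z)⁻¹ - 1) ∈ polyLoops (Set.Iio 0) (TruncDual 𝒜 k))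
    (hgp : (fun _ z => groupVal 𝒜 k (gp z)⁻¹) ∈ polyLoops (Set.Ici 0) (TruncDual 𝒜 k))
    (h : ∀ z, (hm z)⁻¹ * hp z = (gm z)⁻¹ * gp z) : hm = gm ∧ hp = gp := by
  have h1 : ∀ z, hm z * (gm z)⁻¹ = hp z * (gp z)⁻¹ := by
    intro z
    have h2 : hp z = hm z * ((gm z)⁻¹ * gp z) := by rw [← h z, mul_inv_cancel_left]
    rw [h2]
    group
  have h2 := polyLoops_mul_sub_one hhm.sub_one_mem hgm
  have h3 : ∀ l : Module.Dual ℂ (TruncDual 𝒜 k),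
      IsEntire fun z => l (groupVal 𝒜 k (hm z) * groupVal 𝒜 k (gm z)⁻¹ - 1) := by
    intro l
    have h4 : ∀ l : Module.Dual ℂ (TruncDual 𝒜 k), IsEntire fun z => l (groupVal 𝒜 k (hp z)) := by
      intro l
      obtain ⟨x, rfl⟩ := evalAt_surjective l
      exact hhp x
    obtain ⟨F, hF, hF'⟩ := isEntire_bilin (LinearMap.mul ℂ (TruncDual 𝒜 k)) h4 hgp 0 l
    refine ⟨fun z => F z - l 1, hF.sub_const _, fun z => ?_⟩
    have h6 := hF' z
    simp only [LinearMap.mul_apply'] at h6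
    change l _ = F z - l 1
    rw [map_sub, ← map_mul, h1, map_mul, h6]
  have h5 : ∀ z, hm z = gm z := by
    intro z
    have h6 := eq_zero_of_isEntire h2 h3 z
    rw [← map_mul, sub_eq_zero, ← map_one (groupVal 𝒜 k)] at h6
    exact mul_inv_eq_one.1 (groupVal_injective h6)
  refine ⟨funext h5, funext fun z => ?_⟩
  have h7 := h z
  rw [h5] at h7
  exact mul_left_cancel h7

end Uniqueness

/-! ### Birkhoff curves in the truncated group -/

section GroupCurve

variable {H : Type*} [Ring H] [HopfAlgebra ℂ H] {𝒜 : ℕ → Submodule ℂ H} [GradedAlgebra 𝒜] {k : ℕ}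
  [ConnectedGradedHopf 𝒜]

variable (𝒜 k) in
/-- A linear projection of the truncated convolution algebra onto the Lie algebra. -/
def lieRetraction : TruncDual 𝒜 k →ₗ[ℂ] truncLie 𝒜 k :=
  (LinearMap.exists_leftInverse_of_injective (truncLie 𝒜 k).toSubmodule.subtype
    (Submodule.ker_subtype _)).choose

lemma lieRetraction_coe (Z : truncLie 𝒜 k) : lieRetraction 𝒜 k (Z : TruncDual 𝒜 k) = Z :=
  LinearMap.congr_fun (LinearMap.exists_leftInverse_of_injective
    (truncLie 𝒜 k).toSubmodule.subtype (Submodule.ker_subtype _)).choose_spec Z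

variable (𝒜 k) in
/-- `Z ↦ a Z b`, projected to the Lie algebra. It is bilinear in `(a, b)` and equals `Ad g` for
`a = g`, `b = g⁻¹`. -/
def conjEnd : TruncDual 𝒜 k →ₗ[ℂ] TruncDual 𝒜 k →ₗ[ℂ] Module.End ℂ (truncLie 𝒜 k) :=
  LinearMap.mk₂ ℂ
    (fun a b => lieRetraction 𝒜 k ∘ₗ LinearMap.mulLeft ℂ a ∘ₗ LinearMap.mulRight ℂ b ∘ₗ
      (truncLie 𝒜 k).toSubmodule.subtype)
    (fun a a' b => by ext1 Z; simp [add_mul])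
    (fun c a b => by ext1 Z; simp)
    (fun a b b' => by ext1 Z; simp [mul_add])
    (fun c a b => by ext1 Z; simp)

lemma conjEnd_apply (a b : TruncDual 𝒜 k) (Z : truncLie 𝒜 k) :
    conjEnd 𝒜 k a b Z = lieRetraction 𝒜 k (a * ((Z : TruncDual 𝒜 k) * b)) := rfl

lemma groupAd_coe (g : truncGroup 𝒜 k) (Z : truncLie 𝒜 k) :
    ((groupAd 𝒜 k g Z : truncLie 𝒜 k) : TruncDual 𝒜 k) =
      groupVal 𝒜 k g * (Z : TruncDual 𝒜 k) * groupVal 𝒜 k g⁻¹ := rfl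

lemma conjEnd_group (g : truncGroup 𝒜 k) :
    conjEnd 𝒜 k (groupVal 𝒜 k g) (groupVal 𝒜 k g⁻¹) = groupAd 𝒜 k g := by
  ext1 Z
  rw [conjEnd_apply, ← mul_assoc, ← groupAd_coe, lieRetraction_coe]

lemma conjEnd_one : conjEnd 𝒜 k 1 1 = 1 := by
  rw [← map_one (groupAd 𝒜 k), ← conjEnd_group, inv_one, map_one (groupVal 𝒜 k)]

lemma groupAd_lie (g : truncGroup 𝒜 k) (Y Z : truncLie 𝒜 k) :
    groupAd 𝒜 k g ⁅Y, Z⁆ = ⁅groupAd 𝒜 k g Y, groupAd 𝒜 k g Z⁆ := by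
  apply Subtype.ext
  have h : groupVal 𝒜 k g⁻¹ * groupVal 𝒜 k g = 1 := by
    rw [← map_mul, inv_mul_cancel, map_one]
  have h2 : ∀ U W : TruncDual 𝒜 k, groupVal 𝒜 k g * U * groupVal 𝒜 k g⁻¹ *
      (groupVal 𝒜 k g * W * groupVal 𝒜 k g⁻¹) =
      groupVal 𝒜 k g * (U * W) * groupVal 𝒜 k g⁻¹ := by
    intro U W
    calc _ = groupVal 𝒜 k g * U * (groupVal 𝒜 k g⁻¹ * groupVal 𝒜 k g) * W * groupVal 𝒜 k g⁻¹ := by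
          noncomm_ring
      _ = _ := by rw [h]; noncomm_ring
  rw [groupAd_coe, LieSubalgebra.coe_bracket, LieSubalgebra.coe_bracket, groupAd_coe, groupAd_coe,
    LieRing.of_associative_ring_bracket, LieRing.of_associative_ring_bracket, h2, h2]
  noncomm_ring

lemma hasVelocity_groupAd_groupExp (Y : truncLie 𝒜 k) (t : ℝ) :
    HasVelocity (fun s : ℝ => groupAd 𝒜 k (groupExp ((s : ℂ) • Y)))
      (groupAd 𝒜 k (groupExp ((t : ℂ) • Y)) * adEnd _ Y) t := by
  have h1 := hasVelocity_groupExp Y t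
  have h2 : HasVelocity (fun s : ℝ => groupVal 𝒜 k (groupExp ((s : ℂ) • Y))⁻¹)
      (-((Y : TruncDual 𝒜 k) * groupVal 𝒜 k (groupExp ((t : ℂ) • Y))⁻¹)) t := by
    have h3 := (hasVelocity_groupExp_right Y (-t)).comp_neg
    simpa only [Complex.ofReal_neg, neg_smul, groupExp_neg] using h3
  have h4 := h1.bilin h2 (conjEnd 𝒜 k)
  simp only [conjEnd_group] at h4
  convert h4 using 1
  ext1 Z
  set a := groupVal 𝒜 k (groupExp ((t : ℂ) • Y))
  set b := groupVal 𝒜 k (groupExp ((t : ℂ) • Y))⁻¹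
  have h5 : conjEnd 𝒜 k a b (adEnd _ Y Z) = groupAd 𝒜 k (groupExp ((t : ℂ) • Y)) (adEnd _ Y Z) := by
    rw [← conjEnd_group]
  rw [Module.End.mul_apply, ← h5, LinearMap.add_apply, conjEnd_apply, conjEnd_apply, conjEnd_apply,
    ← map_add, adEnd_apply, LieSubalgebra.coe_bracket, LieRing.of_associative_ring_bracket]
  congr 1
  noncomm_ring

lemma isMinusLoop_one {ι Γ 𝔩 : Type*} [Group Γ] (K : Coords ι Γ 𝔩) : IsMinusLoop K 1 := fun i =>
  ⟨0, by simp, fun z => by simp⟩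

lemma isPlusLoop_one {ι Γ 𝔩 : Type*} [Group Γ] (K : Coords ι Γ 𝔩) : IsPlusLoop K 1 := fun i =>
  ⟨fun _ => K.coord i 1, differentiable_const _, fun _ => rfl⟩

namespace IsFactorPair

variable {gm gp : ℝ → ℂˣ → truncGroup 𝒜 k} (hg : IsFactorPair gm gp)
include hg

lemma gm_mem : (fun t z => groupVal 𝒜 k (gm t z)) ∈ polyLoops Set.univ (TruncDual 𝒜 k) :=
  mem_polyLoops_of_sub_one (Set.mem_univ 0) (polyLoops_mono (Set.subset_univ _) hg.gm_sub_one)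

lemma isMinusLoop (t : ℝ) : IsMinusLoop (groupCoords 𝒜 k) (gm t) := by
  intro x
  obtain ⟨p, hp, hp'⟩ := polyLoops_inverse (polyLoops_map (evalAt 𝒜 k x) hg.gm_sub_one) t
  refine ⟨p, hp, fun z => ?_⟩
  rw [← hp', map_sub]
  exact (add_sub_cancel _ _).symm

lemma isPlusLoop (t : ℝ) : IsPlusLoop (groupCoords 𝒜 k) (gp t) := fun x =>
  polyLoops_entire (polyLoops_map (evalAt 𝒜 k x) hg.gp_mem) t

lemma isLaurentLoop (t : ℝ) :
    IsLaurentLoop (groupCoords 𝒜 k) (gm t) ∧ IsLaurentLoop (groupCoords 𝒜 k) (gp t) :=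
  ⟨fun x => polyLoops_laurent (polyLoops_map (evalAt 𝒜 k x) hg.gm_mem) t,
    fun x => polyLoops_laurent (polyLoops_map (evalAt 𝒜 k x) hg.gp_mem) t⟩

lemma contDiff (z : ℂˣ) (x : H) :
    ContDiff ℝ (⊤ : ℕ∞) (fun t => (groupCoords 𝒜 k).coord x (gm t z)) ∧
      ContDiff ℝ (⊤ : ℕ∞) (fun t => (groupCoords 𝒜 k).coord x (gp t z)) :=
  ⟨polyLoops_contDiff (polyLoops_map (evalAt 𝒜 k x) hg.gm_mem) z,
    polyLoops_contDiff (polyLoops_map (evalAt 𝒜 k x) hg.gp_mem) z⟩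

lemma ad_gm : (fun t z => groupAd 𝒜 k (gm t z) - 1) ∈
    polyLoops (Set.Iio 0) (Module.End ℂ (truncLie 𝒜 k)) := by
  have h1 := polyLoops_bilin (conjEnd 𝒜 k) Iio_add_Iio hg.gm_sub_one hg.gm_inv_sub_one
  have h2 := polyLoops_map (conjEnd 𝒜 k 1) hg.gm_inv_sub_one
  have h3 := polyLoops_map ((conjEnd 𝒜 k).flip 1) hg.gm_sub_one
  convert Submodule.add_mem _ (Submodule.add_mem _ h1 h2) h3 using 1
  ext1 t; ext1 z
  simp only [Pi.add_apply, map_sub, LinearMap.sub_apply, LinearMap.flip_apply, conjEnd_group,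
    conjEnd_one]
  abel

lemma ad_gm_inv_sub_one : (fun t z => groupAd 𝒜 k (gm t z)⁻¹ - 1) ∈
    polyLoops (Set.Iio 0) (Module.End ℂ (truncLie 𝒜 k)) := by
  have h1 := polyLoops_bilin (conjEnd 𝒜 k) Iio_add_Iio hg.gm_inv_sub_one hg.gm_sub_one
  have h2 := polyLoops_map (conjEnd 𝒜 k 1) hg.gm_sub_one
  have h3 := polyLoops_map ((conjEnd 𝒜 k).flip 1) hg.gm_inv_sub_one
  convert Submodule.add_mem _ (Submodule.add_mem _ h1 h2) h3 using 1
  ext1 t; ext1 z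
  simp only [Pi.add_apply, map_sub, LinearMap.sub_apply, LinearMap.flip_apply, conjEnd_one]
  rw [← conjEnd_group (gm t z)⁻¹, inv_inv]
  abel

lemma ad_gm_inv : (fun t z => groupAd 𝒜 k (gm t z)⁻¹) ∈
    polyLoops (Set.Iic 0) (Module.End ℂ (truncLie 𝒜 k)) :=
  mem_polyLoops_of_sub_one Set.self_mem_Iic
    (polyLoops_mono Set.Iio_subset_Iic_self hg.ad_gm_inv_sub_one)

lemma ad_gp : (fun t z => groupAd 𝒜 k (gp t z)) ∈
    polyLoops (Set.Ici 0) (Module.End ℂ (truncLie 𝒜 k)) := by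
  convert polyLoops_bilin (conjEnd 𝒜 k) Ici_add_Ici hg.gp_mem hg.gp_inv_mem using 1
  ext1 t; ext1 z
  rw [conjEnd_group]

lemma ad_gp_inv : (fun t z => groupAd 𝒜 k (gp t z)⁻¹) ∈
    polyLoops (Set.Ici 0) (Module.End ℂ (truncLie 𝒜 k)) := by
  convert polyLoops_bilin (conjEnd 𝒜 k) Ici_add_Ici hg.gp_inv_mem hg.gp_mem using 1
  ext1 t; ext1 z
  rw [← conjEnd_group, inv_inv]

/-- Any Birkhoff factorization of the same loop consists of `g₋(t)` and `g₊(t)`. -/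
lemma eq_of_birkhoff [∀ n, FiniteDimensional ℂ (𝒜 n)] {hm hp : ℂˣ → truncGroup 𝒜 k} (t : ℝ)
    (hhm : IsMinusLoop (groupCoords 𝒜 k) hm) (hhp : IsPlusLoop (groupCoords 𝒜 k) hp)
    (h : ∀ z, (hm z)⁻¹ * hp z = (gm t z)⁻¹ * gp t z) : hm = gm t ∧ hp = gp t :=
  eq_of_factorization hhm hhp (polyLoops_freeze hg.gm_inv_sub_one t)
    (polyLoops_freeze hg.gp_inv_mem t) h

variable [∀ n, FiniteDimensional ℂ (𝒜 n)] {X : Loop (truncLie 𝒜 k)}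
  (hE : ∀ t z, (gm t z)⁻¹ * gp t z = groupExp (-(t : ℂ) • evalLoop z X))
include hE

lemma gm_gp_zero : gm 0 = 1 ∧ gp 0 = 1 := by
  have h := hg.eq_of_birkhoff 0 (isMinusLoop_one _) (isPlusLoop_one _) fun z => by
    rw [hE]
    simp [groupExp_zero]
  exact ⟨h.1.symm, h.2.symm⟩

lemma isBirkhoffCurve : IsBirkhoffCurve (groupCoords 𝒜 k) (groupAd 𝒜 k) X gm gp where
  birkhoff t := ⟨hg.isMinusLoop t, hg.isPlusLoop t, fun z => by
    rw [hE, evalLoop_smul]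
    exact isExp_groupExp _⟩
  unique t hm hp h := hg.eq_of_birkhoff t h.1 h.2.1 fun z => by
    rw [hE, isExp_iff.1 (h.2.2 z), evalLoop_smul]
  gm_zero := (hg.gm_gp_zero hE).1
  gp_zero := (hg.gm_gp_zero hE).2
  laurent := hg.isLaurentLoop
  smooth := hg.contDiff
  ad_gm := hg.ad_gm
  ad_gm_inv := hg.ad_gm_inv
  ad_gp := hg.ad_gp
  ad_gp_inv := hg.ad_gp_inv
  velocity t z := by
    have h1 := (hasVelocity_groupAd_groupExp (evalLoop z X) (-t)).comp_neg
    simpa only [hE, Complex.ofReal_neg] using h1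

end IsFactorPair

/-- The loops `exp(-tX)` in `G⁽ᵏ⁾` have Birkhoff factorizations polynomial in `t`. -/
lemma exists_factorPair_groupExp (X : Loop (truncLie 𝒜 k)) :
    ∃ gm gp : ℝ → ℂˣ → truncGroup 𝒜 k, IsFactorPair gm gp ∧
      ∀ t z, (gm t z)⁻¹ * gp t z = groupExp (-(t : ℂ) • evalLoop z X) :=
  exists_birkhoff (groupExp_loop_mem X)

end GroupCurve

/-! ### The adjoint representation of the double group -/

section DoubleAd

variable {H : Type*} [Ring H] [HopfAlgebra ℂ H] {𝒜 : ℕ → Submodule ℂ H} [GradedAlgebra 𝒜] {k : ℕ}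
  [ConnectedGradedHopf 𝒜]

@[simp] lemma DoubleGroup.mul_base (x y : DoubleGroup 𝒜 k) : (x * y).base = x.base * y.base := rfl
@[simp] lemma DoubleGroup.mul_vec (x y : DoubleGroup 𝒜 k) :
    (x * y).vec = x.vec + groupCoAd 𝒜 k x.base y.vec := rfl
@[simp] lemma DoubleGroup.one_base : (1 : DoubleGroup 𝒜 k).base = 1 := rfl
@[simp] lemma DoubleGroup.one_vec : (1 : DoubleGroup 𝒜 k).vec = 0 := rfl
@[simp] lemma DoubleGroup.inv_base (x : DoubleGroup 𝒜 k) : x⁻¹.base = x.base⁻¹ := rfl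
@[simp] lemma DoubleGroup.inv_vec (x : DoubleGroup 𝒜 k) :
    x⁻¹.vec = -groupCoAd 𝒜 k x.base⁻¹ x.vec := rfl

lemma groupCoAd_eq (g : truncGroup 𝒜 k) (ξ : Module.Dual ℂ (truncLie 𝒜 k)) :
    groupCoAd 𝒜 k g ξ = Module.Dual.transpose (R := ℂ) (groupAd 𝒜 k g⁻¹) ξ := rfl

lemma groupCoAd_mul (g g' : truncGroup 𝒜 k) (ξ : Module.Dual ℂ (truncLie 𝒜 k)) :
    groupCoAd 𝒜 k (g * g') ξ = groupCoAd 𝒜 k g (groupCoAd 𝒜 k g' ξ) := by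
  ext Z
  simp [groupCoAd]

lemma groupCoAd_one (ξ : Module.Dual ℂ (truncLie 𝒜 k)) : groupCoAd 𝒜 k 1 ξ = ξ := by
  ext Z
  simp [groupCoAd]

lemma groupCoAd_add (g : truncGroup 𝒜 k) (ξ η : Module.Dual ℂ (truncLie 𝒜 k)) :
    groupCoAd 𝒜 k g (ξ + η) = groupCoAd 𝒜 k g ξ + groupCoAd 𝒜 k g η := rfl

lemma groupCoAd_sub (g : truncGroup 𝒜 k) (ξ η : Module.Dual ℂ (truncLie 𝒜 k)) :
    groupCoAd 𝒜 k g (ξ - η) = groupCoAd 𝒜 k g ξ - groupCoAd 𝒜 k g η := rfl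

lemma groupCoAd_apply_groupAd (g : truncGroup 𝒜 k) (ξ : Module.Dual ℂ (truncLie 𝒜 k))
    (Z : truncLie 𝒜 k) : groupCoAd 𝒜 k g ξ (groupAd 𝒜 k g Z) = ξ Z := by
  rw [groupCoAd, LinearMap.comp_apply, ← Module.End.mul_apply, ← map_mul, inv_mul_cancel, map_one,
    Module.End.one_apply]

lemma dual_lie_apply {𝔤 : Type*} [LieRing 𝔤] [LieAlgebra ℂ 𝔤] (a b : 𝔤) (ξ : Module.Dual ℂ 𝔤) :
    ⁅a, ξ⁆ b = -ξ ⁅a, b⁆ := by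
  simp

lemma groupCoAd_lie (g : truncGroup 𝒜 k) (a : truncLie 𝒜 k) (ξ : Module.Dual ℂ (truncLie 𝒜 k)) :
    groupCoAd 𝒜 k g ⁅a, ξ⁆ = ⁅groupAd 𝒜 k g a, groupCoAd 𝒜 k g ξ⁆ := by
  ext Z
  have h : a = groupAd 𝒜 k g⁻¹ (groupAd 𝒜 k g a) := by
    rw [← Module.End.mul_apply, ← map_mul, inv_mul_cancel, map_one, Module.End.one_apply]
  rw [dual_lie_apply, groupCoAd, groupCoAd, LinearMap.comp_apply, LinearMap.comp_apply,
    dual_lie_apply, groupAd_lie, ← h]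

variable (𝒜 k) in
/-- The adjoint action of `G̃⁽ᵏ⁾` as a representation. -/
def doubleAdHom : DoubleGroup 𝒜 k →* Module.End ℂ (Double (truncLie 𝒜 k)) where
  toFun x :=
    { toFun := doubleAd 𝒜 k x
      map_add' := fun Y W => by
        refine Double.ext (map_add _ _ _) ?_
        simp only [doubleAd, Double.add_fst, Double.add_snd, map_add, groupCoAd_add, add_lie]
        abel
      map_smul' := fun c Y => by
        refine Double.ext (map_smul _ _ _) ?_
        simp only [doubleAd, Double.smul_fst, Double.smul_snd, map_smul, groupCoAd_eq, smul_lie,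
          RingHom.id_apply, smul_sub] }
  map_one' := by
    ext1 Y
    refine Double.ext ?_ ?_
    · simp [doubleAd]
    · simp [doubleAd, groupCoAd_one]
  map_mul' x y := by
    ext1 Y
    refine Double.ext ?_ ?_
    · simp [doubleAd]
    · simp only [doubleAd, DoubleGroup.mul_base, DoubleGroup.mul_vec, groupCoAd_mul, lie_add,
        groupCoAd_sub, groupCoAd_lie, map_mul, Module.End.mul_apply, LinearMap.coe_mk,
        AddHom.coe_mk]
      abel

lemma doubleAdHom_fst (x : DoubleGroup 𝒜 k) (Y : Double (truncLie 𝒜 k)) :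
    (doubleAdHom 𝒜 k x Y).fst = groupAd 𝒜 k x.base Y.fst := rfl

lemma doubleAdHom_snd (x : DoubleGroup 𝒜 k) (Y : Double (truncLie 𝒜 k)) :
    (doubleAdHom 𝒜 k x Y).snd =
      groupCoAd 𝒜 k x.base Y.snd - ⁅groupAd 𝒜 k x.base Y.fst, x.vec⁆ := rfl

lemma doubleAdHom_lie (x : DoubleGroup 𝒜 k) (Y W : Double (truncLie 𝒜 k)) :
    doubleAdHom 𝒜 k x ⁅Y, W⁆ = ⁅doubleAdHom 𝒜 k x Y, doubleAdHom 𝒜 k x W⁆ := by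
  refine Double.ext (groupAd_lie _ _ _) ?_
  simp only [Double.lie_snd, doubleAdHom_fst, doubleAdHom_snd, Double.lie_fst, groupCoAd_sub,
    groupCoAd_lie, groupAd_lie, lie_lie, lie_sub]
  abel

/-- The adjoint action preserves the natural pairing. -/
lemma pairing_doubleAdHom (x : DoubleGroup 𝒜 k) (Y W : Double (truncLie 𝒜 k)) :
    Double.pairing (doubleAdHom 𝒜 k x Y) (doubleAdHom 𝒜 k x W) = Double.pairing Y W := by
  simp only [Double.pairing, doubleAdHom_fst, doubleAdHom_snd, LinearMap.sub_apply,
    groupCoAd_apply_groupAd, dual_lie_apply]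
  rw [← lie_skew, map_neg]
  ring

section Blocks

variable (𝔤 : Type*) [LieRing 𝔤] [LieAlgebra ℂ 𝔤]

/-- The projection `δ → 𝔤*`. -/
def projDual : Double 𝔤 →ₗ[ℂ] Module.Dual ℂ 𝔤 where
  toFun := Double.snd
  map_add' _ _ := rfl
  map_smul' _ _ := rfl

/-- An endomorphism of `𝔤`, extended by zero to `δ = 𝔤 ⊕ 𝔤*`. -/
def blockFst : Module.End ℂ 𝔤 →ₗ[ℂ] Module.End ℂ (Double 𝔤) where
  toFun a := Double.inl ∘ₗ a ∘ₗ Double.proj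
  map_add' a b := by ext1 Y; simp
  map_smul' c a := by ext1 Y; simp

/-- The transpose of an endomorphism of `𝔤`, extended by zero to `δ = 𝔤 ⊕ 𝔤*`. -/
def blockSnd : Module.End ℂ 𝔤 →ₗ[ℂ] Module.End ℂ (Double 𝔤) where
  toFun a := Double.inr ∘ₗ Module.Dual.transpose (R := ℂ) a ∘ₗ projDual 𝔤
  map_add' a b := by ext1 Y; simp
  map_smul' c a := by ext1 Y; simp

/-- The endomorphism `(Y, β) ↦ (0, ad*_{a Y} α)` of `δ`. -/
def blockOff : Module.Dual ℂ 𝔤 →ₗ[ℂ] Module.End ℂ 𝔤 →ₗ[ℂ] Module.End ℂ (Double 𝔤) :=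
  LinearMap.mk₂ ℂ (fun α a =>
      { toFun := fun Y => Double.inr ⁅a Y.fst, α⁆
        map_add' := fun Y W => by simp
        map_smul' := fun c Y => by simp })
    (fun α β a => by ext1 Y; simp)
    (fun c α a => by ext1 Y; simp)
    (fun α a b => by ext1 Y; simp)
    (fun c α a => by ext1 Y; simp)

end Blocks

lemma doubleAdHom_eq_blocks (x : DoubleGroup 𝒜 k) :
    doubleAdHom 𝒜 k x = blockFst _ (groupAd 𝒜 k x.base) + blockSnd _ (groupAd 𝒜 k x.base⁻¹) -
      blockOff _ x.vec (groupAd 𝒜 k x.base) := by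
  rw [eq_sub_iff_add_eq]
  ext1 Y
  refine Double.ext ?_ ?_
  · change groupAd 𝒜 k x.base Y.fst + 0 = groupAd 𝒜 k x.base Y.fst + 0
    rfl
  · change groupCoAd 𝒜 k x.base Y.snd - ⁅groupAd 𝒜 k x.base Y.fst, x.vec⁆ +
      ⁅groupAd 𝒜 k x.base Y.fst, x.vec⁆ = 0 + groupCoAd 𝒜 k x.base Y.snd
    abel

lemma one_eq_blocks {𝔤 : Type*} [LieRing 𝔤] [LieAlgebra ℂ 𝔤] :
    (1 : Module.End ℂ (Double 𝔤)) = blockFst 𝔤 1 + blockSnd 𝔤 1 := by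
  ext1 Y
  exact Double.ext (add_zero _).symm (zero_add _).symm

lemma doubleAdHom_mem {S : Set ℤ} {g : ℝ → ℂˣ → DoubleGroup 𝒜 k}
    (h1 : (fun t z => groupAd 𝒜 k (g t z).base) ∈ polyLoops S (Module.End ℂ (truncLie 𝒜 k)))
    (h2 : (fun t z => groupAd 𝒜 k (g t z).base⁻¹) ∈ polyLoops S (Module.End ℂ (truncLie 𝒜 k)))
    (h3 : (fun t z => (g t z).vec) ∈ polyLoops S (Module.Dual ℂ (truncLie 𝒜 k)))
    (hS : ∀ m ∈ S, ∀ m' ∈ S, m + m' ∈ S) :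
    (fun t z => doubleAdHom 𝒜 k (g t z)) ∈
      polyLoops S (Module.End ℂ (Double (truncLie 𝒜 k))) := by
  have h4 := polyLoops_bilin (blockOff (truncLie 𝒜 k)) hS h3 h1
  have h5 := Submodule.sub_mem _ (Submodule.add_mem _ (polyLoops_map (blockFst _) h1)
    (polyLoops_map (blockSnd _) h2)) h4
  convert h5 using 1
  ext1 t; ext1 z
  exact doubleAdHom_eq_blocks _

end DoubleAd

/-! ### Exponentials in the double group -/

section DoubleExp

variable {H : Type*} [Ring H] [HopfAlgebra ℂ H] {𝒜 : ℕ → Submodule ℂ H} [GradedAlgebra 𝒜] {k : ℕ}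
  [ConnectedGradedHopf 𝒜]

lemma HasVelocity.comp_mul {V : Type*} [AddCommGroup V] [Module ℂ V] {c : ℝ → V} {v : V} {a t : ℝ}
    (h : HasVelocity c v (t * a)) : HasVelocity (fun s => c (s * a)) ((a : ℂ) • v) t := by
  intro l
  refine (HasDerivAt.scomp t (h l) (hasDerivAt_mul_const a)).congr_deriv ?_
  rw [map_smul]
  simp

lemma eq_of_hasVelocity_of_eq {V : Type*} [AddCommGroup V] [Module ℂ V] {c d : ℝ → V} {v : ℝ → V}
    (hc : ∀ t, HasVelocity c (v t) t) (hd : ∀ t, HasVelocity d (v t) t) (h : c 0 = d 0) (t : ℝ) :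
    c t = d t := by
  have h1 : ∀ t, HasVelocity (fun s => c s - d s) 0 t := fun t => by
    simpa using (hc t).sub (hd t)
  have h2 := eq_of_velocity_eq_zero h1 t 0
  rwa [h, sub_self, sub_eq_zero] at h2

/-- Along a one-parameter subgroup of `G̃⁽ᵏ⁾` the component in `(𝔤⁽ᵏ⁾)*` moves with the coadjoint
action of the component in `G⁽ᵏ⁾`. -/
lemma hasVelocity_vec_of_oneParameter {γ : ℝ → DoubleGroup 𝒜 k}
    {α : Module.Dual ℂ (truncLie 𝒜 k)} (hγ : ∀ s t, γ (s + t) = γ s * γ t)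
    (h0 : HasVelocity (fun s => (γ s).vec) α 0) (t : ℝ) :
    HasVelocity (fun s => (γ s).vec) (groupCoAd 𝒜 k (γ t).base α) t := by
  have h1 : HasVelocity (fun r => (γ (t + r)).vec) (groupCoAd 𝒜 k (γ t).base α) 0 := by
    simp only [hγ, DoubleGroup.mul_vec]
    have h2 := (HasVelocity.const (γ t).vec 0).add
      (h0.map (Module.Dual.transpose (R := ℂ) (groupAd 𝒜 k (γ t).base⁻¹)))
    rwa [zero_add] at h2
  simpa using h1.of_shift (c := fun s => (γ s).vec)

lemma hasVelocity_dual {𝔤 : Type*} [AddCommGroup 𝔤] [Module ℂ 𝔤] [FiniteDimensional ℂ 𝔤]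
    {c : ℝ → Module.Dual ℂ 𝔤} {α : Module.Dual ℂ 𝔤} {t : ℝ}
    (h : ∀ Z, HasDerivAt (fun s => c s Z) (α Z) t) : HasVelocity c α t := by
  intro l
  obtain ⟨Z, rfl⟩ := (Module.evalEquiv ℂ 𝔤).surjective l
  exact h Z

lemma oneParameter_zero {Γ : Type*} [Group Γ] {γ : ℝ → Γ} (hγ : ∀ s t, γ (s + t) = γ s * γ t) :
    γ 0 = 1 := by
  have h2 := hγ 0 0
  rwa [add_zero, left_eq_mul] at h2

/-- A one-parameter subgroup of `G̃⁽ᵏ⁾` is determined by its velocity at `0`. -/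
lemma double_oneParameter_unique [∀ n, FiniteDimensional ℂ (𝒜 n)] {γ γ' : ℝ → DoubleGroup 𝒜 k}
    {Y : Double (truncLie 𝒜 k)} (hγ : ∀ s t, γ (s + t) = γ s * γ t)
    (h0 : ∀ i, HasDerivAt (fun t => (doubleCoords 𝒜 k).coord i (γ t))
      ((doubleCoords 𝒜 k).tangent i Y) 0)
    (hγ' : ∀ s t, γ' (s + t) = γ' s * γ' t)
    (h0' : ∀ i, HasDerivAt (fun t => (doubleCoords 𝒜 k).coord i (γ' t))
      ((doubleCoords 𝒜 k).tangent i Y) 0) (s : ℝ) : γ s = γ' s := by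
  have hb : ∀ s, (γ s).base = groupExp ((s : ℂ) • Y.fst) :=
    eq_groupExp_of_oneParameter (γ := fun s => (γ s).base)
      (fun s t => congrArg DoubleGroup.base (hγ s t)) (fun x => h0 (Sum.inl x))
  have hb' : ∀ s, (γ' s).base = groupExp ((s : ℂ) • Y.fst) :=
    eq_groupExp_of_oneParameter (γ := fun s => (γ' s).base)
      (fun s t => congrArg DoubleGroup.base (hγ' s t)) (fun x => h0' (Sum.inl x))
  refine DoubleGroup.ext ((hb s).trans (hb' s).symm) ?_
  have hv := hasVelocity_vec_of_oneParameter hγ (hasVelocity_dual fun Z => h0 (Sum.inr Z))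
  have hv' := hasVelocity_vec_of_oneParameter hγ' (hasVelocity_dual fun Z => h0' (Sum.inr Z))
  simp only [hb] at hv
  simp only [hb'] at hv'
  refine eq_of_hasVelocity_of_eq (c := fun s => (γ s).vec) (d := fun s => (γ' s).vec) hv hv' ?_ s
  simp only [oneParameter_zero hγ, oneParameter_zero hγ']

/-- `e(t)` is the loop `exp(-tX)` in `G̃⁽ᵏ⁾`, given in components: the component in `(𝔤⁽ᵏ⁾)*` is a
primitive of the coadjoint action along the component in `G⁽ᵏ⁾`. -/
structure IsExpLoop (X : Loop (Double (truncLie 𝒜 k))) (e : ℝ → ℂˣ → DoubleGroup 𝒜 k) : Prop where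
  base : ∀ t z, (e t z).base = groupExp (-(t : ℂ) • (evalLoop z X).fst)
  vec_mem : (fun t z => (e t z).vec) ∈ polyLoops Set.univ (Module.Dual ℂ (truncLie 𝒜 k))
  vec_zero : ∀ z, (e 0 z).vec = 0
  velocity : ∀ t z, HasVelocity (fun s => (e s z).vec)
    (groupCoAd 𝒜 k (e t z).base (-(evalLoop z X).snd)) t

lemma groupAd_groupExp_loop_mem (X : Loop (truncLie 𝒜 k)) :
    (fun (t : ℝ) z => groupAd 𝒜 k (groupExp (-(t : ℂ) • evalLoop z X))) ∈
      polyLoops Set.univ (Module.End ℂ (truncLie 𝒜 k)) := by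
  have h1 := groupExp_loop_mem X
  have h2 : (fun (t : ℝ) z => groupVal 𝒜 k (groupExp (-(t : ℂ) • evalLoop z X))⁻¹) ∈
      polyLoops Set.univ (TruncDual 𝒜 k) := by
    have h3 := groupExp_loop_mem (-X)
    simpa only [evalLoop_neg, smul_neg, groupExp_neg] using h3
  have h4 := polyLoops_bilin (conjEnd 𝒜 k) (add_mem_univ Set.univ Set.univ) h1 h2
  simpa only [conjEnd_group] using h4

/-- The primitive exists within curves that are polynomial in `t` because the coadjoint action of
`exp(-tX₁)`, for a nilpotent `X₁`, is polynomial in `t`. -/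
lemma exists_isExpLoop (X : Loop (Double (truncLie 𝒜 k))) : ∃ e, IsExpLoop X e := by
  let X₁ : Loop (truncLie 𝒜 k) := mapLoop Double.proj X
  have hX₁ : ∀ z, evalLoop z X₁ = (evalLoop z X).fst := fun z => evalLoop_mapLoop _ z X
  have h1 : (fun (t : ℝ) z => groupAd 𝒜 k (groupExp (-(t : ℂ) • (evalLoop z X).fst))⁻¹) ∈
      polyLoops Set.univ (Module.End ℂ (truncLie 𝒜 k)) := by
    have h2 := groupAd_groupExp_loop_mem (-X₁)
    simpa only [evalLoop_neg, smul_neg, groupExp_neg, hX₁] using h2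
  have h2 : (fun (_ : ℝ) z => -(evalLoop z X).snd) ∈
      polyLoops Set.univ (Module.Dual ℂ (truncLie 𝒜 k)) :=
    Submodule.neg_mem _ (polyLoops_map (projDual (truncLie 𝒜 k))
      (evalLoop_mem_polyLoops X (S := Set.univ) fun m _ => Set.mem_univ m))
  have h3 := polyLoops_bilin (Module.Dual.transpose (R := ℂ) (M := truncLie 𝒜 k)
    (M' := truncLie 𝒜 k)) (add_mem_univ Set.univ Set.univ) h1 h2
  obtain ⟨F, hF, hF0, hF'⟩ := exists_antiderivative_mem_polyLoops h3
  exact ⟨fun t z => ⟨groupExp (-(t : ℂ) • (evalLoop z X).fst), F t z⟩, fun _ _ => rfl, hF, hF0, hF'⟩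

namespace IsExpLoop

variable {X : Loop (Double (truncLie 𝒜 k))} {e : ℝ → ℂˣ → DoubleGroup 𝒜 k} (he : IsExpLoop X e)
include he

lemma base_add (s t : ℝ) (z : ℂˣ) : (e (s + t) z).base = (e s z).base * (e t z).base := by
  simp only [he.base, Complex.ofReal_add, neg_add, groupExp_smul_add]

lemma apply_add (s t : ℝ) (z : ℂˣ) : e (s + t) z = e s z * e t z := by
  refine DoubleGroup.ext (he.base_add s t z) ?_
  refine eq_of_hasVelocity_of_eq (c := fun t => (e (s + t) z).vec)
    (d := fun t => (e s z * e t z).vec)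
    (v := fun t => groupCoAd 𝒜 k (e (s + t) z).base (-(evalLoop z X).snd))
    (fun t => (he.velocity (s + t) z).shift) (fun t => ?_) ?_ t
  · have h2 := (HasVelocity.const (e s z).vec t).add
      ((he.velocity t z).map (Module.Dual.transpose (R := ℂ) (groupAd 𝒜 k (e s z).base⁻¹)))
    rw [zero_add, ← groupCoAd_eq, ← groupCoAd_mul, ← he.base_add] at h2
    exact h2
  · simp only [add_zero, DoubleGroup.mul_vec, he.vec_zero, groupCoAd_eq, map_zero]

/-- `s ↦ e(st)` is the one-parameter subgroup with velocity `-tX(λ)`. -/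
lemma isOneParameter (t : ℝ) (z : ℂˣ) :
    (∀ r s, e ((r + s) * t) z = e (r * t) z * e (s * t) z) ∧
    ∀ i, HasDerivAt (fun s => (doubleCoords 𝒜 k).coord i (e (s * t) z))
      ((doubleCoords 𝒜 k).tangent i (-(t : ℂ) • evalLoop z X)) 0 := by
  refine ⟨fun r s => by rw [add_mul, he.apply_add], ?_⟩
  rintro (x | Z)
  · have h1 := hasVelocity_truncExp_zero (-(t : ℂ) • (evalLoop z X).fst) (evalAt 𝒜 k x)
    refine h1.congr_of_eventuallyEq (Eventually.of_forall fun s => ?_)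
    change (groupVal 𝒜 k (e (s * t) z).base).toFun x = _
    rw [he.base, groupVal_groupExp]
    change (truncExp _).toFun x = (truncExp _).toFun x
    congr 3
    rw [Complex.ofReal_mul, ← mul_neg, mul_smul]
    rfl
  · have h1 : HasVelocity (fun s => (e s z).vec) (-(evalLoop z X).snd) (0 * t) := by
      rw [zero_mul]
      have h2 := he.velocity 0 z
      rwa [he.base, Complex.ofReal_zero, neg_zero, zero_smul, groupExp_zero,
        groupCoAd_one] at h2
    refine (h1.comp_mul (Module.Dual.eval ℂ (truncLie 𝒜 k) Z)).congr_deriv ?_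
    change ((t : ℂ) • -(evalLoop z X).snd) Z = (-(t : ℂ) • (evalLoop z X).snd) Z
    rw [smul_neg, neg_smul]

lemma isExp (t : ℝ) (z : ℂˣ) : IsExp (doubleCoords 𝒜 k) (-(t : ℂ) • evalLoop z X) (e t z) :=
  ⟨fun s => e (s * t) z, (he.isOneParameter t z).1, (he.isOneParameter t z).2,
    congrArg (fun s => e s z) (one_mul t)⟩

lemma eq_of_isExp [∀ n, FiniteDimensional ℂ (𝒜 n)] {t : ℝ} {z : ℂˣ} {g : DoubleGroup 𝒜 k}
    (h : IsExp (doubleCoords 𝒜 k) (-(t : ℂ) • evalLoop z X) g) : g = e t z := by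
  obtain ⟨γ, hγ, h0, rfl⟩ := h
  have h1 := double_oneParameter_unique hγ h0 (he.isOneParameter t z).1 (he.isOneParameter t z).2 1
  rwa [one_mul] at h1

lemma ad_base_mem : (fun t z => groupAd 𝒜 k (e t z).base) ∈
    polyLoops Set.univ (Module.End ℂ (truncLie 𝒜 k)) := by
  have h := groupAd_groupExp_loop_mem (mapLoop Double.proj X)
  simp only [evalLoop_mapLoop] at h
  simp only [he.base]
  exact h

lemma ad_base_inv_mem : (fun t z => groupAd 𝒜 k (e t z).base⁻¹) ∈
    polyLoops Set.univ (Module.End ℂ (truncLie 𝒜 k)) := by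
  have h := groupAd_groupExp_loop_mem (-mapLoop Double.proj X)
  simp only [evalLoop_neg, evalLoop_mapLoop, smul_neg, groupExp_neg] at h
  simp only [he.base]
  exact h

lemma hasVelocity_doubleAdHom (t : ℝ) (z : ℂˣ) :
    HasVelocity (fun s => doubleAdHom 𝒜 k (e s z))
      (-(doubleAdHom 𝒜 k (e t z) * adEnd _ (evalLoop z X))) t := by
  have hb : HasVelocity (fun s => groupAd 𝒜 k (e s z).base) (-adEnd _ (evalLoop z X).fst) 0 := by
    have h1 := (hasVelocity_groupAd_groupExp (evalLoop z X).fst (-0)).comp_neg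
    simp only [neg_zero, Complex.ofReal_zero, zero_smul, groupExp_zero, map_one, one_mul,
      Complex.ofReal_neg] at h1
    simpa only [he.base] using h1
  have hb' : HasVelocity (fun s => groupAd 𝒜 k (e s z).base⁻¹) (adEnd _ (evalLoop z X).fst) 0 := by
    have h1 := hasVelocity_groupAd_groupExp (evalLoop z X).fst 0
    simp only [Complex.ofReal_zero, zero_smul, groupExp_zero, map_one, one_mul] at h1
    simpa only [he.base, neg_smul, groupExp_neg, inv_inv] using h1
  have hbase : (e 0 z).base = 1 := by
    rw [he.base, Complex.ofReal_zero, neg_zero, zero_smul, groupExp_zero]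
  have hv : HasVelocity (fun s => (e s z).vec) (-(evalLoop z X).snd) 0 := by
    have h2 := he.velocity 0 z
    rwa [hbase, groupCoAd_one] at h2
  have h0 : HasVelocity (fun s => doubleAdHom 𝒜 k (e s z)) (-adEnd _ (evalLoop z X)) 0 := by
    have h3 := ((hb.map (blockFst _)).add (hb'.map (blockSnd _))).sub (hv.bilin hb (blockOff _))
    simp only [doubleAdHom_eq_blocks]
    convert h3 using 1
    rw [hbase, he.vec_zero, map_one, map_zero, LinearMap.zero_apply, add_zero, map_neg, map_neg,
      LinearMap.neg_apply, sub_neg_eq_add]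
    ext1 Y
    refine Double.ext ?_ ?_
    · change -⁅(evalLoop z X).fst, Y.fst⁆ = -⁅(evalLoop z X).fst, Y.fst⁆ + 0 + 0
      abel
    · change -(⁅(evalLoop z X).fst, Y.snd⁆ - ⁅Y.fst, (evalLoop z X).snd⁆) =
        -0 + Module.Dual.transpose (R := ℂ) (adEnd _ (evalLoop z X).fst) Y.snd +
          ⁅Y.fst, (evalLoop z X).snd⁆
      ext Z
      simp [Module.Dual.transpose_apply]
      ring
  have h4 := hasVelocity_oneParameter_left (γ := fun s => doubleAdHom 𝒜 k (e s z))
    (fun s t => by rw [he.apply_add, map_mul]) h0 t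
  rwa [mul_neg] at h4

end IsExpLoop

end DoubleExp

/-! ### Birkhoff curves in the double group -/

section DoubleCurve

variable {H : Type*} [Ring H] [HopfAlgebra ℂ H] {𝒜 : ℕ → Submodule ℂ H} [GradedAlgebra 𝒜] {k : ℕ}
  [ConnectedGradedHopf 𝒜]

/-- The factors of `exp(-tX)` in `G̃⁽ᵏ⁾`: over the factors of the component in `G⁽ᵏ⁾`, the components
in `(𝔤⁽ᵏ⁾)*` have the exponents of a Birkhoff factorization. -/
structure IsDoubleFactorPair (gm gp : ℝ → ℂˣ → DoubleGroup 𝒜 k) : Prop where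
  base : IsFactorPair (fun t z => (gm t z).base) (fun t z => (gp t z).base)
  vec_gm : (fun t z => (gm t z).vec) ∈ polyLoops (Set.Iio 0) (Module.Dual ℂ (truncLie 𝒜 k))
  vec_gp : (fun t z => (gp t z).vec) ∈ polyLoops (Set.Ici 0) (Module.Dual ℂ (truncLie 𝒜 k))

lemma inv_mul_vec (x y : DoubleGroup 𝒜 k) :
    (x⁻¹ * y).vec = groupCoAd 𝒜 k x.base⁻¹ (y.vec - x.vec) := by
  rw [DoubleGroup.mul_vec, DoubleGroup.inv_vec, DoubleGroup.inv_base, groupCoAd_sub]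
  abel

/-- Over a factorization `g₋⁻¹ g₊` in `G⁽ᵏ⁾`, the components `α₋`, `α₊` in `(𝔤⁽ᵏ⁾)*` have to satisfy
`α₊ - α₋ = Ad*_{g₋} β`, where `β` is the component of `exp(-tX)`; hence they are, up to sign, the
nonnegative and the negative part of `Ad*_{g₋} β`. -/
lemma exists_doubleFactorPair {X : Loop (Double (truncLie 𝒜 k))} {e : ℝ → ℂˣ → DoubleGroup 𝒜 k}
    (he : IsExpLoop X e) : ∃ gm gp : ℝ → ℂˣ → DoubleGroup 𝒜 k, IsDoubleFactorPair gm gp ∧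
      ∀ t z, (gm t z)⁻¹ * gp t z = e t z := by
  obtain ⟨gm, gp, hg, hE⟩ := exists_factorPair_groupExp (mapLoop Double.proj X)
  have hE' : ∀ t z, (gm t z)⁻¹ * gp t z = (e t z).base := fun t z => by
    rw [hE, he.base, evalLoop_mapLoop]
    rfl
  have h1 := polyLoops_bilin (Module.Dual.transpose (R := ℂ) (M := truncLie 𝒜 k)
    (M' := truncLie 𝒜 k)) (add_mem_univ (Set.Iic 0) Set.univ) hg.ad_gm_inv he.vec_mem
  obtain ⟨fm, hfm, fp, hfp, hsum⟩ := polyLoops_split h1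
  refine ⟨fun t z => ⟨gm t z, -fm t z⟩, fun t z => ⟨gp t z, fp t z⟩,
    ⟨hg, Submodule.neg_mem _ hfm, hfp⟩, fun t z => DoubleGroup.ext (hE' t z) ?_⟩
  have h2 : fp t z - -fm t z = groupCoAd 𝒜 k (gm t z) (e t z).vec := by
    have h3 := congrFun (congrFun hsum t) z
    rw [sub_neg_eq_add, add_comm]
    exact h3.symm
  rw [inv_mul_vec, h2, ← groupCoAd_mul, inv_mul_cancel, groupCoAd_one]

namespace IsDoubleFactorPair

variable {gm gp : ℝ → ℂˣ → DoubleGroup 𝒜 k} (hg : IsDoubleFactorPair gm gp)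
include hg

lemma isMinusLoop (t : ℝ) : IsMinusLoop (doubleCoords 𝒜 k) (gm t) := by
  rintro (x | Z)
  · exact hg.base.isMinusLoop t x
  · obtain ⟨p, hp, hp'⟩ := polyLoops_inverse
      (polyLoops_map (Module.Dual.eval ℂ (truncLie 𝒜 k) Z) hg.vec_gm) t
    refine ⟨p, hp, fun z => ?_⟩
    rw [← hp']
    exact (zero_add _).symm

lemma isPlusLoop (t : ℝ) : IsPlusLoop (doubleCoords 𝒜 k) (gp t) := by
  rintro (x | Z)
  · exact hg.base.isPlusLoop t x
  · exact polyLoops_entire (polyLoops_map (Module.Dual.eval ℂ (truncLie 𝒜 k) Z) hg.vec_gp) t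

lemma isLaurentLoop (t : ℝ) :
    IsLaurentLoop (doubleCoords 𝒜 k) (gm t) ∧ IsLaurentLoop (doubleCoords 𝒜 k) (gp t) := by
  constructor
  · rintro (x | Z)
    · exact (hg.base.isLaurentLoop t).1 x
    · exact polyLoops_laurent (polyLoops_map (Module.Dual.eval ℂ (truncLie 𝒜 k) Z) hg.vec_gm) t
  · rintro (x | Z)
    · exact (hg.base.isLaurentLoop t).2 x
    · exact polyLoops_laurent (polyLoops_map (Module.Dual.eval ℂ (truncLie 𝒜 k) Z) hg.vec_gp) t

lemma contDiff (z : ℂˣ) (i : H ⊕ truncLie 𝒜 k) :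
    ContDiff ℝ (⊤ : ℕ∞) (fun t => (doubleCoords 𝒜 k).coord i (gm t z)) ∧
      ContDiff ℝ (⊤ : ℕ∞) (fun t => (doubleCoords 𝒜 k).coord i (gp t z)) := by
  rcases i with x | Z
  · exact hg.base.contDiff z x
  · exact ⟨polyLoops_contDiff (polyLoops_map (Module.Dual.eval ℂ (truncLie 𝒜 k) Z) hg.vec_gm) z,
      polyLoops_contDiff (polyLoops_map (Module.Dual.eval ℂ (truncLie 𝒜 k) Z) hg.vec_gp) z⟩

lemma ad_gm_base_mem : (fun t z => groupAd 𝒜 k (gm t z).base) ∈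
    polyLoops (Set.Iic 0) (Module.End ℂ (truncLie 𝒜 k)) :=
  mem_polyLoops_of_sub_one Set.self_mem_Iic
    (polyLoops_mono Set.Iio_subset_Iic_self hg.base.ad_gm)

lemma ad_gm : (fun t z => doubleAdHom 𝒜 k (gm t z) - 1) ∈
    polyLoops (Set.Iio 0) (Module.End ℂ (Double (truncLie 𝒜 k))) := by
  have h1 := polyLoops_bilin (blockOff (truncLie 𝒜 k)) Iio_add_Iic hg.vec_gm hg.ad_gm_base_mem
  have h2 := Submodule.sub_mem _ (Submodule.add_mem _
    (polyLoops_map (blockFst _) hg.base.ad_gm)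
    (polyLoops_map (blockSnd _) hg.base.ad_gm_inv_sub_one)) h1
  convert h2 using 1
  ext1 t; ext1 z
  rw [doubleAdHom_eq_blocks, one_eq_blocks]
  simp only [Pi.add_apply, Pi.sub_apply, map_sub]
  abel

lemma ad_gm_inv : (fun t z => doubleAdHom 𝒜 k (gm t z)⁻¹) ∈
    polyLoops (Set.Iic 0) (Module.End ℂ (Double (truncLie 𝒜 k))) := by
  refine doubleAdHom_mem hg.base.ad_gm_inv ?_ ?_ Iic_add_Iic
  · simpa only [DoubleGroup.inv_base, inv_inv] using hg.ad_gm_base_mem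
  · have h1 := polyLoops_bilin (Module.Dual.transpose (R := ℂ) (M := truncLie 𝒜 k)
      (M' := truncLie 𝒜 k)) Iic_add_Iic hg.ad_gm_base_mem
      (polyLoops_mono Set.Iio_subset_Iic_self hg.vec_gm)
    have h2 := Submodule.neg_mem _ h1
    convert h2 using 1
    ext1 t; ext1 z
    rw [DoubleGroup.inv_vec, groupCoAd_eq, inv_inv]
    rfl

lemma ad_gp : (fun t z => doubleAdHom 𝒜 k (gp t z)) ∈
    polyLoops (Set.Ici 0) (Module.End ℂ (Double (truncLie 𝒜 k))) :=
  doubleAdHom_mem hg.base.ad_gp hg.base.ad_gp_inv hg.vec_gp Ici_add_Ici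

lemma ad_gp_inv : (fun t z => doubleAdHom 𝒜 k (gp t z)⁻¹) ∈
    polyLoops (Set.Ici 0) (Module.End ℂ (Double (truncLie 𝒜 k))) := by
  refine doubleAdHom_mem hg.base.ad_gp_inv ?_ ?_ Ici_add_Ici
  · simpa only [DoubleGroup.inv_base, inv_inv] using hg.base.ad_gp
  · have h1 := polyLoops_bilin (Module.Dual.transpose (R := ℂ) (M := truncLie 𝒜 k)
      (M' := truncLie 𝒜 k)) Ici_add_Ici hg.base.ad_gp hg.vec_gp
    have h2 := Submodule.neg_mem _ h1
    convert h2 using 1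
    ext1 t; ext1 z
    rw [DoubleGroup.inv_vec, groupCoAd_eq, inv_inv]
    rfl

variable [∀ n, FiniteDimensional ℂ (𝒜 n)]

/-- Uniqueness of the factorization. The components in `G⁽ᵏ⁾` agree, hence the components in
`(𝔤⁽ᵏ⁾)*` of both factors differ by the same loop, which vanishes by Liouville's theorem. -/
lemma eq_of_birkhoff {hm hp : ℂˣ → DoubleGroup 𝒜 k} (t : ℝ)
    (hhm : IsMinusLoop (doubleCoords 𝒜 k) hm) (hhp : IsPlusLoop (doubleCoords 𝒜 k) hp)
    (h : ∀ z, (hm z)⁻¹ * hp z = (gm t z)⁻¹ * gp t z) : hm = gm t ∧ hp = gp t := by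
  obtain ⟨hb1, hb2⟩ := hg.base.eq_of_birkhoff (hm := fun z => (hm z).base)
    (hp := fun z => (hp z).base) t (fun x => hhm (Sum.inl x)) (fun x => hhp (Sum.inl x))
    (fun z => congrArg DoubleGroup.base (h z))
  have hb1' : ∀ z, (hm z).base = (gm t z).base := congrFun hb1
  have h1 : ∀ z, (hm z).vec - (gm t z).vec = (hp z).vec - (gp t z).vec := by
    intro z
    have h2 := congrArg (fun x => groupCoAd 𝒜 k (gm t z).base x.vec) (h z)
    simp only [inv_mul_vec, hb1', ← groupCoAd_mul, mul_inv_cancel, groupCoAd_one] at h2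
    rw [sub_eq_sub_iff_add_eq_add] at h2 ⊢
    rw [add_comm, ← h2, add_comm]
  have h2 : (fun _ z => (hm z).vec) ∈ polyLoops (Set.Iio 0) (Module.Dual ℂ (truncLie 𝒜 k)) := by
    refine mem_polyLoops_of_inverse fun l => ?_
    obtain ⟨Z, rfl⟩ := (Module.evalEquiv ℂ (truncLie 𝒜 k)).surjective l
    obtain ⟨p, hp0, hp'⟩ := hhm (Sum.inr Z)
    exact ⟨p, hp0, fun z => (hp' z).trans (zero_add _)⟩
  have h3 : ∀ z, (hm z).vec - (gm t z).vec = 0 := by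
    refine eq_zero_of_isEntire (Submodule.sub_mem _ h2 (polyLoops_freeze hg.vec_gm t)) fun l => ?_
    obtain ⟨Z, rfl⟩ := (Module.evalEquiv ℂ (truncLie 𝒜 k)).surjective l
    obtain ⟨F, hF, hF'⟩ := hhp (Sum.inr Z)
    obtain ⟨G, hG, hG'⟩ := hg.isPlusLoop t (Sum.inr Z)
    refine ⟨fun z => F z - G z, hF.sub hG, fun z => ?_⟩
    change ((hm z).vec - (gm t z).vec) Z = F z - G z
    rw [h1, ← hF', ← hG']
    rfl
  refine ⟨funext fun z => DoubleGroup.ext (hb1' z) (sub_eq_zero.1 (h3 z)),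
    funext fun z => DoubleGroup.ext (congrFun hb2 z) (sub_eq_zero.1 ?_)⟩
  rw [← h1, h3]

lemma isBirkhoffCurve {X : Loop (Double (truncLie 𝒜 k))} {e : ℝ → ℂˣ → DoubleGroup 𝒜 k}
    (he : IsExpLoop X e) (hE : ∀ t z, (gm t z)⁻¹ * gp t z = e t z) :
    IsBirkhoffCurve (doubleCoords 𝒜 k) (doubleAdHom 𝒜 k) X gm gp := by
  have h0 := hg.eq_of_birkhoff 0 (isMinusLoop_one _) (isPlusLoop_one _) fun z => by
    have h1 := oneParameter_zero (γ := fun s => e s z) fun s t => he.apply_add s t z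
    rw [hE]
    simp only [Pi.one_apply, inv_one, mul_one]
    exact h1.symm
  exact
    { birkhoff := fun t => ⟨hg.isMinusLoop t, hg.isPlusLoop t, fun z => by
        rw [hE, evalLoop_smul]
        exact he.isExp t z⟩
      unique := fun t hm hp h => hg.eq_of_birkhoff t h.1 h.2.1 fun z => by
        rw [hE]
        have h1 := h.2.2 z
        rw [evalLoop_smul] at h1
        exact he.eq_of_isExp h1
      gm_zero := h0.1.symm
      gp_zero := h0.2.symm
      laurent := hg.isLaurentLoop
      smooth := hg.contDiff
      ad_gm := hg.ad_gm
      ad_gm_inv := hg.ad_gm_inv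
      ad_gp := hg.ad_gp
      ad_gp_inv := hg.ad_gp_inv
      velocity := fun t z => by
        simpa only [hE] using he.hasVelocity_doubleAdHom t z }

end IsDoubleFactorPair

/-- An `IsExpLoop` is a loop in `LG̃⁽ᵏ⁾`. -/
lemma IsExpLoop.isLaurentLoop {X : Loop (Double (truncLie 𝒜 k))} {e : ℝ → ℂˣ → DoubleGroup 𝒜 k}
    (he : IsExpLoop X e) (t : ℝ) : IsLaurentLoop (doubleCoords 𝒜 k) (e t) := by
  rintro (x | Z)
  · have h := groupExp_loop_mem (mapLoop Double.proj X)
    simp only [evalLoop_mapLoop] at h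
    have h1 := polyLoops_laurent (polyLoops_map (evalAt 𝒜 k x) h) t
    obtain ⟨p, hp⟩ := h1
    refine ⟨p, fun z => ?_⟩
    rw [← hp z]
    change (groupVal 𝒜 k (e t z).base).toFun x = _
    rw [he.base]
    rfl
  · exact polyLoops_laurent (polyLoops_map (Module.Dual.eval ℂ (truncLie 𝒜 k) Z) he.vec_mem) t

end DoubleCurve

/-! ### The residue pairing on the loop algebra of the double -/

section LaurentPolynomials

/-- A Laurent polynomial is determined by its values on `ℂ ∖ {0}`. -/
lemma laurent_ext {p q : LaurentPolynomial ℂ}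
    (h : ∀ z : ℂˣ, p.eval₂ (RingHom.id ℂ) z = q.eval₂ (RingHom.id ℂ) z) : p = q := by
  -- scalar Laurent polynomials are loops in the abelian Lie algebra `ℂ`
  let _ : LieRing ℂ := LieRing.ofAssociativeRing
  let _ : LieAlgebra ℂ ℂ := LieAlgebra.ofAssociativeAlgebra
  have key : ∀ (p : LaurentPolynomial ℂ) (z : ℂˣ),
      p.eval₂ (RingHom.id ℂ) z = evalLoop z (ofCoeffs p.coeff : Loop ℂ) := by
    intro p z
    rw [evalLoop, coeffs_ofCoeffs]
    induction p using LaurentPolynomial.induction_on' with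
    | add p q hp hq =>
      rw [map_add, hp, hq, AddMonoidAlgebra.coeff_add,
        Finsupp.sum_add_index' (fun _ => smul_zero _) (fun _ _ _ => smul_add _ _ _)]
    | C_mul_T n a =>
      rw [LaurentPolynomial.eval₂_C_mul_T, ← LaurentPolynomial.single_eq_C_mul_T,
        AddMonoidAlgebra.coeff_single]
      refine Eq.trans ?_ (Finsupp.sum_single_index (by simp)).symm
      simp [mul_comm]
  have h1 : (ofCoeffs p.coeff : Loop ℂ) = ofCoeffs q.coeff :=
    evalLoop_injective fun z => by rw [← key, h, key]
  have h2 := congrArg coeffs h1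
  rw [coeffs_ofCoeffs, coeffs_ofCoeffs] at h2
  exact AddMonoidAlgebra.coeff_injective h2

end LaurentPolynomials

section Pairing

variable {𝔤 : Type*} [LieRing 𝔤] [LieAlgebra ℂ 𝔤]

lemma pairing_comm (x y : Double 𝔤) : Double.pairing x y = Double.pairing y x := add_comm _ _

/-- The natural pairing is invariant. -/
lemma pairing_lie (x y w : Double 𝔤) : Double.pairing ⁅x, y⁆ w = Double.pairing x ⁅y, w⁆ := by
  simp only [Double.pairing, Double.lie_fst, Double.lie_snd, LinearMap.sub_apply, dual_lie_apply]
  rw [← lie_skew x.fst y.fst, ← lie_skew x.fst w.fst, map_neg, map_neg]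
  ring

variable (𝔤) in
/-- The natural pairing as a bilinear form. -/
def pairingLin : Double 𝔤 →ₗ[ℂ] Double 𝔤 →ₗ[ℂ] ℂ :=
  LinearMap.mk₂ ℂ Double.pairing
    (fun x y w => by simp only [Double.pairing, Double.add_fst, Double.add_snd, map_add,
      LinearMap.add_apply]; ring)
    (fun c x y => by simp only [Double.pairing, Double.smul_fst, Double.smul_snd, map_smul,
      LinearMap.smul_apply, smul_eq_mul]; ring)
    (fun x y w => by simp only [Double.pairing, Double.add_fst, Double.add_snd, map_add,
      LinearMap.add_apply]; ring)
    (fun c x y => by simp only [Double.pairing, Double.smul_fst, Double.smul_snd, map_smul,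
      LinearMap.smul_apply, smul_eq_mul]; ring)

lemma pairingLin_apply (x y : Double 𝔤) : pairingLin 𝔤 x y = Double.pairing x y := rfl

lemma eq_zero_of_pairing {x : Double 𝔤} (h : ∀ y, Double.pairing x y = 0) : x = 0 := by
  refine Double.ext (eq_of_forall_dual fun l => ?_) (LinearMap.ext fun c => ?_)
  · simpa [Double.pairing] using h ⟨0, l⟩
  · simpa [Double.pairing] using h ⟨c, 0⟩

/-- The Laurent polynomial `λ ↦ ⟨L(λ), L'(λ)⟩`. -/
def pairPoly (L L' : Loop (Double 𝔤)) : LaurentPolynomial ℂ :=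
  (coeffs L).sum fun i a => (coeffs L').sum fun j b =>
    LaurentPolynomial.C (Double.pairing a b) * LaurentPolynomial.T (i + j)

lemma pairPoly_eval (L L' : Loop (Double 𝔤)) (z : ℂˣ) :
    (pairPoly L L').eval₂ (RingHom.id ℂ) z = Double.pairing (evalLoop z L) (evalLoop z L') := by
  rw [pairPoly, ← pairingLin_apply, evalLoop, evalLoop]
  simp only [Finsupp.sum, map_sum, LinearMap.sum_apply, LaurentPolynomial.eval₂_C_mul_T, map_smul,
    LinearMap.smul_apply, pairingLin_apply, RingHom.id_apply, smul_eq_mul, zpow_add, Units.val_mul,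
    Finset.mul_sum]
  rw [Finset.sum_comm]
  refine Finset.sum_congr rfl fun i _ => Finset.sum_congr rfl fun j _ => ?_
  ring

variable (𝔤) in
/-- The invariant bilinear form `Res_{λ=0} ⟨L(λ), L'(λ)⟩` on `Lδ`. -/
def resForm : Loop (Double 𝔤) →ₗ[ℂ] Loop (Double 𝔤) →ₗ[ℂ] ℂ :=
  LinearMap.mk₂ ℂ (fun L L' => (pairPoly L L').coeff (-1))
    (fun L L' M => by
      have : pairPoly (L + L') M = pairPoly L M + pairPoly L' M := laurent_ext fun z => by
        simp only [map_add, pairPoly_eval, evalLoop_add, ← pairingLin_apply, LinearMap.add_apply]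
      rw [this]; rfl)
    (fun c L M => by
      have : pairPoly (c • L) M = LaurentPolynomial.C c * pairPoly L M := laurent_ext fun z => by
        simp only [map_mul, LaurentPolynomial.eval₂_C, pairPoly_eval, evalLoop_smul,
          ← pairingLin_apply, map_smul, LinearMap.smul_apply, smul_eq_mul, RingHom.id_apply]
      rw [this, ← LaurentPolynomial.smul_eq_C_mul]; rfl)
    (fun M L L' => by
      have : pairPoly M (L + L') = pairPoly M L + pairPoly M L' := laurent_ext fun z => by
        simp only [map_add, pairPoly_eval, evalLoop_add, ← pairingLin_apply]
      rw [this]; rfl)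
    (fun c M L => by
      have : pairPoly M (c • L) = LaurentPolynomial.C c * pairPoly M L := laurent_ext fun z => by
        simp only [map_mul, LaurentPolynomial.eval₂_C, pairPoly_eval, evalLoop_smul,
          ← pairingLin_apply, map_smul, smul_eq_mul, RingHom.id_apply]
      rw [this, ← LaurentPolynomial.smul_eq_C_mul]; rfl)

lemma resForm_apply (L L' : Loop (Double 𝔤)) : resForm 𝔤 L L' = (pairPoly L L').coeff (-1) := rfl

/-- The residue form depends only on the values of the pairing on `ℂ ∖ {0}`. -/
lemma resForm_congr {L L' M M' : Loop (Double 𝔤)}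
    (h : ∀ z, Double.pairing (evalLoop z L) (evalLoop z L') =
      Double.pairing (evalLoop z M) (evalLoop z M')) : resForm 𝔤 L L' = resForm 𝔤 M M' := by
  have : pairPoly L L' = pairPoly M M' :=
    laurent_ext fun z => by rw [pairPoly_eval, pairPoly_eval, h]
  rw [resForm_apply, resForm_apply, this]

lemma resForm_comm (L L' : Loop (Double 𝔤)) : resForm 𝔤 L L' = resForm 𝔤 L' L :=
  resForm_congr fun _ => pairing_comm _ _

lemma resForm_lie (L M N : Loop (Double 𝔤)) : resForm 𝔤 ⁅L, M⁆ N = resForm 𝔤 L ⁅M, N⁆ :=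
  resForm_congr fun z => by rw [evalLoop_lie, evalLoop_lie, pairing_lie]

lemma resForm_monoLoop (m n : ℤ) (a b : Double 𝔤) :
    resForm 𝔤 (monoLoop m a) (monoLoop n b) = if m + n = -1 then Double.pairing a b else 0 := by
  have : pairPoly (monoLoop m a) (monoLoop n b) =
      LaurentPolynomial.C (Double.pairing a b) * LaurentPolynomial.T (m + n) :=
    laurent_ext fun z => by
      rw [pairPoly_eval, evalLoop_monoLoop, evalLoop_monoLoop, LaurentPolynomial.eval₂_C_mul_T,
        ← pairingLin_apply, map_smul, map_smul, LinearMap.smul_apply, zpow_add, Units.val_mul,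
        RingHom.id_apply, pairingLin_apply, smul_eq_mul, smul_eq_mul]
      ring
  rw [resForm_apply, this, ← LaurentPolynomial.single_eq_C_mul_T, AddMonoidAlgebra.coeff_single,
    Finsupp.single_apply]

lemma resForm_apply_monoLoop (L : Loop (Double 𝔤)) (m : ℤ) (b : Double 𝔤) :
    resForm 𝔤 L (monoLoop (-1 - m) b) = Double.pairing (coeffs L m) b := by
  induction L using loop_induction with
  | hmono n a =>
    rw [resForm_monoLoop, coeffs_monoLoop, Finsupp.single_apply]
    have : n + (-1 - m) = -1 ↔ n = m := by omega
    simp only [this]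
    split_ifs
    · rfl
    · rw [← pairingLin_apply, map_zero, LinearMap.zero_apply]
  | hzero => rw [map_zero, coeffs_zero, ← pairingLin_apply, Finsupp.zero_apply, map_zero]; rfl
  | hadd L L' h h' =>
    rw [map_add, LinearMap.add_apply, h, h', coeffs_add, Finsupp.add_apply]
    simp only [← pairingLin_apply, map_add, LinearMap.add_apply]

/-- The residue form is nondegenerate. -/
lemma eq_of_resForm {L L' : Loop (Double 𝔤)} (h : ∀ Y, resForm 𝔤 L Y = resForm 𝔤 L' Y) :
    L = L' := by
  rw [← sub_eq_zero]
  refine coeffs_injective (Finsupp.ext fun m => ?_)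
  rw [coeffs_zero, Finsupp.zero_apply]
  refine eq_zero_of_pairing fun b => ?_
  rw [← resForm_apply_monoLoop, map_sub, LinearMap.sub_apply, h, sub_self]

lemma gradedDualApply_add (ξ η : ℤ →₀ Module.Dual ℂ (Double 𝔤)) (Y : Loop (Double 𝔤)) :
    gradedDualApply (ξ + η) Y = gradedDualApply ξ Y + gradedDualApply η Y :=
  Finsupp.sum_add_index' (fun _ => rfl) (fun _ _ _ => rfl)

lemma gradedDualApply_single (i : ℤ) (f : Module.Dual ℂ (Double 𝔤)) (Y : Loop (Double 𝔤)) :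
    gradedDualApply (Finsupp.single i f) Y = f (coeffs Y i) :=
  Finsupp.sum_single_index rfl

/-- Every loop represents an element of the graded dual. -/
lemma exists_gradedDualApply_eq (M : Loop (Double 𝔤)) :
    ∃ ξ : ℤ →₀ Module.Dual ℂ (Double 𝔤), ∀ Y, gradedDualApply ξ Y = resForm 𝔤 M Y := by
  induction M using loop_induction with
  | hmono m a =>
    refine ⟨Finsupp.single (-1 - m) (pairingLin 𝔤 a), fun Y => ?_⟩
    have h := resForm_apply_monoLoop Y (-1 - m) a
    rw [sub_sub_cancel] at h
    rw [gradedDualApply_single, resForm_comm, h, pairing_comm, pairingLin_apply]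
  | hzero => exact ⟨0, fun Y => by rw [map_zero]; rfl⟩
  | hadd L L' h h' =>
    obtain ⟨ξ, hξ⟩ := h
    obtain ⟨η, hη⟩ := h'
    exact ⟨ξ + η, fun Y => by
      rw [gradedDualApply_add, hξ, hη, map_add, LinearMap.add_apply]⟩

lemma sharp_add [FiniteDimensional ℂ 𝔤] (f g : Module.Dual ℂ (Double 𝔤)) :
    Double.sharp (f + g) = Double.sharp f + Double.sharp g := by
  rw [← sub_eq_zero]
  refine eq_zero_of_pairing fun y => ?_
  simp only [← pairingLin_apply, map_sub, map_add, LinearMap.sub_apply, LinearMap.add_apply]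
  simp only [pairingLin_apply, Double.pairing_sharp, LinearMap.add_apply, sub_self]

lemma sharp_zero [FiniteDimensional ℂ 𝔤] : Double.sharp (0 : Module.Dual ℂ (Double 𝔤)) = 0 :=
  eq_zero_of_pairing fun y => by rw [Double.pairing_sharp]; rfl

/-- `⟨I ξ, Y⟩ = ξ(Y)`. -/
lemma resForm_gradIso [FiniteDimensional ℂ 𝔤] (ξ : ℤ →₀ Module.Dual ℂ (Double 𝔤))
    (Y : Loop (Double 𝔤)) : resForm 𝔤 (gradIso ξ) Y = gradedDualApply ξ Y := by
  induction ξ using Finsupp.induction_linear with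
  | zero =>
    have : gradIso (0 : ℤ →₀ Module.Dual ℂ (Double 𝔤)) = 0 :=
      coeffs_injective (by rw [gradIso, coeffs_ofCoeffs, Finsupp.sum_zero_index, coeffs_zero])
    rw [this, map_zero]
    rfl
  | single i f =>
    have h : gradIso (Finsupp.single i f) = monoLoop (-1 - i) (Double.sharp f) := by
      rw [gradIso, Finsupp.sum_single_index (by rw [sharp_zero, Finsupp.single_zero]),
        ofCoeffs_single]
    rw [h, resForm_comm, resForm_apply_monoLoop, pairing_comm, Double.pairing_sharp,
      gradedDualApply_single]
  | add ξ η hξ hη =>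
    have : gradIso (ξ + η) = gradIso ξ + gradIso η := coeffs_injective (by
      rw [coeffs_add, gradIso, gradIso, gradIso, coeffs_ofCoeffs, coeffs_ofCoeffs, coeffs_ofCoeffs]
      exact Finsupp.sum_add_index' (fun _ => by rw [sharp_zero, Finsupp.single_zero])
        (fun _ _ _ => by rw [sharp_add, Finsupp.single_add]))
    rw [this, map_add, LinearMap.add_apply, hξ, hη, gradedDualApply_add]

end Pairing

/-! ### Gradients of Casimir functions -/

lemma IsHolomorphic.differentiable_sum_add {V : Type*} [AddCommGroup V] [Module ℂ V] {ψ : V → ℂ}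
    (hψ : IsHolomorphic ψ) {n : ℕ} (v : Fin n → V) (Y : V) :
    Differentiable ℂ fun xs : (Fin n → ℂ) × ℂ => ψ (∑ i, xs.1 i • v i + xs.2 • Y) := by
  have h1 := hψ (n + 1) (Fin.snoc (α := fun _ => V) v Y)
  have h2 : Differentiable ℂ fun xs : (Fin n → ℂ) × ℂ =>
      (Fin.snoc (α := fun _ => ℂ) xs.1 xs.2 : Fin (n + 1) → ℂ) := by
    rw [differentiable_pi]
    intro i
    refine Fin.lastCases ?_ (fun i => ?_) i
    · simp only [Fin.snoc_last]
      exact differentiable_snd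
    · simp only [Fin.snoc_castSucc]
      fun_prop
  have h3 := h1.comp h2
  simpa only [Function.comp_def, Fin.sum_univ_castSucc, Fin.snoc_castSucc, Fin.snoc_last] using h3

section Gradient

variable {H : Type*} [Ring H] [HopfAlgebra ℂ H] {𝒜 : ℕ → Submodule ℂ H} [GradedAlgebra 𝒜]
  [ConnectedGradedHopf 𝒜] {k : ℕ}

lemma resForm_invariant {L L' M M' : Loop (Double (truncLie 𝒜 k))} {g : ℂˣ → DoubleGroup 𝒜 k}
    (hL : ∀ z, evalLoop z L' = doubleAdHom 𝒜 k (g z) (evalLoop z L))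
    (hM : ∀ z, evalLoop z M' = doubleAdHom 𝒜 k (g z) (evalLoop z M)) :
    resForm _ L' M' = resForm _ L M :=
  resForm_congr fun z => by rw [hL, hM, pairing_doubleAdHom]

variable [∀ n, FiniteDimensional ℂ (𝒜 n)] {ψ : Loop (Double (truncLie 𝒜 k)) → ℂ}
  {dψ : Loop (Double (truncLie 𝒜 k)) → ℤ →₀ Module.Dual ℂ (Double (truncLie 𝒜 k))}

namespace IsCasimir

variable (hψ : IsCasimir 𝒜 k ψ dψ)
include hψ

lemma hasDerivAt (L Y : Loop (Double (truncLie 𝒜 k))) :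
    HasDerivAt (fun s : ℂ => ψ (L + s • Y)) (resForm _ (gradIso (dψ L)) Y) 0 := by
  rw [resForm_gradIso]
  exact hψ.differential L Y

/-- The coefficients of the gradient of a Casimir function are partial derivatives. -/
lemma coeffLipschitz_grad : CoeffLipschitz fun L => gradIso (dψ L) := by
  intro n p v m l
  set Y : Loop (Double (truncLie 𝒜 k)) := monoLoop (-1 - m) (Double.sharp l) with hY
  have h : (fun x : Fin n → ℂ => l (coeffs (gradIso (dψ (∑ i, x i • monoLoop (p i) (v i)))) m)) =
      fun x => deriv (fun s : ℂ => ψ (∑ i, x i • monoLoop (p i) (v i) + s • Y)) 0 := by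
    ext1 x
    rw [(hψ.hasDerivAt _ Y).deriv, hY, resForm_apply_monoLoop, pairing_comm, Double.pairing_sharp]
  have h' := locallyLipschitz_deriv
    (hψ.holomorphic.differentiable_sum_add (fun i => monoLoop (p i) (v i)) Y)
  rw [← h] at h'
  exact h'

/-- A Casimir function is constant along the orbits of one-parameter subgroups, so its gradient at
`L` commutes with `L`. -/
lemma lie_grad (L : Loop (Double (truncLie 𝒜 k))) : ⁅L, gradIso (dψ L)⁆ = 0 := by
  refine eq_of_resForm fun Y => ?_
  obtain ⟨e, he⟩ := exists_isExpLoop Y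
  have he0 : ∀ z, e 0 z = 1 := fun z =>
    oneParameter_zero (γ := fun s => e s z) fun s t => he.apply_add s t z
  have h1 : (fun t z => doubleAdHom 𝒜 k (e t z)) ∈
      polyLoops Set.univ (Module.End ℂ (Double (truncLie 𝒜 k))) :=
    doubleAdHom_mem he.ad_base_mem he.ad_base_inv_mem he.vec_mem (add_mem_univ Set.univ Set.univ)
  have h2 := polyLoops_bilin
    (LinearMap.id : Module.End ℂ (Double (truncLie 𝒜 k)) →ₗ[ℂ] _ →ₗ[ℂ] Double (truncLie 𝒜 k))
    (add_mem_univ Set.univ Set.univ) h1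
    (evalLoop_mem_polyLoops L (S := Set.univ) fun m _ => Set.mem_univ m)
  obtain ⟨c, hc, hc'⟩ := exists_loop_curve h2
  obtain ⟨v, hv⟩ := hc' 0
  have hc0 : c 0 = L := evalLoop_injective fun z => by
    rw [hc, he0, map_one]
    rfl
  have hv' : v = -⁅Y, L⁆ := evalLoop_injective fun z => by
    have h3 := hv.map (evalLin _ z)
    simp only [evalLin_apply, hc] at h3
    have h4 := (he.hasVelocity_doubleAdHom 0 z).map (LinearMap.applyₗ (evalLoop z L))
    rw [he0, map_one, one_mul] at h4
    rw [h3.unique h4, evalLoop_neg, evalLoop_lie]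
    rfl
  have h3 : HasDerivAt (fun s => ψ (c s)) (resForm _ (gradIso (dψ L)) v) 0 := by
    refine hψ.holomorphic.comp_hasDerivAt hv ?_
    rw [hc0]
    exact hψ.hasDerivAt L v
  have h4 : ∀ s, ψ (c s) = ψ L := fun s => hψ.invariant (e s) (he.isLaurentLoop s) L (c s) (hc s)
  simp only [h4] at h3
  have h5 := h3.unique (hasDerivAt_const 0 (ψ L))
  rw [hv', map_neg, neg_eq_zero, resForm_comm, resForm_lie, resForm_comm] at h5
  rw [h5, map_zero, LinearMap.zero_apply]

/-- The gradient of a Casimir function is equivariant. -/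
lemma grad_equivariant {g : ℂˣ → DoubleGroup 𝒜 k} (hg : IsLaurentLoop (doubleCoords 𝒜 k) g)
    (hg' : ActsOnLoops (doubleAdHom 𝒜 k) g) {L L' : Loop (Double (truncLie 𝒜 k))}
    (hL : ∀ z, evalLoop z L' = doubleAdHom 𝒜 k (g z) (evalLoop z L)) (z : ℂˣ) :
    evalLoop z (gradIso (dψ L')) = doubleAdHom 𝒜 k (g z) (evalLoop z (gradIso (dψ L))) := by
  obtain ⟨W, hW⟩ := hg'.1 (gradIso (dψ L))
  rw [← hW]
  congr 1
  refine eq_of_resForm fun Y => ?_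
  obtain ⟨Y', hY'⟩ := hg'.2 Y
  have hY : ∀ z, evalLoop z Y = doubleAdHom 𝒜 k (g z) (evalLoop z Y') := fun z => by
    rw [hY', ← Module.End.mul_apply, ← map_mul, mul_inv_cancel, map_one, Module.End.one_apply]
  rw [resForm_invariant hW hY]
  have h1 : ∀ s : ℂ, ψ (L' + s • Y) = ψ (L + s • Y') := fun s =>
    hψ.invariant g hg _ _ fun z => by
      rw [evalLoop_add, evalLoop_add, evalLoop_smul, evalLoop_smul, hL, hY, ← map_smul, ← map_add]
      rfl
  have h2 := hψ.hasDerivAt L' Y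
  simp only [h1] at h2
  exact h2.unique (hψ.hasDerivAt L Y')

end IsCasimir

end Gradient

/-! ### The quadratic Casimir functions -/

section Quadratic

variable {H : Type*} [Ring H] [HopfAlgebra ℂ H] (𝒜 : ℕ → Submodule ℂ H) [GradedAlgebra 𝒜]
  [ConnectedGradedHopf 𝒜] (k : ℕ)

lemma evalLoop_T_smul {𝔩 : Type*} [LieRing 𝔩] [LieAlgebra ℂ 𝔩] (p : ℤ) (L : Loop 𝔩) (z : ℂˣ) :
    evalLoop z ((LaurentPolynomial.T p : AddMonoidAlgebra ℂ ℤ) • L) =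
      ((z ^ p : ℂˣ) : ℂ) • evalLoop z L := by
  induction L using loop_induction with
  | hmono n v =>
    have : (LaurentPolynomial.T p : AddMonoidAlgebra ℂ ℤ) • monoLoop n v = monoLoop (p + n) v := by
      rw [monoLoop, TensorProduct.smul_tmul', smul_eq_mul, LaurentPolynomial.T,
        AddMonoidAlgebra.single_mul_single, one_mul]
      rfl
    rw [this, evalLoop_monoLoop, evalLoop_monoLoop, zpow_add, Units.val_mul, mul_smul]
  | hzero => simp
  | hadd L L' h h' => rw [smul_add, evalLoop_add, h, h', evalLoop_add, smul_add]

/-- Multiplication by `λ ^ p`. -/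
def shiftLin (𝔩 : Type*) [LieRing 𝔩] [LieAlgebra ℂ 𝔩] (p : ℤ) : Loop 𝔩 →ₗ[ℂ] Loop 𝔩 where
  toFun L := (LaurentPolynomial.T p : AddMonoidAlgebra ℂ ℤ) • L
  map_add' _ _ := smul_add _ _ _
  map_smul' c L := evalLoop_injective fun z => by
    simp only [evalLoop_T_smul, evalLoop_smul, RingHom.id_apply]
    rw [smul_comm]

lemma resCasimir_eq {𝔤 : Type*} [LieRing 𝔤] [LieAlgebra ℂ 𝔤] (m n : ℤ) (L : Loop (Double 𝔤)) :
    resCasimir m n L = resForm 𝔤 (shiftLin _ (m + n + n) L) L := by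
  have h : LaurentPolynomial.T m * loopSquare ((LaurentPolynomial.T n : AddMonoidAlgebra ℂ ℤ) • L) =
      pairPoly (shiftLin _ (m + n + n) L) L := laurent_ext fun z => by
    have h1 : loopSquare ((LaurentPolynomial.T n : AddMonoidAlgebra ℂ ℤ) • L) =
        pairPoly (shiftLin _ n L) (shiftLin _ n L) := rfl
    rw [h1, map_mul, pairPoly_eval, pairPoly_eval, LaurentPolynomial.eval₂_T]
    simp only [shiftLin, LinearMap.coe_mk, AddHom.coe_mk, evalLoop_T_smul, ← pairingLin_apply,
      map_smul, LinearMap.smul_apply, smul_eq_mul, zpow_add, Units.val_mul]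
    ring
  exact congrArg (fun p : LaurentPolynomial ℂ => p.coeff (-1)) h

lemma exists_isCasimir_resCasimir (m n : ℤ) : ∃ dψ, IsCasimir 𝒜 k (resCasimir m n) dψ := by
  set B := (resForm (truncLie 𝒜 k)) ∘ₗ shiftLin _ (m + n + n) with hB
  have hψ : ∀ L, resCasimir m n L = B L L := resCasimir_eq m n
  have hsymm : ∀ L M, B L M = B M L := fun L M => by
    simp only [hB, LinearMap.comp_apply]
    rw [resForm_comm]
    refine resForm_congr fun z => ?_
    simp only [shiftLin, LinearMap.coe_mk, AddHom.coe_mk, evalLoop_T_smul, ← pairingLin_apply,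
      map_smul, LinearMap.smul_apply]
  choose ξ hξ using fun L => exists_gradedDualApply_eq
    (𝔤 := truncLie 𝒜 k) ((2 : ℂ) • shiftLin _ (m + n + n) L)
  refine ⟨ξ, ?_, fun L Y => ?_, fun g hg L L' hL => ?_⟩
  · intro N v
    simp only [hψ, map_sum, map_smul, LinearMap.sum_apply, LinearMap.smul_apply]
    fun_prop
  · have h1 : ∀ s : ℂ, resCasimir m n (L + s • Y) = B L L + s * (2 * B L Y) + s ^ 2 * B Y Y := by
      intro s
      simp only [hψ, map_add, map_smul, LinearMap.add_apply, LinearMap.smul_apply, smul_eq_mul,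
        hsymm Y L]
      ring
    simp only [h1, hξ, map_smul, LinearMap.smul_apply, smul_eq_mul]
    have h2 := (((hasDerivAt_id (0 : ℂ)).mul_const (2 * B L Y)).const_add (B L L)).add
      ((hasDerivAt_pow 2 (0 : ℂ)).mul_const (B Y Y))
    refine h2.congr_deriv ?_
    simp [hB]
  · rw [resCasimir_eq, resCasimir_eq]
    refine resForm_invariant (g := g) (fun z => ?_) hL
    simp only [shiftLin, LinearMap.coe_mk, AddHom.coe_mk, evalLoop_T_smul, hL, map_smul]
    rfl

end Quadratic

/-! ### The Lax equations -/

section Projection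

variable {𝔩 𝔩' : Type*} [LieRing 𝔩] [LieAlgebra ℂ 𝔩] [LieRing 𝔩'] [LieAlgebra ℂ 𝔩']

lemma mapLoop_lie {f : 𝔩 →ₗ[ℂ] 𝔩'} (hf : ∀ x y, f ⁅x, y⁆ = ⁅f x, f y⁆) (L L' : Loop 𝔩) :
    mapLoop f ⁅L, L'⁆ = ⁅mapLoop f L, mapLoop f L'⁆ :=
  evalLoop_injective fun z => by
    rw [evalLoop_mapLoop, evalLoop_lie, hf, evalLoop_lie, evalLoop_mapLoop, evalLoop_mapLoop]

lemma mapLoop_half_rMat (f : 𝔩 →ₗ[ℂ] 𝔩') (L : Loop 𝔩) :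
    mapLoop f ((1 / 2 : ℂ) • rMat L) = (1 / 2 : ℂ) • rMat (mapLoop f L) :=
  coeffs_injective (Finsupp.ext fun m => by
    rw [coeffs_mapLoop, coeffs_half_rMat, coeffs_half_rMat, coeffs_mapLoop, map_smul])

lemma mapLoop_proj_inl {𝔤 : Type*} [LieRing 𝔤] [LieAlgebra ℂ 𝔤] (L : Loop 𝔤) :
    mapLoop Double.proj (mapLoop Double.inl L) = L :=
  evalLoop_injective fun z => by
    rw [evalLoop_mapLoop, evalLoop_mapLoop]
    rfl

/-- A loop of endomorphisms of a finite-dimensional space is Laurent polynomial if it is so when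
applied to every vector. -/
lemma end_mem_polyLoops [FiniteDimensional ℂ 𝔩] {F : ℂˣ → Module.End ℂ 𝔩}
    (hF : ∀ v, ∃ L : Loop 𝔩, ∀ z, evalLoop z L = F z v) :
    (fun _ z => F z) ∈ polyLoops Set.univ (Module.End ℂ 𝔩) := by
  let b := Module.finBasis ℂ 𝔩
  choose L hL using fun i => hF (b i)
  have h1 : (fun (_ : ℝ) z => F z) = ∑ i, fun (_ : ℝ) z =>
      LinearMap.smulRightₗ (b.coord i) (evalLoop z (L i)) := by
    ext1 t; ext1 z
    refine b.ext fun j => ?_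
    simp [Finset.sum_apply, hL, Finsupp.single_apply]
  rw [h1]
  exact Submodule.sum_mem _ fun i _ => polyLoops_map (LinearMap.smulRightₗ (b.coord i))
    (evalLoop_mem_polyLoops (L i) (S := Set.univ) fun m _ => Set.mem_univ m)

end Projection

section Lax

variable {H : Type*} [Ring H] [HopfAlgebra ℂ H] {𝒜 : ℕ → Submodule ℂ H} [GradedAlgebra 𝒜]
  [ConnectedGradedHopf 𝒜] {k : ℕ}

variable (𝒜 k) in
/-- The inclusion of `G⁽ᵏ⁾` into `G̃⁽ᵏ⁾`. -/
def inclDouble (g : truncGroup 𝒜 k) : DoubleGroup 𝒜 k := ⟨g, 0⟩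

lemma doubleAdHom_inclDouble_inl (g : truncGroup 𝒜 k) (Y : truncLie 𝒜 k) :
    doubleAdHom 𝒜 k (inclDouble 𝒜 k g) (Double.inl Y) = Double.inl (groupAd 𝒜 k g Y) := by
  refine Double.ext rfl ?_
  rw [doubleAdHom_snd]
  change groupCoAd 𝒜 k g 0 - ⁅_, (0 : Module.Dual ℂ (truncLie 𝒜 k))⁆ = 0
  rw [lie_zero, groupCoAd_eq, map_zero, sub_zero]

lemma isLaurentLoop_inclDouble {g : ℂˣ → truncGroup 𝒜 k}
    (hg : IsLaurentLoop (groupCoords 𝒜 k) g) :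
    IsLaurentLoop (doubleCoords 𝒜 k) fun z => inclDouble 𝒜 k (g z) := by
  rintro (x | Z)
  · exact hg x
  · exact ⟨0, fun z => by rw [map_zero]; rfl⟩

variable [∀ n, FiniteDimensional ℂ (𝒜 n)]

lemma actsOnLoops_inclDouble {g : ℂˣ → truncGroup 𝒜 k} (hg : ActsOnLoops (groupAd 𝒜 k) g) :
    ActsOnLoops (doubleAdHom 𝒜 k) fun z => inclDouble 𝒜 k (g z) := by
  have h1 : (fun _ z => groupAd 𝒜 k (g z)) ∈
      polyLoops Set.univ (Module.End ℂ (truncLie 𝒜 k)) := end_mem_polyLoops fun v => by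
    obtain ⟨L, hL⟩ := hg.1 (monoLoop 0 v)
    exact ⟨L, fun z => by rw [hL, evalLoop_monoLoop, zpow_zero, Units.val_one, one_smul]⟩
  have h2 : (fun _ z => groupAd 𝒜 k (g z)⁻¹) ∈
      polyLoops Set.univ (Module.End ℂ (truncLie 𝒜 k)) := end_mem_polyLoops fun v => by
    obtain ⟨L, hL⟩ := hg.2 (monoLoop 0 v)
    exact ⟨L, fun z => by rw [hL, evalLoop_monoLoop, zpow_zero, Units.val_one, one_smul]⟩
  refine actsOnLoops_of_mem
    (doubleAdHom_mem h1 h2 (Submodule.zero_mem _) (add_mem_univ Set.univ Set.univ))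
    (doubleAdHom_mem h2 ?_ ?_ (add_mem_univ Set.univ Set.univ))
  · simpa only [DoubleGroup.inv_base, inv_inv, inclDouble] using h1
  · convert Submodule.zero_mem _ using 1
    ext1 t; ext1 z
    rw [DoubleGroup.inv_vec, groupCoAd_eq]
    exact neg_eq_zero.2 (map_zero _)

variable {ψ : Loop (Double (truncLie 𝒜 k)) → ℂ}
  {dψ : Loop (Double (truncLie 𝒜 k)) → ℤ →₀ Module.Dual ℂ (Double (truncLie 𝒜 k))}

/-- The Lax flow on the loop algebra of the double. -/
lemma IsCasimir.exists_solved_double (hψ : IsCasimir 𝒜 k ψ dψ)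
    (L₀ : Loop (Double (truncLie 𝒜 k))) : ∃ gm gp L,
      SolvedByFactorization (doubleCoords 𝒜 k) (doubleAd 𝒜 k) (gradIso (dψ L₀))
        (fun L => ⁅L, (1 / 2 : ℂ) • rMat (gradIso (dψ L))⁆) L₀ gm gp L := by
  obtain ⟨e, he⟩ := exists_isExpLoop (gradIso (dψ L₀))
  obtain ⟨gm, gp, hg, hE⟩ := exists_doubleFactorPair he
  obtain ⟨L, hL⟩ := (hg.isBirkhoffCurve he hE).solvedByFactorization doubleAdHom_lie
    (Ξ := fun L => gradIso (dψ L)) (fun g hg hg' L L' hL => hψ.grad_equivariant hg hg' hL)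
    hψ.lie_grad hψ.coeffLipschitz_grad rfl
  exact ⟨gm, gp, L, hL⟩

/-- The Lax flow on the loop algebra of `𝔤⁽ᵏ⁾`. -/
lemma IsCasimir.exists_solved_group (hψ : IsCasimir 𝒜 k ψ dψ) (L₀ : Loop (truncLie 𝒜 k)) :
    ∃ gm gp L, SolvedByFactorization (groupCoords 𝒜 k) (fun g => groupAd 𝒜 k g)
      (mapLoop Double.proj (gradIso (dψ (mapLoop Double.inl L₀))))
      (fun L => ⁅L, mapLoop Double.proj
        ((1 / 2 : ℂ) • rMat (gradIso (dψ (mapLoop Double.inl L))))⁆) L₀ gm gp L := by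
  set Ξ : Loop (truncLie 𝒜 k) → Loop (truncLie 𝒜 k) := fun L =>
    mapLoop Double.proj (gradIso (dψ (mapLoop Double.inl L))) with hΞ
  obtain ⟨gm, gp, hg, hE⟩ := exists_factorPair_groupExp (Ξ L₀)
  have hcomm : ∀ L, ⁅L, Ξ L⁆ = 0 := fun L => by
    have h := congrArg (mapLoop Double.proj) (hψ.lie_grad (mapLoop Double.inl L))
    rwa [mapLoop_lie (fun _ _ => rfl), mapLoop_proj_inl, map_zero] at h
  have hLip : CoeffLipschitz Ξ := by
    intro n p v m l
    have h := hψ.coeffLipschitz_grad n p (fun i => Double.inl (v i)) m (l ∘ₗ Double.proj)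
    simp only [hΞ, coeffs_mapLoop, map_sum, map_smul, mapLoop_monoLoop]
    exact h
  have hequi : ∀ g, IsLaurentLoop (groupCoords 𝒜 k) g → ActsOnLoops (groupAd 𝒜 k) g →
      ∀ L L', (∀ z, evalLoop z L' = groupAd 𝒜 k (g z) (evalLoop z L)) →
      ∀ z, evalLoop z (Ξ L') = groupAd 𝒜 k (g z) (evalLoop z (Ξ L)) := by
    intro g hg hg' L L' hL z
    have h := hψ.grad_equivariant (isLaurentLoop_inclDouble hg) (actsOnLoops_inclDouble hg')
      (L := mapLoop Double.inl L) (L' := mapLoop Double.inl L') (fun z => by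
        rw [evalLoop_mapLoop, evalLoop_mapLoop, hL, doubleAdHom_inclDouble_inl]) z
    simp only [hΞ, evalLoop_mapLoop, h]
    rfl
  obtain ⟨L, hL⟩ := (hg.isBirkhoffCurve hE).solvedByFactorization groupAd_lie hequi hcomm hLip rfl
  refine ⟨gm, gp, L, ?_⟩
  simp only [mapLoop_half_rMat]
  exact hL

end Lax

end HopfLax

end

theorem theorem5p4 {H : Type*} [Ring H] [HopfAlgebra ℂ H] (𝒜 : ℕ → Submodule ℂ H)
    [GradedAlgebra 𝒜] [ConnectedGradedHopf 𝒜] [∀ n, FiniteDimensional ℂ (𝒜 n)] (k : ℕ) :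
    -- the residue functions are Casimir functions
    (∀ m n : ℤ, ∃ dψ, IsCasimir 𝒜 k (resCasimir m n) dψ) ∧
    ∀ (ψ : Loop (Double (truncLie 𝒜 k)) → ℂ)
      (dψ : Loop (Double (truncLie 𝒜 k)) → ℤ →₀ Module.Dual ℂ (Double (truncLie 𝒜 k))),
      IsCasimir 𝒜 k ψ dψ →
      -- the flow on the loop algebra of the double, and its projection
      (∀ L₀ : Loop (Double (truncLie 𝒜 k)), ∃ gm gp L,
        SolvedByFactorization (doubleCoords 𝒜 k) (doubleAd 𝒜 k) (gradIso (dψ L₀))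
          (fun L => ⁅L, (1 / 2 : ℂ) • rMat (gradIso (dψ L))⁆) L₀ gm gp L ∧
        ∀ t, HasVelocity (fun s => mapLoop Double.proj (L s))
          ⁅mapLoop Double.proj (L t),
            mapLoop Double.proj ((1 / 2 : ℂ) • rMat (gradIso (dψ (L t))))⁆ t) ∧
      -- the flow on the loop algebra of the truncated Lie algebra itself
      (∀ L₀ : Loop (truncLie 𝒜 k), ∃ gm gp L,
        SolvedByFactorization (groupCoords 𝒜 k) (fun g => groupAd 𝒜 k g)
          (mapLoop Double.proj (gradIso (dψ (mapLoop Double.inl L₀))))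
          (fun L => ⁅L, mapLoop Double.proj
            ((1 / 2 : ℂ) • rMat (gradIso (dψ (mapLoop Double.inl L))))⁆) L₀ gm gp L) := by
  refine ⟨exists_isCasimir_resCasimir 𝒜 k, fun ψ dψ hψ => ⟨fun L₀ => ?_, hψ.exists_solved_group⟩⟩
  obtain ⟨gm, gp, L, hL⟩ := hψ.exists_solved_double L₀
  refine ⟨gm, gp, L, hL, fun t => ?_⟩
  rw [← mapLoop_lie fun _ _ => rfl]
  exact (hL.2.2.2.2.2.2.2.2.2.1 t).map (mapLoop Double.proj)
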